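/- Let $\kappa_1,\kappa_2,\kappa_3>0$. For $\mathbf u=(u^1,u^2,u^3)\in H^1(\mathbb R^5;\mathbb C^3)\setminus\{0\}$ put $$M(\mathbf u)=\tfrac12\|u^1\|_{L^2}^2+\tfrac12\|u^2\|_{L^2}^2+\|u^3\|_{L^2}^2,\qquad K(\mathbf u)=\sum_{j=1}^3\tfrac{\kappa_j}{2}\|\nabla u^j\|_{L^2}^2,\qquad V(\mathbf u)=\operatorname{Re}\int_{\mathbb R^5}\overline{u^1}\,\overline{u^2}\,u^3\,dx,$$ $$J(\mathbf u)=M(\mathbf u)^{1/2}K(\mathbf u)^{5/2}V(\mathbf u)^{-2}\in(0,\infty],$$ with $J(\mathbf u)=\infty$ if $V(\mathbf u)=0$, and let $J_{\min}$ be the infimum of $J$ over $H^1(\mathbb R^5;\mathbb C^3)\setminus\{0\}$. Call $\mathbf Q=(\phi_1,\phi_2,\phi_3)\in H^1(\mathbb R^5;\mathbb C^3)\setminus\{0\}$ a ground state if each $\phi_j$ is real-valued, nonnegative and radial about the origin (almost everywhere), $J(\mathbf Q)=J_{\min}$, and $$\phi_1-\kappa_1\Delta\phi_1=\phi_2\phi_3,\qquad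 \phi_2-\kappa_2\Delta\phi_2=\phi_1\phi_3,\qquad 2\phi_3-\kappa_3\Delta\phi_3=\phi_1\phi_2$$ in the sense of distributions on $\mathbb R^5$. Then: 1. $J_{\min}<\infty$, and there is $\mathbf u\in H^1(\mathbb R^5;\mathbb C^3)\setminus\{0\}$ with $J(\mathbf u)=J_{\min}$. 2. For every $\mathbf u\in H^1(\mathbb R^5;\mathbb C^3)\setminus\{0\}$ with $J(\mathbf u)=J_{\min}$ there are a ground state $\mathbf Q=(\phi_1,\phi_2,\phi_3)$, real numbers $m,n>0$ and $\theta_1,\theta_2,\theta_3$, and a point $x_0\in\mathbb R^5$ such that, for $j=1,2,3$, $$u^j(x)=e^{i\theta_j}\,m\,\phi_j\bigl(n(x-x_0)\bigr)\quad\text{for almost every }x\in\mathbb R^5 .$$ 3. Any two ground states have the same mass $M$. -/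

import Mathlib

open MeasureTheory
open scoped ENNReal ContDiff

noncomputable section

namespace NLSSystem

/-- The space `ℝ⁵` with its Euclidean norm. -/
abbrev E5 : Type := EuclideanSpace ℝ (Fin 5)

/-- Real-valued test functions: `C^∞` with compact support. -/
def IsTest (ψ : E5 → ℝ) : Prop :=
  ContDiff ℝ ∞ ψ ∧ HasCompactSupport ψ

/-- `g` is the weak partial derivative of `u` in the `i`-th coordinate direction
(meant for `u`, `g` locally integrable). -/
def HasWeakPartial (i : Fin 5) (u g : E5 → ℂ) : Prop :=
  ∀ ψ : E5 → ℝ, IsTest ψ →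
    ∫ x, (fderiv ℝ ψ x (EuclideanSpace.single i 1)) • u x = -∫ x, ψ x • g x

/-- `u ∈ H¹(ℝ⁵; ℂ)`: `u` is in `L²` and all its first weak partial derivatives are in `L²`. -/
def MemH1 (u : E5 → ℂ) : Prop :=
  MemLp u 2 ∧ ∀ i : Fin 5, ∃ g : E5 → ℂ, MemLp g 2 ∧ HasWeakPartial i u g

open Classical in
/-- The `L²` weak partial derivative of `u`, which is unique up to null sets
(and `0` by convention if there is none). -/
def weakPartial (i : Fin 5) (u : E5 → ℂ) : E5 → ℂ :=
  if h : ∃ g : E5 → ℂ, MemLp g 2 ∧ HasWeakPartial i u g then h.choose else 0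

/-- The squared norm `‖u‖²` of `L²(ℝ⁵)`. -/
def normL2Sq (u : E5 → ℂ) : ℝ := ∫ x, ‖u x‖ ^ 2

/-- The squared homogeneous Sobolev norm `‖∇u‖²` in `L²(ℝ⁵)`. -/
def normH1DotSq (u : E5 → ℂ) : ℝ := ∑ i : Fin 5, ∫ x, ‖weakPartial i u x‖ ^ 2

/-- The set `H¹(ℝ⁵; ℂ³) ∖ {0}`; functions are identified up to null sets. -/
def H1Nonzero : Set (Fin 3 → E5 → ℂ) :=
  {u | (∀ j, MemH1 (u j)) ∧ ¬ ∀ j, ∀ᵐ x, u j x = 0}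

/-- The mass `M(u)`. -/
def M (u : Fin 3 → E5 → ℂ) : ℝ :=
  1 / 2 * normL2Sq (u 0) + 1 / 2 * normL2Sq (u 1) + normL2Sq (u 2)

/-- The kinetic energy `K(u)`. -/
def K (κ : Fin 3 → ℝ) (u : Fin 3 → E5 → ℂ) : ℝ :=
  ∑ j, κ j / 2 * normH1DotSq (u j)

/-- The potential energy `V(u)`. -/
def V (u : Fin 3 → E5 → ℂ) : ℝ :=
  (∫ x, starRingEnd ℂ (u 0 x) * starRingEnd ℂ (u 1 x) * u 2 x).re

/-- The Weinstein functional `J = M^{1/2} K^{5/2} V^{-2}`, with value `∞` where `V = 0`.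
(On `H¹ ∖ {0}` both `M` and `K` are positive, so `0 / 0` does not occur.) -/
def J (κ : Fin 3 → ℝ) (u : Fin 3 → E5 → ℂ) : ℝ≥0∞ :=
  ENNReal.ofReal (M u ^ (1 / 2 : ℝ) * K κ u ^ (5 / 2 : ℝ)) / ENNReal.ofReal (V u ^ 2)

/-- The infimum of `J` over `H¹ ∖ {0}`. -/
def Jmin (κ : Fin 3 → ℝ) : ℝ≥0∞ := ⨅ u ∈ H1Nonzero, J κ u

/-- `a φ - k Δφ = F` on `ℝ⁵` in the sense of distributions. -/
def SolvesWeakly (a k : ℝ) (φ F : E5 → ℂ) : Prop :=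
  ∀ ψ : E5 → ℝ, IsTest ψ →
    ∫ x, (a * ψ x - k * Laplacian.laplacian ψ x) • φ x = ∫ x, ψ x • F x

/-- The elliptic system of the ground state. -/
def SolvesEllipticSystem (κ : Fin 3 → ℝ) (φ : Fin 3 → E5 → ℂ) : Prop :=
  SolvesWeakly 1 (κ 0) (φ 0) (fun x => φ 1 x * φ 2 x) ∧
  SolvesWeakly 1 (κ 1) (φ 1) (fun x => φ 0 x * φ 2 x) ∧
  SolvesWeakly 2 (κ 2) (φ 2) (fun x => φ 0 x * φ 1 x)

/-- `φ` is real-valued and nonnegative almost everywhere. -/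
def IsNonneg (φ : E5 → ℂ) : Prop := ∀ᵐ x, 0 ≤ (φ x).re ∧ (φ x).im = 0

/-- `φ` is radial (about the origin), up to a null set. -/
def IsRadial (φ : E5 → ℂ) : Prop := ∃ f : ℝ → ℂ, ∀ᵐ x, φ x = f ‖x‖

/-- Ground states: nonzero nonnegative radial `H¹` solutions of the elliptic system
at which `J` takes its minimal value. -/
structure IsGroundState (κ : Fin 3 → ℝ) (Q : Fin 3 → E5 → ℂ) : Prop where
  mem : Q ∈ H1Nonzero
  nonneg : ∀ j, IsNonneg (Q j)
  radial : ∀ j, IsRadial (Q j)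
  solves : SolvesEllipticSystem κ Q
  minimal : J κ Q = Jmin κ

end NLSSystem

end

/-!
Write `IsOpt κ u` for triples which are optimal in the Gagliardo–Nirenberg type inequality
`V² ≤ C M^{1/2} K^{5/2}`; these are exactly the minimizers of `J` (`isOpt_of_J_eq`, `IsOpt.J_eq`).

*Existence* (`exists_isOpt`). Scaling normalizes a maximizing sequence for `V` to bounded mass and
energy. By the Gagliardo–Nirenberg inequality (`exists_gagliardo_nirenberg`) and local compactness
(`rellich`) some translates have a nonzero weak limit (`nonvanishing`); `M`, `K` and `V` all split
along the weakly convergent sequence (`tendsto_V_sub`), and strict superadditivity of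
`M^{1/4} K^{5/4}` (`eq_one_of_le_add`) forces the limit to be optimal.

*Symmetry.* The Dirichlet integral is described without derivatives, through the integrals of
`|u(x - h) - u(x)|²` over all `x` and all `h` in a small ball (`dq_le`, `memH1_of_dq_le_ofReal`). In
this form it visibly does not increase under `u ↦ |u|` and under polarization, the two-point
rearrangement with respect to a hyperplane, while `V` does not decrease. Hence moduli and
polarizations of optimal triples are optimal (`IsOpt.norm`, `IsOpt.pol`), and all of these solve an
Euler–Lagrange system (`IsOpt.solvesWeakly`). A comparison principle through Gaussian averages
(`SolvesReal.gauss_le`) gives the strong maximum principle for such weak solutions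
(`SolvesReal.ae_pos`) without any regularity theory. It has two consequences:

* the components of an optimal triple have constant phases (`exists_phase`);
* for every hyperplane an optimal triple of nonnegative functions lies on one side of its reflection
  (`IsOpt.reflection_alternative`). If the hyperplane bisects the mass of the first component, then
  the triple is symmetric in it (`IsOpt.comp_refl_ae_eq`).

After a translation the coordinate hyperplanes bisect, so the triple is even, so every hyperplane
through the origin bisects, and the triple is radial (`IsOpt.exists_radial`). No rearrangement
inequality beyond the two-point one is needed.

*Scale.* Rescaling an optimal triple to `K = 5M`, `V = 4M` turns the Euler–Lagrange system into the
elliptic system of ground states (`IsOpt.solvesEllipticSystem`, `IsOpt.exists_groundState`).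
Conversely, a ground state satisfies both its Euler–Lagrange system and the elliptic system. If
`K ≠ 5M` or `V ≠ 4M`, elimination of the nonlinearity would make its first component a nonnegative
square integrable eigenfunction of the Laplacian, which has to vanish
(`SolvesReal.eq_zero_of_homogeneous`). Thus `K = 5M` and `V = 4M` (`IsGroundState.isOpt_and_energies`),
and `J = Jmin` determines the mass (`IsGroundState.M_eq`).
-/

noncomputable section

namespace NLSSystem

open Filter Topology

/-! ### Square integrable functions and weak derivatives -/

/-- The squared `L²` norm as an extended nonnegative real. -/
def lsq {F : Type*} [NormedAddCommGroup F] (u : E5 → F) : ℝ≥0∞ := ∫⁻ x, ‖u x‖ₑ ^ 2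

lemma lsq_eq_eLpNorm {F : Type*} [NormedAddCommGroup F] (u : E5 → F) :
    lsq u = eLpNorm u 2 volume ^ 2 := by
  rw [eLpNorm_eq_lintegral_rpow_enorm_toReal (by norm_num) (by norm_num), lsq,
    ← ENNReal.rpow_natCast, ← ENNReal.rpow_mul]
  simp

lemma memLp_two_iff_lsq {F : Type*} [NormedAddCommGroup F] {u : E5 → F} :
    MemLp u 2 ↔ AEStronglyMeasurable u ∧ lsq u < ⊤ := by
  rw [lsq_eq_eLpNorm, MemLp]
  refine and_congr_right fun _ => ?_
  simp [ENNReal.pow_lt_top_iff]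

lemma integrable_sq {F : Type*} [NormedAddCommGroup F] {u : E5 → F} (hu : MemLp u 2) :
    Integrable (fun x => ‖u x‖ ^ 2) := hu.integrable_norm_pow two_ne_zero

lemma lsq_eq_ofReal {F : Type*} [NormedAddCommGroup F] {u : E5 → F} (hu : MemLp u 2) :
    lsq u = ENNReal.ofReal (∫ x, ‖u x‖ ^ 2) := by
  rw [ofReal_integral_eq_lintegral_ofReal (integrable_sq hu) (ae_of_all _ fun x => by positivity)]
  refine lintegral_congr fun x => ?_
  rw [ENNReal.ofReal_pow (norm_nonneg _), ofReal_norm]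

lemma normL2Sq_nonneg (u : E5 → ℂ) : 0 ≤ normL2Sq u := integral_nonneg fun x => by positivity

lemma normH1DotSq_nonneg (u : E5 → ℂ) : 0 ≤ normH1DotSq u :=
  Finset.sum_nonneg fun _ _ => integral_nonneg fun x => by positivity

lemma lsq_eq_normL2Sq {u : E5 → ℂ} (hu : MemLp u 2) : lsq u = ENNReal.ofReal (normL2Sq u) :=
  lsq_eq_ofReal hu

lemma normL2Sq_le_of_lsq_le {u : E5 → ℂ} {A : ℝ} (hA : 0 ≤ A) (hu : MemLp u 2)
    (h : lsq u ≤ ENNReal.ofReal A) : normL2Sq u ≤ A := by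
  rw [lsq_eq_normL2Sq hu] at h
  exact (ENNReal.ofReal_le_ofReal_iff hA).1 h

lemma normL2Sq_congr {u v : E5 → ℂ} (h : u =ᵐ[volume] v) : normL2Sq u = normL2Sq v :=
  integral_congr_ae (by filter_upwards [h] with x hx; rw [hx])

lemma normL2Sq_eq_zero_iff {u : E5 → ℂ} (hu : MemLp u 2) :
    normL2Sq u = 0 ↔ ∀ᵐ x, u x = 0 := by
  rw [normL2Sq, integral_eq_zero_iff_of_nonneg (fun x => by positivity) (integrable_sq hu)]
  simp [Filter.EventuallyEq]

lemma IsTest.memLp {ψ : E5 → ℝ} (hψ : IsTest ψ) (p : ℝ≥0∞) : MemLp ψ p :=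
  hψ.1.continuous.memLp_of_hasCompactSupport hψ.2

/-- The partial derivative of a test function is a test function. -/
lemma IsTest.fderiv {ψ : E5 → ℝ} (hψ : IsTest ψ) (v : E5) :
    IsTest (fun x => fderiv ℝ ψ x v) :=
  ⟨(hψ.1.fderiv_right (m := ∞) (by simp)).clm_apply contDiff_const,
    hψ.2.fderiv_apply (𝕜 := ℝ) v⟩

lemma IsTest.comp_affine {ψ : E5 → ℝ} (hψ : IsTest ψ) {l : ℝ} (hl : l ≠ 0) (b : E5) :
    IsTest (fun x => ψ (l • x + b)) := by
  refine ⟨hψ.1.comp ((contDiff_const_smul l).add contDiff_const), ?_⟩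
  exact hψ.2.comp_homeomorph ((Homeomorph.smulOfNeZero l hl).trans (Homeomorph.addRight b))

lemma IsTest.integrable_smul {F : Type*} [NormedAddCommGroup F] [NormedSpace ℝ F]
    {ψ : E5 → ℝ} (hψ : IsTest ψ) {u : E5 → F}
    (hu : LocallyIntegrable u) : Integrable (fun x => ψ x • u x) :=
  hu.integrable_smul_left_of_hasCompactSupport hψ.1.continuous hψ.2

lemma locInt {F : Type*} [NormedAddCommGroup F] {u : E5 → F} (hu : MemLp u 2) :
    LocallyIntegrable u := hu.locallyIntegrable (by norm_num)

lemma HasWeakPartial.congr {i : Fin 5} {u v g : E5 → ℂ} (h : HasWeakPartial i u g)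
    (huv : u =ᵐ[volume] v) : HasWeakPartial i v g := by
  intro ψ hψ
  rw [← h ψ hψ]
  exact integral_congr_ae (by filter_upwards [huv] with x hx; rw [hx])

lemma HasWeakPartial.add {i : Fin 5} {u v g h : E5 → ℂ} (hu : HasWeakPartial i u g)
    (hv : HasWeakPartial i v h) (mu : MemLp u 2) (mv : MemLp v 2) (mg : MemLp g 2)
    (mh : MemLp h 2) : HasWeakPartial i (u + v) (g + h) := by
  intro ψ hψ
  simp only [Pi.add_apply, smul_add]
  rw [integral_add ((hψ.fderiv _).integrable_smul (locInt mu))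
    ((hψ.fderiv _).integrable_smul (locInt mv)), hu ψ hψ, hv ψ hψ,
    integral_add (hψ.integrable_smul (locInt mg)) (hψ.integrable_smul (locInt mh))]
  ring

lemma HasWeakPartial.const_smul {i : Fin 5} {u g : E5 → ℂ} (hu : HasWeakPartial i u g) (c : ℂ) :
    HasWeakPartial i (c • u) (c • g) := by
  intro ψ hψ
  simp only [Pi.smul_apply]
  simp_rw [smul_comm _ c]
  rw [integral_smul, integral_smul, hu ψ hψ, smul_neg]

lemma MemH1.memLp_weakPartial {u : E5 → ℂ} (hu : MemH1 u) (i : Fin 5) :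
    MemLp (weakPartial i u) 2 := by
  rw [weakPartial, dif_pos (hu.2 i)]
  exact (hu.2 i).choose_spec.1

lemma MemH1.hasWeakPartial {u : E5 → ℂ} (hu : MemH1 u) (i : Fin 5) :
    HasWeakPartial i u (weakPartial i u) := by
  rw [weakPartial, dif_pos (hu.2 i)]
  exact (hu.2 i).choose_spec.2

lemma HasWeakPartial.ae_eq {i : Fin 5} {u g h : E5 → ℂ} (hg : HasWeakPartial i u g)
    (hh : HasWeakPartial i u h) (mg : MemLp g 2) (mh : MemLp h 2) : g =ᵐ[volume] h := by
  refine ae_eq_of_integral_contDiff_smul_eq (locInt mg) (locInt mh) fun ψ h1 h2 => ?_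
  have := (hg ψ ⟨h1, h2⟩).symm.trans (hh ψ ⟨h1, h2⟩)
  exact neg_injective this

lemma weakPartial_ae_eq {i : Fin 5} {u g : E5 → ℂ} (mg : MemLp g 2)
    (hg : HasWeakPartial i u g) : weakPartial i u =ᵐ[volume] g := by
  have hex : ∃ g : E5 → ℂ, MemLp g 2 ∧ HasWeakPartial i u g := ⟨g, mg, hg⟩
  rw [weakPartial, dif_pos hex]
  exact hex.choose_spec.2.ae_eq hg hex.choose_spec.1 mg

lemma memH1_of {u : E5 → ℂ} (hu : MemLp u 2) {g : Fin 5 → E5 → ℂ} (hg : ∀ i, MemLp (g i) 2)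
    (h : ∀ i, HasWeakPartial i u (g i)) : MemH1 u := ⟨hu, fun i => ⟨g i, hg i, h i⟩⟩

lemma normH1DotSq_eq {u : E5 → ℂ} {g : Fin 5 → E5 → ℂ} (hg : ∀ i, MemLp (g i) 2)
    (h : ∀ i, HasWeakPartial i u (g i)) : normH1DotSq u = ∑ i, normL2Sq (g i) :=
  Finset.sum_congr rfl fun i _ => normL2Sq_congr (weakPartial_ae_eq (hg i) (h i))

lemma MemH1.congr {u v : E5 → ℂ} (hu : MemH1 u) (h : u =ᵐ[volume] v) : MemH1 v :=
  memH1_of ((memLp_congr_ae h).1 hu.1) hu.memLp_weakPartial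
    fun i => (hu.hasWeakPartial i).congr h

lemma MemH1.add {u v : E5 → ℂ} (hu : MemH1 u) (hv : MemH1 v) : MemH1 (u + v) :=
  memH1_of (hu.1.add hv.1) (fun i => (hu.memLp_weakPartial i).add (hv.memLp_weakPartial i))
    fun i => (hu.hasWeakPartial i).add (hv.hasWeakPartial i) hu.1 hv.1 (hu.memLp_weakPartial i)
      (hv.memLp_weakPartial i)

lemma MemH1.const_smul {u : E5 → ℂ} (hu : MemH1 u) (c : ℂ) : MemH1 (c • u) :=
  memH1_of (hu.1.const_smul c) (fun i => (hu.memLp_weakPartial i).const_smul c)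
    fun i => (hu.hasWeakPartial i).const_smul c

lemma weakPartial_add {u v : E5 → ℂ} (hu : MemH1 u) (hv : MemH1 v) (i : Fin 5) :
    weakPartial i (u + v) =ᵐ[volume] weakPartial i u + weakPartial i v :=
  weakPartial_ae_eq ((hu.memLp_weakPartial i).add (hv.memLp_weakPartial i))
    ((hu.hasWeakPartial i).add (hv.hasWeakPartial i) hu.1 hv.1 (hu.memLp_weakPartial i)
      (hv.memLp_weakPartial i))

lemma weakPartial_const_smul {u : E5 → ℂ} (hu : MemH1 u) (c : ℂ) (i : Fin 5) :
    weakPartial i (c • u) =ᵐ[volume] c • weakPartial i u :=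
  weakPartial_ae_eq ((hu.memLp_weakPartial i).const_smul c) ((hu.hasWeakPartial i).const_smul c)

lemma MemH1.sub {u v : E5 → ℂ} (hu : MemH1 u) (hv : MemH1 v) : MemH1 (u - v) := by
  have := hu.add (hv.const_smul (-1))
  simpa [sub_eq_add_neg] using this

lemma weakPartial_sub {u v : E5 → ℂ} (hu : MemH1 u) (hv : MemH1 v) (i : Fin 5) :
    weakPartial i (u - v) =ᵐ[volume] weakPartial i u - weakPartial i v := by
  have h1 := weakPartial_add hu (hv.const_smul (-1)) i
  have h2 := weakPartial_const_smul hv (-1) i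
  have : u + (-1 : ℂ) • v = u - v := by simp [sub_eq_add_neg]
  rw [this] at h1
  filter_upwards [h1, h2] with x hx1 hx2
  rw [hx1, Pi.add_apply, hx2]
  simp [sub_eq_add_neg]

lemma normH1DotSq_congr {u v : E5 → ℂ} (hu : MemH1 u) (h : u =ᵐ[volume] v) :
    normH1DotSq v = normH1DotSq u :=
  normH1DotSq_eq hu.memLp_weakPartial fun i => (hu.hasWeakPartial i).congr h

/-! ### Inner products -/

/-- The real `L²` inner product of complex-valued functions. -/
def ip (u v : E5 → ℂ) : ℝ := ∫ x, inner ℝ (u x) (v x)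

/-- The inner product `∑ᵢ ⟨∂ᵢu, ∂ᵢv⟩` belonging to the homogeneous Sobolev norm. -/
def gip (u v : E5 → ℂ) : ℝ := ∑ i, ip (weakPartial i u) (weakPartial i v)

lemma integrable_inner {u v : E5 → ℂ} (hu : MemLp u 2) (hv : MemLp v 2) :
    Integrable (fun x => inner ℝ (u x) (v x)) := by
  refine (hu.norm.integrable_mul hv.norm).mono' (hu.1.inner hv.1) (ae_of_all _ fun x => ?_)
  simpa using norm_inner_le_norm (𝕜 := ℝ) (u x) (v x)

lemma ip_congr {u u' v v' : E5 → ℂ} (h : u =ᵐ[volume] u') (h' : v =ᵐ[volume] v') :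
    ip u v = ip u' v' :=
  integral_congr_ae (by filter_upwards [h, h'] with x hx hx'; rw [hx, hx'])

lemma normL2Sq_add_smul {u v : E5 → ℂ} (hu : MemLp u 2) (hv : MemLp v 2) (t : ℝ) :
    normL2Sq (u + (t : ℂ) • v) = normL2Sq u + 2 * t * ip u v + t ^ 2 * normL2Sq v := by
  have h : ∀ x, ‖(u + (t : ℂ) • v) x‖ ^ 2
      = (‖u x‖ ^ 2 + (2 * t) * inner ℝ (u x) (v x)) + t ^ 2 * ‖v x‖ ^ 2 := by
    intro x
    have : (u + (t : ℂ) • v) x = u x + t • v x := by simp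
    rw [this, norm_add_sq_real, inner_smul_right, norm_smul, mul_pow]
    simp; ring
  simp only [normL2Sq, ip]
  simp_rw [h]
  rw [integral_add, integral_add, integral_const_mul, integral_const_mul]
  · exact (integrable_sq hu)
  · exact (integrable_inner hu hv).const_mul _
  · exact (integrable_sq hu).add ((integrable_inner hu hv).const_mul _)
  · exact (integrable_sq hv).const_mul _

lemma normL2Sq_add {u v : E5 → ℂ} (hu : MemLp u 2) (hv : MemLp v 2) :
    normL2Sq (u + v) = normL2Sq u + 2 * ip u v + normL2Sq v := by
  have := normL2Sq_add_smul hu hv 1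
  simpa using this

lemma normH1DotSq_add_smul {u v : E5 → ℂ} (hu : MemH1 u) (hv : MemH1 v) (t : ℝ) :
    normH1DotSq (u + (t : ℂ) • v)
      = normH1DotSq u + 2 * t * gip u v + t ^ 2 * normH1DotSq v := by
  have h : normH1DotSq (u + (t : ℂ) • v)
      = ∑ i, normL2Sq (weakPartial i u + (t : ℂ) • weakPartial i v) :=
    normH1DotSq_eq
      (fun i => (hu.memLp_weakPartial i).add ((hv.memLp_weakPartial i).const_smul _))
      fun i => (hu.hasWeakPartial i).add ((hv.hasWeakPartial i).const_smul _) hu.1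
        (hv.1.const_smul _) (hu.memLp_weakPartial i) ((hv.memLp_weakPartial i).const_smul _)
  rw [h]
  simp_rw [fun i => normL2Sq_add_smul (hu.memLp_weakPartial i) (hv.memLp_weakPartial i) t,
    Finset.sum_add_distrib, ← Finset.mul_sum]
  rfl

/-! ### Affine changes of variables -/

lemma integral_comp_affine {F : Type*} [NormedAddCommGroup F] [NormedSpace ℝ F] (f : E5 → F)
    {l : ℝ} (hl : 0 < l) (b : E5) :
    ∫ x, f (l • x + b) = (l ^ 5)⁻¹ • ∫ x, f x := by
  have h := Measure.integral_comp_smul (volume : Measure E5) (fun y => f (y + b)) l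
  rw [h, integral_add_right_eq_self f b]
  simp [abs_of_pos (pow_pos hl 5)]

lemma integrable_comp_affine {F : Type*} [NormedAddCommGroup F] {f : E5 → F}
    (hf : Integrable f) {l : ℝ} (hl : 0 < l) (b : E5) :
    Integrable (fun x => f (l • x + b)) :=
  (hf.comp_add_right b).comp_smul hl.ne'

lemma quasiMeasurePreserving_affine {l : ℝ} (hl : 0 < l) (b : E5) :
    Measure.QuasiMeasurePreserving (fun x : E5 => l • x + b) := by
  refine ⟨by fun_prop, ?_⟩
  refine Measure.AbsolutelyContinuous.mk fun s hs h0 => ?_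
  rw [Measure.map_apply (by fun_prop) hs]
  have : (fun x : E5 => l • x + b) ⁻¹' s = (fun x : E5 => l • x) ⁻¹' ((fun y => y + b) ⁻¹' s) := rfl
  rw [this, Measure.addHaar_preimage_smul _ hl.ne', measure_preimage_add_right, h0, mul_zero]

lemma ae_comp_affine {p : E5 → Prop} (h : ∀ᵐ x, p x) {l : ℝ} (hl : 0 < l) (b : E5) :
    ∀ᵐ x : E5, p (l • x + b) :=
  (quasiMeasurePreserving_affine hl b).ae h

lemma memLp_comp_affine {u : E5 → ℂ} (hu : MemLp u 2) {l : ℝ} (hl : 0 < l) (b : E5) :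
    MemLp (fun x => u (l • x + b)) 2 := by
  have hm := hu.1.comp_quasiMeasurePreserving (quasiMeasurePreserving_affine hl b)
  refine (memLp_two_iff_integrable_sq_norm hm).2 ?_
  exact integrable_comp_affine (integrable_sq hu) hl b

lemma HasWeakPartial.comp_affine {i : Fin 5} {u g : E5 → ℂ} (h : HasWeakPartial i u g)
    {l : ℝ} (hl : 0 < l) (b : E5) :
    HasWeakPartial i (fun x => u (l • x + b)) (fun x => (l : ℂ) • g (l • x + b)) := by
  intro ψ hψ
  have hl' : l⁻¹ ≠ 0 := inv_ne_zero hl.ne'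
  set φ : E5 → ℝ := fun y => ψ (l⁻¹ • y + (-l⁻¹ • b)) with hφ
  have hφt : IsTest φ := hψ.comp_affine hl' _
  have key : ∀ x : E5, l⁻¹ • (l • x + b) + (-l⁻¹ • b) = x := by
    intro x; rw [smul_add, smul_smul, inv_mul_cancel₀ hl.ne']; simp
  have hd : ∀ y v, _root_.fderiv ℝ φ y v = l⁻¹ * _root_.fderiv ℝ ψ (l⁻¹ • y + (-l⁻¹ • b)) v := by
    intro y v
    have h1 : HasFDerivAt (fun y : E5 => l⁻¹ • y + (-l⁻¹ • b))
        (l⁻¹ • ContinuousLinearMap.id ℝ E5) y :=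
      ((hasFDerivAt_id y).const_smul l⁻¹).add_const _
    have h2 := ((hψ.1.differentiable (by simp) (l⁻¹ • y + (-l⁻¹ • b))).hasFDerivAt).comp y h1
    have h3 : HasFDerivAt φ _ y := h2
    rw [h3.fderiv]; simp
  have e1 : ∀ x, (_root_.fderiv ℝ ψ x (EuclideanSpace.single i 1)) • u (l • x + b)
      = l • (fun y => (_root_.fderiv ℝ φ y (EuclideanSpace.single i 1)) • u y) (l • x + b) := by
    intro x
    simp only [hd, key, smul_smul, ← mul_assoc, mul_inv_cancel₀ hl.ne', one_mul]
  have e2 : ∀ x, ψ x • ((l : ℂ) • g (l • x + b))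
      = l • (fun y => φ y • g y) (l • x + b) := by
    intro x
    simp only [hφ, key]
    rw [smul_comm, Complex.coe_smul]
  simp_rw [e1, e2]
  rw [integral_smul, integral_smul, integral_comp_affine (fun y => (_root_.fderiv ℝ φ y (EuclideanSpace.single i 1)) • u y) hl b,
    integral_comp_affine (fun y => φ y • g y) hl b, h φ hφt]
  simp

lemma MemH1.comp_affine {u : E5 → ℂ} (hu : MemH1 u) {l : ℝ} (hl : 0 < l) (b : E5) :
    MemH1 (fun x => u (l • x + b)) :=
  memH1_of (memLp_comp_affine hu.1 hl b)
    (fun i => (memLp_comp_affine (hu.memLp_weakPartial i) hl b).const_smul (l : ℂ))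
    fun i => (hu.hasWeakPartial i).comp_affine hl b

lemma normL2Sq_comp_affine (u : E5 → ℂ) {l : ℝ} (hl : 0 < l) (b : E5) :
    normL2Sq (fun x => u (l • x + b)) = (l ^ 5)⁻¹ * normL2Sq u := by
  rw [normL2Sq, integral_comp_affine (fun x => ‖u x‖ ^ 2) hl b, smul_eq_mul, normL2Sq]

lemma normL2Sq_const_smul (u : E5 → ℂ) (c : ℂ) :
    normL2Sq (c • u) = ‖c‖ ^ 2 * normL2Sq u := by
  simp only [normL2Sq, Pi.smul_apply, norm_smul, mul_pow]
  rw [integral_const_mul]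

lemma normH1DotSq_const_smul {u : E5 → ℂ} (hu : MemH1 u) (c : ℂ) :
    normH1DotSq (c • u) = ‖c‖ ^ 2 * normH1DotSq u := by
  rw [normH1DotSq_eq (fun i => (hu.memLp_weakPartial i).const_smul c)
    (fun i => (hu.hasWeakPartial i).const_smul c)]
  simp_rw [normL2Sq_const_smul, ← Finset.mul_sum]
  rfl

lemma normH1DotSq_comp_affine {u : E5 → ℂ} (hu : MemH1 u) {l : ℝ} (hl : 0 < l) (b : E5) :
    normH1DotSq (fun x => u (l • x + b)) = l ^ 2 * (l ^ 5)⁻¹ * normH1DotSq u := by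
  rw [normH1DotSq_eq (fun i => (memLp_comp_affine (hu.memLp_weakPartial i) hl b).const_smul (l : ℂ))
    (fun i => (hu.hasWeakPartial i).comp_affine hl b)]
  have h : ∀ i, normL2Sq ((l : ℂ) • fun x => weakPartial i u (l • x + b))
      = l ^ 2 * (l ^ 5)⁻¹ * normL2Sq (weakPartial i u) := by
    intro i
    rw [normL2Sq_const_smul, normL2Sq_comp_affine _ hl b]
    simp [mul_assoc]
  have h' : ∀ i, normL2Sq (fun x => (l : ℂ) • weakPartial i u (l • x + b))
      = l ^ 2 * (l ^ 5)⁻¹ * normL2Sq (weakPartial i u) := h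
  change ∑ i, normL2Sq (fun x => (l : ℂ) • weakPartial i u (l • x + b)) = _
  simp_rw [h', ← Finset.mul_sum]
  rfl

/-! ### Mollification -/

/-- **Cauchy–Schwarz** for the lower Lebesgue integral. -/
lemma lintegral_mul_sq_le {α : Type*} [MeasurableSpace α] {μ : Measure α} {f g : α → ℝ≥0∞}
    (hf : AEMeasurable f μ) (hg : AEMeasurable g μ) :
    (∫⁻ x, f x * g x ∂μ) ^ 2 ≤ (∫⁻ x, f x ^ 2 ∂μ) * ∫⁻ x, g x ^ 2 ∂μ := by
  have h := ENNReal.lintegral_mul_le_Lp_mul_Lq μ Real.HolderConjugate.two_two hf hg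
  have h2 := pow_le_pow_left' h 2
  refine h2.trans (le_of_eq ?_)
  rw [mul_pow, ← ENNReal.rpow_natCast, ← ENNReal.rpow_natCast, ← ENNReal.rpow_mul,
    ← ENNReal.rpow_mul]
  simp

/-- **Jensen's inequality** for the average of `Φ` with respect to the density `ρ`. -/
lemma enorm_integral_smul_sq_le {α F : Type*} [MeasurableSpace α] {μ : Measure α}
    [NormedAddCommGroup F] [NormedSpace ℝ F]
    {ρ : α → ℝ} {Φ : α → F} (hρ : AEMeasurable ρ μ) (h0 : ∀ x, 0 ≤ ρ x)
    (hΦ : AEStronglyMeasurable Φ μ) :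
    ‖∫ x, ρ x • Φ x ∂μ‖ₑ ^ 2
      ≤ (∫⁻ x, ENNReal.ofReal (ρ x) ∂μ) * ∫⁻ x, ENNReal.ofReal (ρ x) * ‖Φ x‖ₑ ^ 2 ∂μ := by
  set s : α → ℝ≥0∞ := fun x => ENNReal.ofReal (Real.sqrt (ρ x)) with hs
  have hss : ∀ x, s x ^ 2 = ENNReal.ofReal (ρ x) := by
    intro x
    simp only [hs]
    rw [← ENNReal.ofReal_pow (Real.sqrt_nonneg _), Real.sq_sqrt (h0 x)]
  have hsm : AEMeasurable s μ := hρ.sqrt.ennreal_ofReal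
  have h1 : ‖∫ x, ρ x • Φ x ∂μ‖ₑ ≤ ∫⁻ x, s x * (s x * ‖Φ x‖ₑ) ∂μ := by
    refine (enorm_integral_le_lintegral_enorm _).trans (le_of_eq ?_)
    refine lintegral_congr fun x => ?_
    rw [enorm_smul, ← mul_assoc, ← sq, hss, Real.enorm_of_nonneg (h0 x)]
  refine (pow_le_pow_left' h1 2).trans ((lintegral_mul_sq_le hsm (hsm.mul hΦ.enorm)).trans ?_)
  simp only [Pi.mul_apply, mul_pow, hss, le_refl]

lemma aestronglyMeasurable_comp_sub {F : Type*} [NormedAddCommGroup F] {u : E5 → F} (hu : AEStronglyMeasurable u) :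
    AEStronglyMeasurable (fun p : E5 × E5 => u (p.1 - p.2)) (volume.prod volume) :=
  hu.comp_quasiMeasurePreserving
    (quasiMeasurePreserving_sub_of_right_invariant volume volume)

lemma lsq_comp_sub {F : Type*} [NormedAddCommGroup F] (u : E5 → F) (t : E5) : lsq (fun x => u (x - t)) = lsq u :=
  lintegral_sub_right_eq_self (fun x => ‖u x‖ₑ ^ 2) t

section

variable {F : Type*} [NormedAddCommGroup F] [NormedSpace ℝ F]

/-- The convolution of `u` with a scalar kernel `ρ`. -/
def conv (ρ : E5 → ℝ) (u : E5 → F) : E5 → F := fun x => ∫ t, ρ t • u (x - t)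

lemma conv_eq (ρ : E5 → ℝ) (u : E5 → F) :
    conv ρ u = convolution ρ u (ContinuousLinearMap.lsmul ℝ ℝ) volume := rfl

lemma conv_apply_swap (ρ : E5 → ℝ) (u : E5 → F) (x : E5) :
    conv ρ u x = ∫ t, ρ (x - t) • u t := by
  rw [conv_eq, convolution_lsmul_swap]

lemma conv_congr {ρ : E5 → ℝ} {u v : E5 → F} (h : u =ᵐ[volume] v) : conv ρ u = conv ρ v := by
  funext x
  rw [conv_apply_swap, conv_apply_swap]
  exact integral_congr_ae (by filter_upwards [h] with t ht; rw [ht])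

lemma IsTest.comp_sub {ρ : E5 → ℝ} (hρ : IsTest ρ) (x : E5) : IsTest (fun y => ρ (x - y)) := by
  have := hρ.comp_affine (l := -1) (by norm_num) x
  refine (iff_of_eq ?_).1 this
  congr 1; funext y; congr 1; rw [neg_one_smul]; abel

lemma fderiv_comp_sub {ρ : E5 → ℝ} (hρ : IsTest ρ) (x y v : E5) :
    _root_.fderiv ℝ (fun y => ρ (x - y)) y v = - _root_.fderiv ℝ ρ (x - y) v := by
  have h1 : HasFDerivAt (fun y : E5 => x - y) (-ContinuousLinearMap.id ℝ E5) y :=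
    (hasFDerivAt_id y).const_sub x
  have h2 : HasFDerivAt (fun y => ρ (x - y)) _ y :=
    ((hρ.1.differentiable (by simp) (x - y)).hasFDerivAt).comp y h1
  rw [h2.fderiv]; simp

lemma integrable_conv {ρ : E5 → ℝ} (hρ : IsTest ρ) {u : E5 → F} (hu : LocallyIntegrable u)
    (x : E5) : Integrable (fun t => ρ (x - t) • u t) :=
  (hρ.comp_sub x).integrable_smul hu

lemma conv_contDiff [CompleteSpace F] {ρ : E5 → ℝ} (hρ : IsTest ρ) {u : E5 → F}
    (hu : LocallyIntegrable u) : ContDiff ℝ ∞ (conv ρ u) :=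
  hρ.2.contDiff_convolution_left (n := ⊤) (ContinuousLinearMap.lsmul ℝ ℝ) hρ.1 hu

lemma fderiv_conv [CompleteSpace F] {ρ : E5 → ℝ} (hρ : IsTest ρ) {u : E5 → F}
    (hu : LocallyIntegrable u) (x v : E5) :
    _root_.fderiv ℝ (conv ρ u) x v = conv (fun y => _root_.fderiv ℝ ρ y v) u x := by
  have h := hρ.2.hasFDerivAt_convolution_left (ContinuousLinearMap.lsmul ℝ ℝ)
    (hρ.1.of_le (by simp)) hu x
  rw [conv_eq, h.fderiv, ← convolution_flip, ContinuousLinearMap.precompL,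
    ContinuousLinearMap.flip_flip, convolution_precompR_apply _ hu (hρ.2.fderiv ℝ)
      (hρ.1.continuous_fderiv (by simp)), convolution_flip]
  rfl

/-- A mollification is differentiated by mollifying the weak derivative. -/
lemma fderiv_conv_eq {ρ : E5 → ℝ} (hρ : IsTest ρ) {u g : E5 → ℂ} {i : Fin 5}
    (hu : LocallyIntegrable u) (h : HasWeakPartial i u g) (x : E5) :
    _root_.fderiv ℝ (conv ρ u) x (EuclideanSpace.single i 1) = conv ρ g x := by
  rw [fderiv_conv hρ hu, conv_apply_swap, conv_apply_swap]
  have := h _ (hρ.comp_sub x)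
  simp_rw [fderiv_comp_sub hρ, neg_smul, integral_neg] at this
  exact neg_injective this

lemma aestronglyMeasurable_conv {ρ : E5 → ℝ} (hρ : IsTest ρ) {u : E5 → F}
    (hu : AEStronglyMeasurable u) : AEStronglyMeasurable (conv ρ u) := by
  have : AEStronglyMeasurable (fun p : E5 × E5 => ρ p.2 • u (p.1 - p.2)) (volume.prod volume) :=
    (hρ.1.continuous.comp continuous_snd).aestronglyMeasurable.smul
      (aestronglyMeasurable_comp_sub hu)
  exact this.integral_prod_right'

/-- Mollifiers: nonnegative test functions of integral one. -/
structure IsMollifier (ρ : E5 → ℝ) : Prop where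
  test : IsTest ρ
  nonneg : ∀ x, 0 ≤ ρ x
  integral_eq : ∫ x, ρ x = 1

lemma IsMollifier.lintegral_eq {ρ : E5 → ℝ} (hρ : IsMollifier ρ) :
    ∫⁻ x, ENNReal.ofReal (ρ x) = 1 := by
  rw [← ofReal_integral_eq_lintegral_ofReal
    ((hρ.test.1.continuous.integrable_of_hasCompactSupport hρ.test.2))
    (ae_of_all _ hρ.nonneg), hρ.integral_eq, ENNReal.ofReal_one]

/-- **Minkowski's inequality** for averages of a family of functions. -/
lemma lsq_average_le {ρ : E5 → ℝ} (hρ : IsMollifier ρ) {Φ : E5 × E5 → F}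
    (hΦ : AEStronglyMeasurable Φ (volume.prod volume)) :
    lsq (fun x => ∫ t, ρ t • Φ (x, t)) ≤ ∫⁻ t, ENNReal.ofReal (ρ t) * lsq (fun x => Φ (x, t)) := by
  have hm : AEMeasurable (fun p : E5 × E5 => ENNReal.ofReal (ρ p.2) * ‖Φ p‖ₑ ^ 2)
      (volume.prod volume) :=
    ((hρ.test.1.continuous.comp continuous_snd).measurable.ennreal_ofReal.aemeasurable).mul
      (hΦ.enorm.pow_const 2)
  calc lsq (fun x => ∫ t, ρ t • Φ (x, t))
      ≤ ∫⁻ x, ∫⁻ t, ENNReal.ofReal (ρ t) * ‖Φ (x, t)‖ₑ ^ 2 := by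
        refine lintegral_mono_ae ?_
        filter_upwards [hΦ.prodMk_left] with x hx
        refine (enorm_integral_smul_sq_le hρ.test.1.continuous.measurable.aemeasurable
          hρ.nonneg hx).trans ?_
        rw [hρ.lintegral_eq, one_mul]
    _ = ∫⁻ t, ∫⁻ x, ENNReal.ofReal (ρ t) * ‖Φ (x, t)‖ₑ ^ 2 := lintegral_lintegral_swap hm
    _ = ∫⁻ t, ENNReal.ofReal (ρ t) * lsq (fun x => Φ (x, t)) := by
        refine lintegral_congr fun t => ?_
        rw [lintegral_const_mul' _ _ ENNReal.ofReal_ne_top, lsq]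

/-- **Young's inequality**: mollification does not increase the `L²` norm. -/
lemma lsq_conv_le {ρ : E5 → ℝ} (hρ : IsMollifier ρ) {u : E5 → F} (hu : AEStronglyMeasurable u) :
    lsq (conv ρ u) ≤ lsq u := by
  refine (lsq_average_le hρ (aestronglyMeasurable_comp_sub hu)).trans (le_of_eq ?_)
  simp only [lsq_comp_sub]
  rw [lintegral_mul_const'' _ (hρ.test.1.continuous.measurable.ennreal_ofReal.aemeasurable),
    hρ.lintegral_eq, one_mul]

lemma IsMollifier.memLp_conv {ρ : E5 → ℝ} (hρ : IsMollifier ρ) {u : E5 → F} (hu : MemLp u 2) :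
    MemLp (conv ρ u) 2 :=
  memLp_two_iff_lsq.2 ⟨aestronglyMeasurable_conv hρ.test hu.1,
    (lsq_conv_le hρ hu.1).trans_lt (memLp_two_iff_lsq.1 hu).2⟩

/-- The mollification error is controlled by the translation differences. -/
lemma lsq_conv_sub_le [CompleteSpace F] {ρ : E5 → ℝ} (hρ : IsMollifier ρ) {u : E5 → F} (hu : MemLp u 2) :
    lsq (conv ρ u - u) ≤ ∫⁻ t, ENNReal.ofReal (ρ t) * lsq (fun x => u (x - t) - u x) := by
  have h1 : conv ρ u - u = fun x => ∫ t, ρ t • (u (x - t) - u x) := by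
    funext x
    have hi : Integrable (fun t => ρ t • u (x - t)) := by
      have := (integrable_conv hρ.test (locInt hu) x).comp_sub_left x
      simpa using this
    have hρi : Integrable ρ := hρ.test.1.continuous.integrable_of_hasCompactSupport hρ.test.2
    simp only [smul_sub]
    rw [integral_sub hi (hρi.smul_const (u x)), integral_smul_const, hρ.integral_eq, one_smul]
    rfl
  rw [h1]
  exact lsq_average_le hρ (Φ := fun p => u (p.1 - p.2) - u p.1)
    ((aestronglyMeasurable_comp_sub hu.1).sub hu.1.comp_fst)

/-- A sequence of smooth bump functions shrinking to the origin. -/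
def bumpSeq (n : ℕ) : ContDiffBump (0 : E5) where
  rIn := 1 / (2 * (n + 1))
  rOut := 1 / (n + 1)
  rIn_pos := by positivity
  rIn_lt_rOut := by
    apply one_div_lt_one_div_of_lt <;> (have : (0 : ℝ) < n + 1 := by positivity) <;> linarith

/-- A sequence of mollifiers `ρₙ` supported in the balls of radius `1 / (n + 1)`. -/
def mollifier (n : ℕ) : E5 → ℝ := (bumpSeq n).normed volume

lemma isMollifier_mollifier (n : ℕ) : IsMollifier (mollifier n) :=
  ⟨⟨(bumpSeq n).contDiff_normed, (bumpSeq n).hasCompactSupport_normed⟩,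
    (bumpSeq n).nonneg_normed, (bumpSeq n).integral_normed⟩

lemma mollifier_eq_zero {n : ℕ} {x : E5} (hx : 1 / ((n : ℝ) + 1) ≤ ‖x‖) : mollifier n x = 0 := by
  by_contra h
  have : x ∈ Function.support ((bumpSeq n).normed volume) := h
  rw [ContDiffBump.support_normed_eq, mem_ball_zero_iff] at this
  exact absurd this (not_lt.2 hx)

lemma ae_tendsto_conv_mollifier [CompleteSpace F] {u : E5 → F} (hu : LocallyIntegrable u) :
    ∀ᵐ x, Tendsto (fun n => conv (mollifier n) u x) atTop (𝓝 (u x)) := by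
  refine ContDiffBump.ae_convolution_tendsto_right_of_locallyIntegrable (φ := bumpSeq) (K := 2)
    ?_ ?_ hu
  · exact tendsto_one_div_add_atTop_nhds_zero_nat
  · refine Eventually.of_forall fun n => le_of_eq ?_
    simp only [bumpSeq]
    field_simp

/-- An integrable function lies above another one on an open set `H` if it does so in the sense of
distributions. -/
lemma ae_le_of_forall_test {f g : E5 → ℝ} (hf : LocallyIntegrable f) (hg : LocallyIntegrable g)
    {H : Set E5} (hH : IsOpen H)
    (h : ∀ η : E5 → ℝ, IsTest η → (∀ x, 0 ≤ η x) → (∀ x, x ∉ H → η x = 0) →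
      ∫ x, η x * f x ≤ ∫ x, η x * g x) :
    ∀ᵐ x, x ∈ H → f x ≤ g x := by
  filter_upwards [ae_tendsto_conv_mollifier hf, ae_tendsto_conv_mollifier hg] with x hfx hgx hxH
  refine le_of_tendsto_of_tendsto hfx hgx ?_
  obtain ⟨r, hr, hball⟩ := Metric.isOpen_iff.1 hH x hxH
  have hlim : Tendsto (fun n : ℕ => 1 / ((n : ℝ) + 1)) atTop (𝓝 0) :=
    tendsto_one_div_add_atTop_nhds_zero_nat
  filter_upwards [hlim.eventually (gt_mem_nhds hr)] with n hn
  rw [conv_apply_swap, conv_apply_swap]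
  refine h (fun t => mollifier n (x - t)) ((isMollifier_mollifier n).test.comp_sub x)
    (fun t => (isMollifier_mollifier n).nonneg _) fun t ht => mollifier_eq_zero ?_
  by_contra hlt
  rw [not_le] at hlt
  exact ht (hball (by rw [Metric.mem_ball, dist_comm, dist_eq_norm]; exact hlt.trans hn))

end

/-! ### Approximation by test functions, translations, and the Sobolev inequality -/

/-- The directional derivative `h · g` of a function with gradient `g`. -/
def dirDeriv (g : Fin 5 → E5 → ℂ) (h : E5) : E5 → ℂ := fun x => ∑ i, (h i : ℂ) * g i x

lemma memLp_dirDeriv {g : Fin 5 → E5 → ℂ} (hg : ∀ i, MemLp (g i) 2) (h : E5) :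
    MemLp (dirDeriv g h) 2 :=
  memLp_finsetSum _ fun i _ => (hg i).const_mul _

lemma eq_sum_single (h : E5) : h = ∑ i, h i • EuclideanSpace.single i (1 : ℝ) := by
  ext j
  simp [Pi.single_apply]

lemma fderiv_conv_dir {ρ : E5 → ℝ} (hρ : IsTest ρ) {u : E5 → ℂ} {g : Fin 5 → E5 → ℂ}
    (hu : LocallyIntegrable u) (hg : ∀ i, MemLp (g i) 2) (hw : ∀ i, HasWeakPartial i u (g i))
    (x h : E5) : fderiv ℝ (conv ρ u) x h = conv ρ (dirDeriv g h) x := by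
  have h1 : fderiv ℝ (conv ρ u) x h = ∑ i, h i • conv ρ (g i) x := by
    conv_lhs => rw [eq_sum_single h]
    rw [map_sum]
    simp_rw [map_smul, fderiv_conv_eq hρ hu (hw _)]
  rw [h1, conv_apply_swap]
  simp_rw [dirDeriv, Finset.smul_sum]
  rw [integral_finsetSum]
  · refine Finset.sum_congr rfl fun i _ => ?_
    rw [conv_apply_swap, ← integral_smul]
    refine integral_congr_ae (ae_of_all _ fun t => ?_)
    simp only [Complex.real_smul]; ring
  · intro i _
    exact integrable_conv hρ (locInt ((hg i).const_mul _)) x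

/-- A smooth cut-off function, equal to `1` on the unit ball. -/
def cutoffBump : ContDiffBump (0 : E5) := ⟨1, 2, one_pos, one_lt_two⟩

/-- The rescaled cut-off functions, equal to `1` on the ball of radius `n + 1`. -/
def cutoff (n : ℕ) : E5 → ℝ := fun x => cutoffBump (((n : ℝ) + 1)⁻¹ • x + 0)

lemma isTest_cutoff (n : ℕ) : IsTest (cutoff n) :=
  IsTest.comp_affine (ψ := cutoffBump) ⟨cutoffBump.contDiff, cutoffBump.hasCompactSupport⟩
    (by positivity) 0

lemma cutoff_mem (n : ℕ) (x : E5) : 0 ≤ cutoff n x ∧ cutoff n x ≤ 1 :=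
  ⟨cutoffBump.nonneg, cutoffBump.le_one⟩

lemma cutoff_eventually_one (x : E5) : ∀ᶠ n in atTop, cutoff n x = 1 := by
  filter_upwards [eventually_ge_atTop ⌈‖x‖⌉₊] with n hn
  have hn' : ‖x‖ ≤ n := (Nat.le_ceil _).trans (by exact_mod_cast hn)
  apply cutoffBump.one_of_mem_closedBall
  rw [mem_closedBall_zero_iff, add_zero, norm_smul, norm_inv, Real.norm_of_nonneg (by positivity)]
  change _ ≤ (1 : ℝ)
  rw [inv_mul_le_iff₀ (by positivity)]
  linarith

lemma exists_fderiv_cutoff_bound :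
    ∃ C : ℝ, 0 ≤ C ∧ ∀ n x, ‖fderiv ℝ (cutoff n) x‖ ≤ C / ((n : ℝ) + 1) := by
  have hc : ContDiff ℝ ∞ (cutoffBump : E5 → ℝ) := cutoffBump.contDiff
  obtain ⟨C, hC⟩ := (hc.continuous_fderiv (by simp)).bounded_above_of_compact_support
    (cutoffBump.hasCompactSupport.fderiv ℝ)
  refine ⟨C, (norm_nonneg _).trans (hC 0), fun n x => ?_⟩
  have h1 : HasFDerivAt (fun y : E5 => ((n : ℝ) + 1)⁻¹ • y + (0 : E5))
      (((n : ℝ) + 1)⁻¹ • ContinuousLinearMap.id ℝ E5) x :=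
    (HasFDerivAt.const_smul (hasFDerivAt_id x) (((n : ℝ) + 1)⁻¹)).add_const (0 : E5)
  have h2 : HasFDerivAt (cutoff n) _ x := ((hc.differentiable (by simp) _).hasFDerivAt).comp x h1
  rw [h2.fderiv, ContinuousLinearMap.comp_smul, ContinuousLinearMap.comp_id, norm_smul, norm_inv,
    Real.norm_of_nonneg (by positivity), mul_comm, div_eq_mul_inv]
  exact mul_le_mul_of_nonneg_right (hC _) (by positivity)

lemma eLpNorm_two_le_of_lsq_le {F G : Type*} [NormedAddCommGroup F] [NormedAddCommGroup G]
    {u : E5 → F} {v : E5 → G} (h : lsq u ≤ lsq v) :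
    eLpNorm u 2 volume ≤ eLpNorm v 2 volume := by
  rw [lsq_eq_eLpNorm, lsq_eq_eLpNorm] at h
  exact (ENNReal.pow_le_pow_left_iff (two_ne_zero)).1 h

/-- Functions with weak gradient in `L²` are limits almost everywhere of smooth functions of compact
support, whose directional derivatives are asymptotically bounded by those of the limit. -/
lemma exists_smooth_approx {u : E5 → ℂ} {g : Fin 5 → E5 → ℂ} (hu : MemLp u 2)
    (hg : ∀ i, MemLp (g i) 2) (hw : ∀ i, HasWeakPartial i u (g i)) :
    ∃ (C : ℝ) (w : ℕ → E5 → ℂ), 0 ≤ C ∧ (∀ n, ContDiff ℝ ∞ (w n) ∧ HasCompactSupport (w n)) ∧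
      (∀ᵐ x, Tendsto (fun n => w n x) atTop (𝓝 (u x))) ∧
      ∀ n h, eLpNorm (fun x => fderiv ℝ (w n) x h) 2 volume
        ≤ eLpNorm (dirDeriv g h) 2 volume + ENNReal.ofReal (C * ‖h‖ / ((n : ℝ) + 1)) := by
  obtain ⟨C, hC0, hC⟩ := exists_fderiv_cutoff_bound
  refine ⟨C * (eLpNorm u 2 volume).toReal, fun n x => cutoff n x • conv (mollifier n) u x,
    by positivity, fun n => ⟨?_, ?_⟩, ?_, fun n h => ?_⟩
  · exact (isTest_cutoff n).1.smul (conv_contDiff (isMollifier_mollifier n).test (locInt hu))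
  · exact (isTest_cutoff n).2.smul_right
  · filter_upwards [ae_tendsto_conv_mollifier (locInt hu)] with x hx
    refine hx.congr' ?_
    filter_upwards [cutoff_eventually_one x] with n hn
    rw [hn, one_smul]
  · have hm := isMollifier_mollifier n
    set v := conv (mollifier n) u with hv
    have hvc : ContDiff ℝ ∞ v := conv_contDiff hm.test (locInt hu)
    have hd : (fun x => fderiv ℝ (fun y => cutoff n y • v y) x h)
        = (fun x => cutoff n x • conv (mollifier n) (dirDeriv g h) x)
          + fun x => (fderiv ℝ (cutoff n) x h) • v x := by
      funext x
      rw [fderiv_fun_smul ((isTest_cutoff n).1.differentiable (by simp) x)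
        (hvc.differentiable (by simp) x)]
      simp [← fderiv_conv_dir hm.test (locInt hu) hg hw, hv]
    have hdm := memLp_dirDeriv hg h
    have e1 : eLpNorm (fun x => cutoff n x • conv (mollifier n) (dirDeriv g h) x) 2 volume
        ≤ eLpNorm (dirDeriv g h) 2 volume := by
      refine (eLpNorm_mono fun x => ?_).trans (eLpNorm_two_le_of_lsq_le (lsq_conv_le hm hdm.1))
      rw [norm_smul, Real.norm_of_nonneg (cutoff_mem n x).1]
      exact mul_le_of_le_one_left (norm_nonneg _) (cutoff_mem n x).2
    have e2 : eLpNorm (fun x => (fderiv ℝ (cutoff n) x h) • v x) 2 volume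
        ≤ ENNReal.ofReal (C * (eLpNorm u 2 volume).toReal * ‖h‖ / ((n : ℝ) + 1)) := by
      have hb : ∀ x, ‖(fderiv ℝ (cutoff n) x h) • v x‖ ≤ (C / ((n : ℝ) + 1) * ‖h‖) * ‖v x‖ := by
        intro x
        rw [norm_smul]
        refine mul_le_mul_of_nonneg_right ?_ (norm_nonneg _)
        exact ((fderiv ℝ (cutoff n) x).le_opNorm h).trans
          (mul_le_mul_of_nonneg_right (hC n x) (norm_nonneg _))
      refine (eLpNorm_le_mul_eLpNorm_of_ae_le_mul (ae_of_all _ hb) 2).trans ?_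
      have hvu : eLpNorm v 2 volume ≤ eLpNorm u 2 volume :=
        eLpNorm_two_le_of_lsq_le (lsq_conv_le hm hu.1)
      refine (mul_le_mul_right hvu _).trans (le_of_eq ?_)
      rw [← ENNReal.ofReal_toReal hu.2.ne, ← ENNReal.ofReal_mul (by positivity),
        ENNReal.toReal_ofReal ENNReal.toReal_nonneg]
      congr 1; ring
    change eLpNorm (fun x => fderiv ℝ (fun y => cutoff n y • v y) x h) 2 volume ≤ _
    rw [hd]
    refine (eLpNorm_add_le ?_ ?_ (by norm_num)).trans (add_le_add e1 e2)
    · exact (isTest_cutoff n).1.continuous.aestronglyMeasurable.smul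
        (hm.memLp_conv hdm).1
    · exact ((isTest_cutoff n).fderiv h).1.continuous.aestronglyMeasurable.smul
        hvc.continuous.aestronglyMeasurable

/-- The translation difference of a smooth function is controlled by its directional derivative. -/
lemma lsq_translate_sub_le_of_smooth {w : E5 → ℂ} (hw : ContDiff ℝ ∞ w) (h : E5) :
    lsq (fun x => w (x + h) - w x) ≤ lsq (fun x => fderiv ℝ w x h) := by
  have hcont : Continuous fun x => fderiv ℝ w x h :=
    (hw.continuous_fderiv (by simp)).clm_apply continuous_const
  have hftc : ∀ x, w (x + h) - w x = ∫ s in Set.Ioc (0 : ℝ) 1, (1 : ℝ) • fderiv ℝ w (x + s • h) h := by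
    intro x
    rw [← intervalIntegral.integral_of_le zero_le_one]
    have hder : ∀ s : ℝ, HasDerivAt (fun s : ℝ => w (x + s • h)) (fderiv ℝ w (x + s • h) h) s := by
      intro s
      have h1 : HasDerivAt (fun s : ℝ => x + s • h) h s := by
        simpa using ((hasDerivAt_id s).smul_const h).const_add x
      exact ((hw.differentiable (by simp) _).hasFDerivAt).comp_hasDerivAt s h1
    simp only [one_smul]
    rw [intervalIntegral.integral_eq_sub_of_hasDerivAt (fun s _ => hder s)]
    · simp
    · exact (hcont.comp (by fun_prop : Continuous fun s : ℝ => x + s • h)).intervalIntegrable _ _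
  have hcont2 : Continuous fun p : E5 × ℝ => fderiv ℝ w (p.1 + p.2 • h) h :=
    hcont.comp (by fun_prop)
  calc lsq (fun x => w (x + h) - w x)
      ≤ ∫⁻ x, ∫⁻ s in Set.Ioc (0 : ℝ) 1, ‖fderiv ℝ w (x + s • h) h‖ₑ ^ 2 := by
        refine lintegral_mono fun x => ?_
        simp only [hftc x]
        refine (enorm_integral_smul_sq_le (ρ := fun _ => (1 : ℝ)) aemeasurable_const
          (fun _ => zero_le_one) ?_).trans (le_of_eq ?_)
        · exact (hcont2.comp (by fun_prop : Continuous fun s : ℝ => (x, s))).aestronglyMeasurable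
        · simp
    _ = ∫⁻ s in Set.Ioc (0 : ℝ) 1, ∫⁻ x, ‖fderiv ℝ w (x + s • h) h‖ₑ ^ 2 := by
        refine lintegral_lintegral_swap ?_
        exact (hcont2.enorm.measurable.pow_const 2).aemeasurable
    _ = ∫⁻ s in Set.Ioc (0 : ℝ) 1, lsq (fun x => fderiv ℝ w x h) := by
        refine lintegral_congr fun s => ?_
        exact lintegral_add_right_eq_self (fun x => ‖fderiv ℝ w x h‖ₑ ^ 2) (s • h)
    _ = lsq (fun x => fderiv ℝ w x h) := by simp

lemma lsq_le_liminf {F : Type*} [NormedAddCommGroup F] {f : ℕ → E5 → F} {u : E5 → F}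
    (hf : ∀ n, AEStronglyMeasurable (f n))
    (h : ∀ᵐ x, Tendsto (fun n => f n x) atTop (𝓝 (u x))) :
    lsq u ≤ liminf (fun n => lsq (f n)) atTop := by
  refine le_trans (lintegral_mono_ae ?_) (lintegral_liminf_le' fun n => (hf n).enorm.pow_const 2)
  filter_upwards [h] with x hx
  exact ((ENNReal.continuous_pow 2).continuousAt.tendsto.comp
    (continuous_enorm.continuousAt.tendsto.comp hx)).liminf_eq.ge

/-- The translation difference of an `H¹` function is controlled by its directional derivative. -/
lemma lsq_translate_sub_le {u : E5 → ℂ} {g : Fin 5 → E5 → ℂ} (hu : MemLp u 2)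
    (hg : ∀ i, MemLp (g i) 2) (hw : ∀ i, HasWeakPartial i u (g i)) (h : E5) :
    lsq (fun x => u (x + h) - u x) ≤ lsq (dirDeriv g h) := by
  obtain ⟨C, w, hC, hws, hlim, hb⟩ := exists_smooth_approx hu hg hw
  have h1 : ∀ᵐ x, Tendsto (fun n => w n (x + h) - w n x) atTop (𝓝 (u (x + h) - u x)) := by
    have := (measurePreserving_add_right volume h).quasiMeasurePreserving.ae hlim
    filter_upwards [hlim, this] with x hx hx'
    exact hx'.sub hx
  have h2 := lsq_le_liminf (f := fun n x => w n (x + h) - w n x)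
    (fun n => (((hws n).1.continuous.comp (continuous_add_const h)).sub
      (hws n).1.continuous).aestronglyMeasurable) h1
  refine h2.trans ?_
  have h3 : ∀ n, lsq (fun x => w n (x + h) - w n x)
      ≤ (eLpNorm (dirDeriv g h) 2 volume + ENNReal.ofReal (C * ‖h‖ / ((n : ℝ) + 1))) ^ 2 := by
    intro n
    refine (lsq_translate_sub_le_of_smooth (hws n).1 h).trans ?_
    rw [lsq_eq_eLpNorm]
    exact pow_le_pow_left' (hb n h) 2
  refine (liminf_le_liminf (Eventually.of_forall h3)).trans (le_of_eq ?_)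
  refine Tendsto.liminf_eq ?_
  rw [lsq_eq_eLpNorm]
  refine (ENNReal.continuous_pow 2).continuousAt.tendsto.comp ?_
  have h4 : Tendsto (fun n : ℕ => ENNReal.ofReal (C * ‖h‖ / ((n : ℝ) + 1))) atTop (𝓝 0) := by
    have h5 : Tendsto (fun n : ℕ => C * ‖h‖ / ((n : ℝ) + 1)) atTop (𝓝 0) := by
      have := (tendsto_one_div_add_atTop_nhds_zero_nat (𝕜 := ℝ)).const_mul (C * ‖h‖)
      simpa only [mul_one_div, mul_zero] using this
    have := ENNReal.tendsto_ofReal h5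
    simpa using this
  simpa using h4.const_add (eLpNorm (dirDeriv g h) 2 volume)

/-- The **Sobolev inequality** `‖u‖_{10/3} ≤ C ∑ᵢ ‖∂ᵢu‖₂` on `ℝ⁵`. -/
lemma exists_sobolev : ∃ C : ℝ, 0 ≤ C ∧ ∀ (u : E5 → ℂ) (g : Fin 5 → E5 → ℂ), MemLp u 2 →
    (∀ i, MemLp (g i) 2) → (∀ i, HasWeakPartial i u (g i)) →
    eLpNorm u (10 / 3 : ℝ).toNNReal volume
      ≤ ENNReal.ofReal C * ∑ i, eLpNorm (g i) 2 volume := by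
  set S := SNormLESNormFDerivOfEqConst ℂ (volume : Measure E5) ((2 : NNReal) : ℝ)
  refine ⟨S, S.2, fun u g hu hg hw => ?_⟩
  obtain ⟨C, w, hC, hws, hlim, hb⟩ := exists_smooth_approx hu hg hw
  have hdir : ∀ i : Fin 5, dirDeriv g (EuclideanSpace.single i 1) = g i := by
    intro i; funext x
    simp [dirDeriv, apply_ite Complex.ofReal]
  have h1 : ∀ n, eLpNorm (w n) (10 / 3 : ℝ).toNNReal volume
      ≤ S * ∑ i, (eLpNorm (g i) 2 volume + ENNReal.ofReal (C / ((n : ℝ) + 1))) := by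
    intro n
    have hs := eLpNorm_le_eLpNorm_fderiv_of_eq (μ := (volume : Measure E5)) (p := 2)
      (p' := (10 / 3 : ℝ).toNNReal) ((hws n).1.of_le (by simp)) (hws n).2 (by norm_num)
      (by simp) (by
        rw [Real.coe_toNNReal _ (by norm_num)]
        simp only [finrank_euclideanSpace, Fintype.card_fin]; norm_num)
    refine hs.trans (mul_le_mul_right ?_ _)
    have hpt : ∀ x, ‖fderiv ℝ (w n) x‖
        ≤ ∑ i, ‖fderiv ℝ (w n) x (EuclideanSpace.single i 1)‖ := by
      intro x
      refine ContinuousLinearMap.opNorm_le_bound _ (by positivity) fun h => ?_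
      conv_lhs => rw [eq_sum_single h]
      rw [map_sum, Finset.sum_mul]
      refine (norm_sum_le _ _).trans (Finset.sum_le_sum fun i _ => ?_)
      rw [map_smul, norm_smul, mul_comm]
      exact mul_le_mul_of_nonneg_left (PiLp.norm_apply_le h i) (norm_nonneg _)
    have hm : ∀ i : Fin 5, AEStronglyMeasurable
        (fun x => ‖fderiv ℝ (w n) x (EuclideanSpace.single i 1)‖) volume := fun i =>
      (((hws n).1.continuous_fderiv (by simp)).clm_apply
        continuous_const).norm.aestronglyMeasurable
    calc eLpNorm (fderiv ℝ (w n)) ((2 : NNReal) : ℝ≥0∞) volume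
        ≤ eLpNorm (fun x => ∑ i, ‖fderiv ℝ (w n) x (EuclideanSpace.single i 1)‖) 2 volume := by
          refine eLpNorm_mono fun x => (hpt x).trans (le_abs_self _)
      _ ≤ ∑ i, eLpNorm (fun x => ‖fderiv ℝ (w n) x (EuclideanSpace.single i 1)‖) 2 volume := by
          have := eLpNorm_sum_le (s := Finset.univ) (p := 2) (μ := (volume : Measure E5))
            (fun i _ => hm i) (by norm_num)
          refine le_trans (le_of_eq ?_) this
          congr 1
      _ ≤ _ := by
          refine Finset.sum_le_sum fun i _ => ?_
          rw [eLpNorm_norm]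
          have := hb n (EuclideanSpace.single i 1)
          rw [hdir] at this
          simpa using this
  refine (Lp.eLpNorm_lim_le_liminf_eLpNorm
    (fun n => (hws n).1.continuous.aestronglyMeasurable) u hlim).trans ?_
  refine (liminf_le_liminf (Eventually.of_forall h1)).trans (le_of_eq ?_)
  refine Tendsto.liminf_eq ?_
  have h4 : Tendsto (fun n : ℕ => ENNReal.ofReal (C / ((n : ℝ) + 1))) atTop (𝓝 0) := by
    have h5 : Tendsto (fun n : ℕ => C / ((n : ℝ) + 1)) atTop (𝓝 0) := by
      have := (tendsto_one_div_add_atTop_nhds_zero_nat (𝕜 := ℝ)).const_mul C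
      simpa only [mul_one_div, mul_zero] using this
    have := ENNReal.tendsto_ofReal h5
    simpa using this
  rw [ENNReal.ofReal_coe_nnreal]
  refine ENNReal.Tendsto.const_mul ?_ (Or.inr ENNReal.coe_ne_top)
  refine tendsto_finsetSum _ fun i _ => ?_
  simpa using h4.const_add (eLpNorm (g i) 2 volume)

/-! ### The Gagliardo–Nirenberg inequality and the potential energy -/

lemma eLpNorm_two_eq {u : E5 → ℂ} (hu : MemLp u 2) :
    eLpNorm u 2 volume = ENNReal.ofReal (normL2Sq u ^ (1 / 2 : ℝ)) := by
  have h := lsq_eq_normL2Sq hu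
  rw [lsq_eq_eLpNorm] at h
  rw [← ENNReal.ofReal_rpow_of_nonneg (normL2Sq_nonneg u) (by norm_num), ← h,
    ← ENNReal.rpow_natCast, ← ENNReal.rpow_mul]
  norm_num

lemma memLp_three_iff {u : E5 → ℂ} (hu : AEStronglyMeasurable u) :
    MemLp u 3 ↔ ∫⁻ x, ‖u x‖ₑ ^ 3 < ⊤ := by
  have h : eLpNorm u 3 volume ^ 3 = ∫⁻ x, ‖u x‖ₑ ^ 3 := by
    rw [eLpNorm_eq_lintegral_rpow_enorm_toReal (by norm_num) (by norm_num), ← ENNReal.rpow_natCast,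
      ← ENNReal.rpow_mul]
    simp
  rw [← h, MemLp, and_iff_right hu]
  simp [ENNReal.pow_lt_top_iff]

lemma integrable_cube {u : E5 → ℂ} (hu : MemLp u 3) : Integrable (fun x => ‖u x‖ ^ 3) :=
  hu.integrable_norm_pow three_ne_zero

lemma lintegral_cube_eq {u : E5 → ℂ} (hu : MemLp u 3) :
    ∫⁻ x, ‖u x‖ₑ ^ 3 = ENNReal.ofReal (∫ x, ‖u x‖ ^ 3) := by
  rw [ofReal_integral_eq_lintegral_ofReal (integrable_cube hu) (ae_of_all _ fun x => by positivity)]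
  refine lintegral_congr fun x => ?_
  rw [ENNReal.ofReal_pow (norm_nonneg _), ofReal_norm]

/-- The **Gagliardo–Nirenberg inequality** `‖u‖₃³ ≤ C ‖u‖₂^{1/2} ‖∇u‖₂^{5/2}` on `ℝ⁵`. -/
lemma exists_gagliardo_nirenberg : ∃ C : ℝ, 0 ≤ C ∧ ∀ u : E5 → ℂ, MemH1 u →
    MemLp u 3 ∧ ∫ x, ‖u x‖ ^ 3 ≤ C * (normL2Sq u ^ (1 / 4 : ℝ) * normH1DotSq u ^ (5 / 4 : ℝ)) := by
  obtain ⟨C, hC0, hC⟩ := exists_sobolev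
  refine ⟨(C * 5) ^ (5 / 2 : ℝ), by positivity, fun u hu => ?_⟩
  have hN := normL2Sq_nonneg u
  have hD := normH1DotSq_nonneg u
  have h1 := hC u _ hu.1 hu.memLp_weakPartial hu.hasWeakPartial
  have h2 : ∀ i, eLpNorm (weakPartial i u) 2 volume
      ≤ ENNReal.ofReal (normH1DotSq u ^ (1 / 2 : ℝ)) := by
    intro i
    rw [eLpNorm_two_eq (hu.memLp_weakPartial i)]
    refine ENNReal.ofReal_le_ofReal (Real.rpow_le_rpow (normL2Sq_nonneg _) ?_ (by norm_num))
    exact Finset.single_le_sum (f := fun i => normL2Sq (weakPartial i u))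
      (fun i _ => normL2Sq_nonneg _) (Finset.mem_univ i)
  have h3 : eLpNorm u (10 / 3 : ℝ).toNNReal volume
      ≤ ENNReal.ofReal (C * 5 * normH1DotSq u ^ (1 / 2 : ℝ)) := by
    refine h1.trans ((mul_le_mul_right (Finset.sum_le_sum fun i _ => h2 i) _).trans (le_of_eq ?_))
    rw [Finset.sum_const, Finset.card_univ, Fintype.card_fin, nsmul_eq_mul,
      mul_assoc, ENNReal.ofReal_mul hC0, ENNReal.ofReal_mul (by norm_num)]
    simp
  have h4 : ∫⁻ x, ‖u x‖ₑ ^ 3 ≤ ENNReal.ofReal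
      ((C * 5) ^ (5 / 2 : ℝ) * (normL2Sq u ^ (1 / 4 : ℝ) * normH1DotSq u ^ (5 / 4 : ℝ))) := by
    have hh := ENNReal.lintegral_mul_norm_pow_le (μ := (volume : Measure E5))
      (f := fun x => ‖u x‖ₑ ^ 2) (g := fun x => ‖u x‖ₑ ^ (10 / 3 : ℝ)) (p := 1 / 4) (q := 3 / 4)
      (hu.1.1.enorm.pow_const _) (hu.1.1.enorm.pow_const _) (by norm_num) (by norm_num)
      (by norm_num)
    have e1 : ∀ x, ‖u x‖ₑ ^ 3 = (‖u x‖ₑ ^ 2) ^ (1 / 4 : ℝ) * (‖u x‖ₑ ^ (10 / 3 : ℝ)) ^ (3 / 4 : ℝ) := by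
      intro x
      rw [← ENNReal.rpow_natCast, ← ENNReal.rpow_natCast, ← ENNReal.rpow_mul, ← ENNReal.rpow_mul,
        ← ENNReal.rpow_add_of_nonneg _ _ (by norm_num) (by norm_num)]
      norm_num
    simp_rw [e1]
    refine hh.trans ?_
    have e2 : (∫⁻ x, ‖u x‖ₑ ^ (10 / 3 : ℝ)) ^ (3 / 4 : ℝ)
        = eLpNorm u (10 / 3 : ℝ).toNNReal volume ^ (5 / 2 : ℝ) := by
      rw [eLpNorm_eq_lintegral_rpow_enorm_toReal (by simp) (by simp), ← ENNReal.rpow_mul]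
      rw [ENNReal.coe_toReal, Real.coe_toNNReal _ (by norm_num)]
      norm_num
    have e3 : (∫⁻ x, ‖u x‖ₑ ^ 2) ^ (1 / 4 : ℝ) = ENNReal.ofReal (normL2Sq u ^ (1 / 4 : ℝ)) := by
      rw [show ∫⁻ x, ‖u x‖ₑ ^ 2 = lsq u from rfl, lsq_eq_normL2Sq hu.1,
        ENNReal.ofReal_rpow_of_nonneg hN (by norm_num)]
    rw [e2, e3]
    refine (mul_le_mul_right (ENNReal.rpow_le_rpow h3 (by norm_num)) _).trans (le_of_eq ?_)
    rw [ENNReal.ofReal_rpow_of_nonneg (by positivity) (by norm_num),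
      ← ENNReal.ofReal_mul (by positivity), Real.mul_rpow (by positivity) (by positivity),
      ← Real.rpow_mul hD]
    congr 1
    norm_num
    ring
  have h5 : MemLp u 3 := (memLp_three_iff hu.1.1).2 (h4.trans_lt ENNReal.ofReal_lt_top)
  refine ⟨h5, ?_⟩
  rw [lintegral_cube_eq h5] at h4
  exact (ENNReal.ofReal_le_ofReal_iff (by positivity)).1 h4

lemma MemH1.memLp_three {u : E5 → ℂ} (hu : MemH1 u) : MemLp u 3 :=
  (exists_gagliardo_nirenberg.choose_spec.2 u hu).1

lemma mul_mul_le_cubes {a b c : ℝ} (ha : 0 ≤ a) (hb : 0 ≤ b) (hc : 0 ≤ c) :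
    a * b * c ≤ (a ^ 3 + b ^ 3 + c ^ 3) / 3 := by
  nlinarith [mul_nonneg (add_nonneg (add_nonneg ha hb) hc) (add_nonneg (add_nonneg
    (sq_nonneg (a - b)) (sq_nonneg (b - c))) (sq_nonneg (a - c)))]

lemma integrable_mul_mul {a b c : E5 → ℂ} (ha : MemLp a 3) (hb : MemLp b 3) (hc : MemLp c 3) :
    Integrable (fun x => ‖a x‖ * ‖b x‖ * ‖c x‖) := by
  refine (((integrable_cube ha).add ((integrable_cube hb))).add (integrable_cube hc)).mono'
    ((ha.1.norm.mul hb.1.norm).mul hc.1.norm) (ae_of_all _ fun x => ?_)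
  rw [Real.norm_of_nonneg (by positivity)]
  refine (mul_mul_le_cubes (norm_nonneg _) (norm_nonneg _) (norm_nonneg _)).trans ?_
  simp only [Pi.add_apply]
  linarith [pow_nonneg (norm_nonneg (a x)) 3, pow_nonneg (norm_nonneg (b x)) 3,
    pow_nonneg (norm_nonneg (c x)) 3]

/-- The trilinear form `Re ∫ ā b̄ c` belonging to the potential energy. -/
def tri (a b c : E5 → ℂ) : ℝ :=
  ∫ x, (starRingEnd ℂ (a x) * starRingEnd ℂ (b x) * c x).re

lemma integrable_tri' {a b c : E5 → ℂ} (ha : MemLp a 3) (hb : MemLp b 3) (hc : MemLp c 3) :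
    Integrable (fun x => starRingEnd ℂ (a x) * starRingEnd ℂ (b x) * c x) := by
  refine (integrable_mul_mul ha hb hc).mono' ?_ (ae_of_all _ fun x => by simp)
  exact ((Complex.continuous_conj.comp_aestronglyMeasurable ha.1).mul
    (Complex.continuous_conj.comp_aestronglyMeasurable hb.1)).mul hc.1

lemma integrable_tri {a b c : E5 → ℂ} (ha : MemLp a 3) (hb : MemLp b 3) (hc : MemLp c 3) :
    Integrable (fun x => (starRingEnd ℂ (a x) * starRingEnd ℂ (b x) * c x).re) :=
  (integrable_tri' ha hb hc).re

lemma V_eq_tri {u : Fin 3 → E5 → ℂ} (hu : ∀ j, MemLp (u j) 3) : V u = tri (u 0) (u 1) (u 2) :=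
  (integral_re (integrable_tri' (hu 0) (hu 1) (hu 2))).symm

lemma abs_tri_le {a b c : E5 → ℂ} (ha : MemLp a 3) (hb : MemLp b 3) (hc : MemLp c 3) :
    |tri a b c| ≤ ∫ x, ‖a x‖ * ‖b x‖ * ‖c x‖ := by
  refine (norm_integral_le_integral_norm (f := fun x =>
    (starRingEnd ℂ (a x) * starRingEnd ℂ (b x) * c x).re)).trans ?_
  refine integral_mono (integrable_tri ha hb hc).norm (integrable_mul_mul ha hb hc) fun x => ?_
  refine (Complex.abs_re_le_norm _).trans (le_of_eq ?_)
  simp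

lemma tri_add_left {a a' b c : E5 → ℂ} (ha : MemLp a 3) (ha' : MemLp a' 3) (hb : MemLp b 3)
    (hc : MemLp c 3) : tri (a + a') b c = tri a b c + tri a' b c := by
  rw [tri, tri, tri, ← integral_add (integrable_tri ha hb hc) (integrable_tri ha' hb hc)]
  refine integral_congr_ae (ae_of_all _ fun x => ?_)
  simp only [Pi.add_apply, map_add, add_mul, Complex.add_re]

lemma tri_comm (a b c : E5 → ℂ) : tri a b c = tri b a c := by
  refine integral_congr_ae (ae_of_all _ fun x => ?_)
  simp only [mul_comm (starRingEnd ℂ (a x))]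

lemma tri_add_middle {a b b' c : E5 → ℂ} (ha : MemLp a 3) (hb : MemLp b 3) (hb' : MemLp b' 3)
    (hc : MemLp c 3) : tri a (b + b') c = tri a b c + tri a b' c := by
  rw [tri_comm, tri_add_left hb hb' ha hc, tri_comm b, tri_comm b']

lemma tri_add_right {a b c c' : E5 → ℂ} (ha : MemLp a 3) (hb : MemLp b 3) (hc : MemLp c 3)
    (hc' : MemLp c' 3) : tri a b (c + c') = tri a b c + tri a b c' := by
  rw [tri, tri, tri, ← integral_add (integrable_tri ha hb hc) (integrable_tri ha hb hc')]
  refine integral_congr_ae (ae_of_all _ fun x => ?_)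
  simp only [Pi.add_apply, mul_add, Complex.add_re]

lemma tri_smul_left (a b c : E5 → ℂ) (t : ℝ) : tri ((t : ℂ) • a) b c = t * tri a b c := by
  rw [tri, tri, ← integral_const_mul]
  refine integral_congr_ae (ae_of_all _ fun x => ?_)
  simp only [Pi.smul_apply, smul_eq_mul, map_mul, Complex.conj_ofReal, mul_assoc,
    Complex.re_ofReal_mul]

lemma tri_smul_middle (a b c : E5 → ℂ) (t : ℝ) : tri a ((t : ℂ) • b) c = t * tri a b c := by
  rw [tri_comm, tri_smul_left, tri_comm]

lemma tri_smul_right (a b c : E5 → ℂ) (t : ℝ) : tri a b ((t : ℂ) • c) = t * tri a b c := by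
  rw [tri, tri, ← integral_const_mul]
  refine integral_congr_ae (ae_of_all _ fun x => ?_)
  simp only [Pi.smul_apply, smul_eq_mul, mul_left_comm _ (t : ℂ), Complex.re_ofReal_mul]

lemma M_nonneg (u : Fin 3 → E5 → ℂ) : 0 ≤ M u := by
  have := normL2Sq_nonneg (u 0)
  have := normL2Sq_nonneg (u 1)
  have := normL2Sq_nonneg (u 2)
  rw [M]; positivity

lemma K_nonneg {κ : Fin 3 → ℝ} (hκ : ∀ j, 0 < κ j) (u : Fin 3 → E5 → ℂ) : 0 ≤ K κ u :=
  Finset.sum_nonneg fun j _ => mul_nonneg (by linarith [hκ j]) (normH1DotSq_nonneg _)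

lemma normL2Sq_le_M (u : Fin 3 → E5 → ℂ) (j : Fin 3) : normL2Sq (u j) ≤ 2 * M u := by
  have h0 := normL2Sq_nonneg (u 0)
  have h1 := normL2Sq_nonneg (u 1)
  have h2 := normL2Sq_nonneg (u 2)
  rw [M]
  fin_cases j <;> simp <;> linarith

lemma normH1DotSq_le_K {κ : Fin 3 → ℝ} (hκ : ∀ j, 0 < κ j) (u : Fin 3 → E5 → ℂ) (j : Fin 3) :
    normH1DotSq (u j) ≤ 2 / κ j * K κ u := by
  have h : κ j / 2 * normH1DotSq (u j) ≤ K κ u :=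
    Finset.single_le_sum (f := fun j => κ j / 2 * normH1DotSq (u j))
      (fun j _ => mul_nonneg (by linarith [hκ j]) (normH1DotSq_nonneg _)) (Finset.mem_univ j)
  have hj := hκ j
  rw [div_mul_eq_mul_div, le_div_iff₀ hj]
  linarith

/-- The potential energy is controlled by mass and kinetic energy, `V⁴ ≤ C M K⁵`. -/
lemma exists_V_pow_le {κ : Fin 3 → ℝ} (hκ : ∀ j, 0 < κ j) :
    ∃ C : ℝ, 0 ≤ C ∧ ∀ u : Fin 3 → E5 → ℂ, (∀ j, MemH1 (u j)) →
      V u ^ 4 ≤ C * (M u * K κ u ^ 5) := by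
  obtain ⟨C, hC0, hC⟩ := exists_gagliardo_nirenberg
  set D : ℝ := ∑ j, C * (2 ^ (1 / 4 : ℝ) * (2 / κ j) ^ (5 / 4 : ℝ)) with hD
  have hD0 : 0 ≤ D := Finset.sum_nonneg fun j _ => by
    have := hκ j; positivity
  refine ⟨D ^ 4, by positivity, fun u hu => ?_⟩
  have hM := M_nonneg u
  have hK := K_nonneg hκ u
  have h3 : ∀ j, MemLp (u j) 3 := fun j => (hu j).memLp_three
  have hj : ∀ j, ∫ x, ‖u j x‖ ^ 3
      ≤ C * (2 ^ (1 / 4 : ℝ) * (2 / κ j) ^ (5 / 4 : ℝ)) * (M u ^ (1 / 4 : ℝ) * K κ u ^ (5 / 4 : ℝ)) := by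
    intro j
    have hkj := hκ j
    refine ((hC _ (hu j)).2).trans ?_
    have e1 : normL2Sq (u j) ^ (1 / 4 : ℝ) ≤ 2 ^ (1 / 4 : ℝ) * M u ^ (1 / 4 : ℝ) := by
      rw [← Real.mul_rpow (by norm_num) hM]
      exact Real.rpow_le_rpow (normL2Sq_nonneg _) (normL2Sq_le_M u j) (by norm_num)
    have e2 : normH1DotSq (u j) ^ (5 / 4 : ℝ) ≤ (2 / κ j) ^ (5 / 4 : ℝ) * K κ u ^ (5 / 4 : ℝ) := by
      rw [← Real.mul_rpow (by positivity) hK]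
      exact Real.rpow_le_rpow (normH1DotSq_nonneg _) (normH1DotSq_le_K hκ u j) (by norm_num)
    have e3 := mul_le_mul e1 e2 (Real.rpow_nonneg (normH1DotSq_nonneg _) _) (by positivity)
    refine (mul_le_mul_of_nonneg_left e3 hC0).trans (le_of_eq (by ring))
  have hV : |V u| ≤ D * (M u ^ (1 / 4 : ℝ) * K κ u ^ (5 / 4 : ℝ)) := by
    rw [V_eq_tri h3]
    refine (abs_tri_le (h3 0) (h3 1) (h3 2)).trans ?_
    have hle : ∫ x, ‖u 0 x‖ * ‖u 1 x‖ * ‖u 2 x‖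
        ≤ ∫ x, (‖u 0 x‖ ^ 3 + ‖u 1 x‖ ^ 3 + ‖u 2 x‖ ^ 3) := by
      refine integral_mono (integrable_mul_mul (h3 0) (h3 1) (h3 2))
        (((integrable_cube (h3 0)).add (integrable_cube (h3 1))).add (integrable_cube (h3 2)))
        fun x => ?_
      refine (mul_mul_le_cubes (norm_nonneg _) (norm_nonneg _) (norm_nonneg _)).trans ?_
      have : 0 ≤ ‖u 0 x‖ ^ 3 + ‖u 1 x‖ ^ 3 + ‖u 2 x‖ ^ 3 := by positivity
      linarith
    have h01 : Integrable (fun x => ‖u 0 x‖ ^ 3 + ‖u 1 x‖ ^ 3) :=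
      (integrable_cube (h3 0)).add (integrable_cube (h3 1))
    refine hle.trans ?_
    rw [integral_add h01 (integrable_cube (h3 2)),
      integral_add (integrable_cube (h3 0)) (integrable_cube (h3 1)), hD, Finset.sum_mul,
      Fin.sum_univ_three]
    exact add_le_add (add_le_add (hj 0) (hj 1)) (hj 2)
  have h4 : V u ^ 4 = |V u| ^ 4 := by rw [← abs_pow, abs_of_nonneg (by positivity)]
  rw [h4]
  refine (pow_le_pow_left₀ (abs_nonneg _) hV 4).trans (le_of_eq ?_)
  rw [mul_pow, mul_pow, ← Real.rpow_natCast (M u ^ (1 / 4 : ℝ)), ← Real.rpow_mul hM,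
    ← Real.rpow_natCast (K κ u ^ (5 / 4 : ℝ)), ← Real.rpow_mul hK]
  norm_num

/-! ### Mollification in `H¹` -/

lemma hasWeakPartial_of_contDiff {v : E5 → ℂ} (hv : ContDiff ℝ ∞ v) (i : Fin 5) :
    HasWeakPartial i v (fun x => fderiv ℝ v x (EuclideanSpace.single i 1)) := by
  intro ψ hψ
  have hd : Continuous fun x => fderiv ℝ v x (EuclideanSpace.single i 1) :=
    (hv.continuous_fderiv (by simp)).clm_apply continuous_const
  have := integral_smul_fderiv_eq_neg_fderiv_smul_of_integrable (μ := (volume : Measure E5))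
    (f := ψ) (g := v) (v := EuclideanSpace.single i 1)
    ((hψ.fderiv _).integrable_smul hv.continuous.locallyIntegrable)
    (hψ.integrable_smul hd.locallyIntegrable)
    (hψ.integrable_smul hv.continuous.locallyIntegrable)
    (fun x _ => hψ.1.differentiable (by simp) x) (fun x _ => hv.differentiable (by simp) x)
  rw [this, neg_neg]

lemma hasWeakPartial_conv {ρ : E5 → ℝ} (hρ : IsMollifier ρ) {u g : E5 → ℂ} {i : Fin 5}
    (hu : MemLp u 2) (h : HasWeakPartial i u g) : HasWeakPartial i (conv ρ u) (conv ρ g) := by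
  have := hasWeakPartial_of_contDiff (conv_contDiff hρ.test (locInt hu)) i
  simpa only [fderiv_conv_eq hρ.test (locInt hu) h] using this

lemma memH1_conv {ρ : E5 → ℝ} (hρ : IsMollifier ρ) {u : E5 → ℂ} (hu : MemH1 u) :
    MemH1 (conv ρ u) :=
  memH1_of (hρ.memLp_conv hu.1) (fun i => hρ.memLp_conv (hu.memLp_weakPartial i))
    fun i => hasWeakPartial_conv hρ hu.1 (hu.hasWeakPartial i)

lemma normL2Sq_conv_le {ρ : E5 → ℝ} (hρ : IsMollifier ρ) {u : E5 → ℂ} (hu : MemLp u 2) :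
    normL2Sq (conv ρ u) ≤ normL2Sq u := by
  refine normL2Sq_le_of_lsq_le (normL2Sq_nonneg _) (hρ.memLp_conv hu) ?_
  rw [← lsq_eq_normL2Sq hu]
  exact lsq_conv_le hρ hu.1

lemma normH1DotSq_conv_le {ρ : E5 → ℝ} (hρ : IsMollifier ρ) {u : E5 → ℂ} (hu : MemH1 u) :
    normH1DotSq (conv ρ u) ≤ normH1DotSq u := by
  rw [normH1DotSq_eq (fun i => hρ.memLp_conv (hu.memLp_weakPartial i))
    fun i => hasWeakPartial_conv hρ hu.1 (hu.hasWeakPartial i)]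
  exact Finset.sum_le_sum fun i _ => normL2Sq_conv_le hρ (hu.memLp_weakPartial i)

lemma norm_dirDeriv_sq_le (g : Fin 5 → E5 → ℂ) (h x : E5) :
    ‖dirDeriv g h x‖ ^ 2 ≤ ‖h‖ ^ 2 * ∑ i, ‖g i x‖ ^ 2 := by
  have h1 : ‖dirDeriv g h x‖ ≤ ∑ i, ‖h i‖ * ‖g i x‖ := by
    refine (norm_sum_le _ _).trans (Finset.sum_le_sum fun i _ => ?_)
    simp
  refine (pow_le_pow_left₀ (norm_nonneg _) h1 2).trans ?_
  rw [EuclideanSpace.norm_sq_eq]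
  exact Finset.sum_mul_sq_le_sq_mul_sq _ _ _

lemma lsq_dirDeriv_le {u : E5 → ℂ} (hu : MemH1 u) (h : E5) :
    lsq (dirDeriv (fun i => weakPartial i u) h) ≤ ENNReal.ofReal (‖h‖ ^ 2 * normH1DotSq u) := by
  rw [lsq_eq_ofReal (memLp_dirDeriv hu.memLp_weakPartial h)]
  refine ENNReal.ofReal_le_ofReal ?_
  have hi : ∀ i ∈ Finset.univ, Integrable (fun x => ‖weakPartial i u x‖ ^ 2) :=
    fun i _ => integrable_sq (hu.memLp_weakPartial i)
  rw [normH1DotSq, ← integral_finsetSum _ hi, ← integral_const_mul]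
  exact integral_mono (integrable_sq (memLp_dirDeriv hu.memLp_weakPartial h))
    ((integrable_finsetSum _ hi).const_mul _) fun x => norm_dirDeriv_sq_le _ h x

/-- The mollification error in `L²` of an `H¹` function is small, uniformly on bounded sets. -/
lemma normL2Sq_conv_mollifier_sub_le {u : E5 → ℂ} (hu : MemH1 u) (n : ℕ) :
    normL2Sq (conv (mollifier n) u - u) ≤ (1 / ((n : ℝ) + 1)) ^ 2 * normH1DotSq u := by
  have hm := isMollifier_mollifier n
  have hD := normH1DotSq_nonneg u
  refine normL2Sq_le_of_lsq_le (by positivity) ((hm.memLp_conv hu.1).sub hu.1) ?_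
  refine (lsq_conv_sub_le hm hu.1).trans ?_
  calc ∫⁻ t, ENNReal.ofReal (mollifier n t) * lsq (fun x => u (x - t) - u x)
      ≤ ∫⁻ t, ENNReal.ofReal (mollifier n t)
          * ENNReal.ofReal ((1 / ((n : ℝ) + 1)) ^ 2 * normH1DotSq u) := by
        refine lintegral_mono fun t => ?_
        by_cases ht : 1 / ((n : ℝ) + 1) ≤ ‖t‖
        · simp [mollifier_eq_zero ht]
        · refine mul_le_mul_right ?_ _
          have h1 := lsq_translate_sub_le hu.1 hu.memLp_weakPartial hu.hasWeakPartial (-t)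
          simp only [← sub_eq_add_neg] at h1
          refine h1.trans ((lsq_dirDeriv_le hu (-t)).trans (ENNReal.ofReal_le_ofReal ?_))
          rw [norm_neg]
          exact mul_le_mul_of_nonneg_right
            (pow_le_pow_left₀ (norm_nonneg _) (not_le.1 ht).le 2) hD
    _ = _ := by
        rw [lintegral_mul_const'' _
          (hm.test.1.continuous.measurable.ennreal_ofReal.aemeasurable), hm.lintegral_eq, one_mul]

/-! ### Weak convergence and local compactness -/

/-- Weak convergence in `L²`, expressed through integrals. The absence of a complex conjugation makes
no difference, as all `h` in `L²` are admitted. -/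
def WeakConv (f : ℕ → E5 → ℂ) (g : E5 → ℂ) : Prop :=
  ∀ h : E5 → ℂ, MemLp h 2 →
    Tendsto (fun n => ∫ x, h x * f n x) atTop (𝓝 (∫ x, h x * g x))

lemma WeakConv.comp {f : ℕ → E5 → ℂ} {g : E5 → ℂ} (h : WeakConv f g) {φ : ℕ → ℕ}
    (hφ : StrictMono φ) : WeakConv (fun n => f (φ n)) g :=
  fun k hk => (h k hk).comp hφ.tendsto_atTop

lemma integrable_mul_of_memLp {f g : E5 → ℂ} (hf : MemLp f 2) (hg : MemLp g 2) :
    Integrable (fun x => f x * g x) := hf.integrable_mul hg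

lemma memLp_conj {f : E5 → ℂ} (hf : MemLp f 2) : MemLp (fun x => starRingEnd ℂ (f x)) 2 :=
  hf.star

lemma ip_eq_re {f g : E5 → ℂ} (hf : MemLp f 2) (hg : MemLp g 2) :
    ip f g = (∫ x, starRingEnd ℂ (f x) * g x).re := by
  have h : ip f g = ∫ x, RCLike.re (starRingEnd ℂ (f x) * g x) :=
    integral_congr_ae (ae_of_all _ fun x => by
      change ((g x) * starRingEnd ℂ (f x)).re = _
      rw [mul_comm]; rfl)
  rw [h, integral_re (integrable_mul_of_memLp (memLp_conj hf) hg)]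
  rfl

lemma WeakConv.tendsto_ip {f : ℕ → E5 → ℂ} {g h : E5 → ℂ} (hfg : WeakConv f g)
    (hf : ∀ n, MemLp (f n) 2) (hg : MemLp g 2) (hh : MemLp h 2) :
    Tendsto (fun n => ip h (f n)) atTop (𝓝 (ip h g)) := by
  simp_rw [ip_eq_re hh (hf _), ip_eq_re hh hg]
  exact (Complex.continuous_re.tendsto _).comp (hfg _ (memLp_conj hh))

lemma ip_self (g : E5 → ℂ) : ip g g = normL2Sq g := by
  simp [ip, normL2Sq]

lemma ip_comm (f g : E5 → ℂ) : ip f g = ip g f :=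
  integral_congr_ae (ae_of_all _ fun _ => real_inner_comm _ _)

lemma normL2Sq_sub {f g : E5 → ℂ} (hf : MemLp f 2) (hg : MemLp g 2) :
    normL2Sq (f - g) = normL2Sq f - 2 * ip g f + normL2Sq g := by
  have h := normL2Sq_add_smul hf hg (-1)
  have e : f + ((-1 : ℝ) : ℂ) • g = f - g := by
    funext x; simp [sub_eq_add_neg]
  rw [e] at h
  rw [h, ip_comm g f]; ring

/-- Mass splits along weakly convergent sequences. -/
lemma WeakConv.tendsto_normL2Sq_sub {f : ℕ → E5 → ℂ} {g : E5 → ℂ} (hfg : WeakConv f g)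
    (hf : ∀ n, MemLp (f n) 2) (hg : MemLp g 2) :
    Tendsto (fun n => normL2Sq (f n) - normL2Sq (f n - g)) atTop (𝓝 (normL2Sq g)) := by
  have h1 := ((hfg.tendsto_ip hf hg hg).const_mul 2).sub_const (normL2Sq g)
  rw [ip_self] at h1
  have h2 : ∀ n, normL2Sq (f n) - normL2Sq (f n - g) = 2 * ip g (f n) - normL2Sq g := by
    intro n; rw [normL2Sq_sub (hf n) hg]; ring
  simp_rw [h2]
  convert h1 using 2; ring

lemma WeakConv.sub_self {f : ℕ → E5 → ℂ} {g : E5 → ℂ} (hfg : WeakConv f g)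
    (hf : ∀ n, MemLp (f n) 2) (hg : MemLp g 2) : WeakConv (fun n => f n - g) 0 := by
  intro h hh
  have h1 := (hfg h hh).sub_const (∫ x, h x * g x)
  rw [_root_.sub_self] at h1
  simp only [Pi.zero_apply, mul_zero, integral_zero]
  refine h1.congr fun n => ?_
  rw [← integral_sub (integrable_mul_of_memLp hh (hf n)) (integrable_mul_of_memLp hh hg)]
  refine integral_congr_ae (ae_of_all _ fun x => ?_)
  simp [mul_sub]

/-- Bounded sequences in `L²` have weakly convergent subsequences. -/
lemma exists_weakConv_subseq {f : ℕ → E5 → ℂ} (hf : ∀ n, MemLp (f n) 2) {A : ℝ}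
    (hA : ∀ n, normL2Sq (f n) ≤ A) :
    ∃ φ : ℕ → ℕ, StrictMono φ ∧ ∃ g, MemLp g 2 ∧ WeakConv (fun n => f (φ n)) g := by
  have : Fact ((1 : ℝ≥0∞) ≤ 2) := ⟨by norm_num⟩
  have : Fact ((2 : ℝ≥0∞) ≠ ⊤) := ⟨by norm_num⟩
  let H := Lp ℂ 2 (volume : Measure E5)
  let T : ℕ → H := fun n => (memLp_conj (hf n)).toLp _
  let L : ℕ → WeakDual ℂ H := fun n => StrongDual.toWeakDual (InnerProductSpace.toDual ℂ H (T n))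
  have hT : ∀ n, ‖T n‖ ≤ Real.sqrt A := by
    intro n
    rw [Lp.norm_toLp]
    have e : eLpNorm (fun x => starRingEnd ℂ (f n x)) 2 volume = eLpNorm (f n) 2 volume :=
      eLpNorm_congr_norm_ae (ae_of_all _ fun x => by simp)
    rw [e, eLpNorm_two_eq (hf n), ENNReal.toReal_ofReal (by have := normL2Sq_nonneg (f n); positivity),
      ← Real.sqrt_eq_rpow]
    exact Real.sqrt_le_sqrt (hA n)
  obtain ⟨Λ, -, φ, hφ, hlim⟩ := WeakDual.isSeqCompact_closedBall ℂ H 0 (Real.sqrt A)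
    (x := L) (fun n => by
      change InnerProductSpace.toDual ℂ H (T n) ∈ Metric.closedBall 0 (Real.sqrt A)
      rw [mem_closedBall_zero_iff, LinearIsometryEquiv.norm_map]
      exact hT n)
  let G : H := (InnerProductSpace.toDual ℂ H).symm (WeakDual.toStrongDual Λ)
  have hG : ∀ x : H, inner ℂ G x = Λ x := fun x => by
    rw [InnerProductSpace.toDual_symm_apply]; rfl
  refine ⟨φ, hφ, fun x => starRingEnd ℂ (G x), memLp_conj (Lp.memLp G), fun h hh => ?_⟩
  have h1 := ((WeakDual.eval_continuous (hh.toLp _)).tendsto Λ).comp hlim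
  have e1 : ∀ n, L n (hh.toLp _) = ∫ x, h x * f n x := by
    intro n
    change inner ℂ (T n) (hh.toLp _) = _
    rw [L2.inner_def]
    refine integral_congr_ae ?_
    filter_upwards [hh.coeFn_toLp, (memLp_conj (hf n)).coeFn_toLp] with x hx hx'
    rw [hx]
    change h x * starRingEnd ℂ (T n x) = _
    rw [hx', Complex.conj_conj]
  have e2 : Λ (hh.toLp _) = ∫ x, h x * starRingEnd ℂ (G x) := by
    rw [← hG, L2.inner_def]
    refine integral_congr_ae ?_
    filter_upwards [hh.coeFn_toLp] with x hx
    rw [hx]; rfl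
  rw [← e2]
  refine h1.congr fun n => ?_
  exact e1 (φ n)

lemma exists_weakConv_subseq_finset {ι : Type*} (s : Finset ι) {f : ℕ → ι → E5 → ℂ}
    (hf : ∀ n i, MemLp (f n i) 2) {A : ℝ} (hA : ∀ n i, normL2Sq (f n i) ≤ A) :
    ∃ φ : ℕ → ℕ, StrictMono φ ∧
      ∀ i ∈ s, ∃ g, MemLp g 2 ∧ WeakConv (fun n => f (φ n) i) g := by
  classical
  induction s using Finset.induction_on with
  | empty => exact ⟨id, strictMono_id, by simp⟩
  | insert a s ha ih =>
    obtain ⟨φ, hφ, h⟩ := ih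
    obtain ⟨χ, hχ, g, hg, hw⟩ := exists_weakConv_subseq (f := fun n => f (φ n) a)
      (fun n => hf _ _) (fun n => hA _ _)
    refine ⟨φ ∘ χ, hφ.comp hχ, fun i hi => ?_⟩
    rcases Finset.mem_insert.1 hi with rfl | hi
    · exact ⟨g, hg, hw⟩
    · obtain ⟨g', hg', hw'⟩ := h i hi
      exact ⟨g', hg', hw'.comp hχ⟩

/-- Bounded finite families in `L²` have simultaneously weakly convergent subsequences. -/
lemma exists_weakConv_subseq_family {ι : Type*} [Fintype ι] {f : ℕ → ι → E5 → ℂ}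
    (hf : ∀ n i, MemLp (f n i) 2) {A : ℝ} (hA : ∀ n i, normL2Sq (f n i) ≤ A) :
    ∃ φ : ℕ → ℕ, StrictMono φ ∧
      ∃ g : ι → E5 → ℂ, ∀ i, MemLp (g i) 2 ∧ WeakConv (fun n => f (φ n) i) (g i) := by
  obtain ⟨φ, hφ, h⟩ := exists_weakConv_subseq_finset Finset.univ hf hA
  choose g hg using fun i => h i (Finset.mem_univ i)
  exact ⟨φ, hφ, g, hg⟩

lemma IsTest.memLp_ofReal {ψ : E5 → ℝ} (hψ : IsTest ψ) : MemLp (fun x => (ψ x : ℂ)) 2 :=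
  (hψ.memLp 2).ofReal

/-- Weak derivatives pass to weak limits. -/
lemma HasWeakPartial.of_weakConv {i : Fin 5} {u g : ℕ → E5 → ℂ} {u' g' : E5 → ℂ}
    (h : ∀ n, HasWeakPartial i (u n) (g n)) (hu : WeakConv u u') (hg : WeakConv g g') :
    HasWeakPartial i u' g' := by
  intro ψ hψ
  have h1 := hu _ (hψ.fderiv (EuclideanSpace.single i 1)).memLp_ofReal
  have h2 := (hg _ hψ.memLp_ofReal).neg
  simp_rw [← Complex.real_smul] at h1 h2
  refine tendsto_nhds_unique h1 (h2.congr fun n => ?_)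
  exact (h n ψ hψ).symm

/-- Mollification turns weak into pointwise convergence, which is the source of local compactness. -/
lemma WeakConv.tendsto_conv {ρ : E5 → ℝ} (hρ : IsTest ρ) {f : ℕ → E5 → ℂ} {g : E5 → ℂ}
    (h : WeakConv f g) (x : E5) :
    Tendsto (fun n => conv ρ (f n) x) atTop (𝓝 (conv ρ g x)) := by
  simp_rw [conv_apply_swap, Complex.real_smul]
  exact h _ (hρ.comp_sub x).memLp_ofReal

lemma norm_conv_sq_le {ρ : E5 → ℝ} (hρ : IsMollifier ρ) {B : ℝ} (hB : ∀ x, ρ x ≤ B)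
    {v : E5 → ℂ} (hv : MemLp v 2) (x : E5) : ‖conv ρ v x‖ ^ 2 ≤ B * normL2Sq v := by
  have hB0 : 0 ≤ B := (hρ.nonneg 0).trans (hB 0)
  have h1 := enorm_integral_smul_sq_le (μ := (volume : Measure E5)) (ρ := fun t => ρ (x - t))
    (Φ := v) ((hρ.test.comp_sub x).1.continuous.measurable.aemeasurable) (fun t => hρ.nonneg _) hv.1
  have e : ∫⁻ t, ENNReal.ofReal (ρ (x - t)) = 1 := by
    rw [lintegral_sub_left_eq_self (fun t => ENNReal.ofReal (ρ t)) x, hρ.lintegral_eq]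
  rw [e, one_mul, ← conv_apply_swap] at h1
  have h2 : ∫⁻ t, ENNReal.ofReal (ρ (x - t)) * ‖v t‖ₑ ^ 2 ≤ ENNReal.ofReal (B * normL2Sq v) := by
    rw [ENNReal.ofReal_mul hB0, ← lsq_eq_normL2Sq hv, lsq, ← lintegral_const_mul' _ _
      ENNReal.ofReal_ne_top]
    exact lintegral_mono fun t => mul_le_mul_left (ENNReal.ofReal_le_ofReal (hB _)) _
  have h3 := h1.trans h2
  rw [← ofReal_norm, ← ENNReal.ofReal_pow (norm_nonneg _)] at h3
  exact (ENNReal.ofReal_le_ofReal_iff (by have := normL2Sq_nonneg v; positivity)).1 h3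

lemma IsTest.exists_bound {ρ : E5 → ℝ} (hρ : IsTest ρ) : ∃ B, ∀ x, ρ x ≤ B := by
  obtain ⟨C, hC⟩ := hρ.1.continuous.bounded_above_of_compact_support hρ.2
  exact ⟨C, fun x => (le_abs_self _).trans (hC x)⟩

/-- **Rellich's theorem**: a sequence that is bounded in `H¹` and tends weakly to zero tends to zero
strongly in `L²` on balls. -/
lemma rellich {v : ℕ → E5 → ℂ} (hv : ∀ n, MemH1 (v n)) {A : ℝ}
    (hA : ∀ n, normL2Sq (v n) ≤ A) (hA' : ∀ n, normH1DotSq (v n) ≤ A) (hw : WeakConv v 0) (R : ℝ) :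
    Tendsto (fun n => ∫ x in Metric.ball (0 : E5) R, ‖v n x‖ ^ 2) atTop (𝓝 0) := by
  have hA0 : 0 ≤ A := (normL2Sq_nonneg _).trans (hA 0)
  rw [Metric.tendsto_atTop]
  intro ε hε
  have hlim : Tendsto (fun m : ℕ => 2 * ((1 / ((m : ℝ) + 1)) ^ 2 * A)) atTop (𝓝 0) := by
    have := (((tendsto_one_div_add_atTop_nhds_zero_nat (𝕜 := ℝ)).pow 2).mul_const A).const_mul 2
    simpa using this
  obtain ⟨m, hm⟩ := (hlim.eventually (gt_mem_nhds (half_pos hε))).exists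
  have hmol := isMollifier_mollifier m
  obtain ⟨B, hB⟩ := hmol.test.exists_bound
  have hB0 : 0 ≤ B := (hmol.nonneg 0).trans (hB 0)
  have hdom : Tendsto (fun n => ∫ x in Metric.ball (0 : E5) R, ‖conv (mollifier m) (v n) x‖ ^ 2)
      atTop (𝓝 (∫ x in Metric.ball (0 : E5) R, 0)) := by
    refine tendsto_integral_of_dominated_convergence (fun _ => B * A) (fun n => ?_) ?_
      (fun n => ae_of_all _ fun x => ?_) (ae_of_all _ fun x => ?_)
    · exact (((hmol.memLp_conv (hv n).1).1.norm.pow 2)).restrict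
    · exact integrableOn_const (by exact measure_ball_lt_top.ne)
    · rw [Real.norm_of_nonneg (by positivity)]
      exact (norm_conv_sq_le hmol hB (hv n).1 x).trans (mul_le_mul_of_nonneg_left (hA n) hB0)
    · have h1 := (hw.tendsto_conv hmol.test x).norm.pow 2
      simpa [conv] using h1
  rw [integral_zero, Metric.tendsto_atTop] at hdom
  obtain ⟨N, hN⟩ := hdom (ε / 4) (by positivity)
  refine ⟨N, fun n hn => ?_⟩
  have h1 := hN n hn
  rw [Real.dist_eq, sub_zero, abs_of_nonneg (integral_nonneg fun x => by positivity)] at h1 ⊢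
  have hc := hmol.memLp_conv (hv n).1
  have h2 : ∫ x in Metric.ball (0 : E5) R, ‖v n x‖ ^ 2
      ≤ ∫ x in Metric.ball (0 : E5) R,
        (2 * ‖(conv (mollifier m) (v n) - v n) x‖ ^ 2 + 2 * ‖conv (mollifier m) (v n) x‖ ^ 2) := by
    refine integral_mono (integrable_sq (hv n).1).integrableOn ?_ fun x => ?_
    · exact (((integrable_sq (hc.sub (hv n).1)).const_mul 2).add
        ((integrable_sq hc).const_mul 2)).integrableOn
    · have h3 : ‖v n x‖ ≤ ‖(conv (mollifier m) (v n) - v n) x‖ + ‖conv (mollifier m) (v n) x‖ := by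
        rw [Pi.sub_apply, norm_sub_rev]
        have := norm_add_le (v n x - conv (mollifier m) (v n) x) (conv (mollifier m) (v n) x)
        simpa using this
      nlinarith [norm_nonneg (v n x), sq_nonneg (‖(conv (mollifier m) (v n) - v n) x‖
        - ‖conv (mollifier m) (v n) x‖)]
  rw [integral_add ((integrable_sq (hc.sub (hv n).1)).const_mul 2).integrableOn
    ((integrable_sq hc).const_mul 2).integrableOn, integral_const_mul, integral_const_mul] at h2
  have h4 : ∫ x in Metric.ball (0 : E5) R, ‖(conv (mollifier m) (v n) - v n) x‖ ^ 2
      ≤ (1 / ((m : ℝ) + 1)) ^ 2 * A := by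
    refine (setIntegral_le_integral (integrable_sq (hc.sub (hv n).1))
      (ae_of_all _ fun x => by positivity)).trans ?_
    exact (normL2Sq_conv_mollifier_sub_le (hv n) m).trans
      (mul_le_mul_of_nonneg_left (hA' n) (by positivity))
  linarith

/-- Products of a fixed function with a sequence tending weakly to zero and a bounded sequence tend
to zero. -/
lemma tendsto_integral_mul_mul {f : E5 → ℂ} (hf : MemLp f 3) {v w : ℕ → E5 → ℂ}
    (hv : ∀ n, MemH1 (v n)) (hw : ∀ n, MemH1 (w n)) {A : ℝ}
    (hvA : ∀ n, normL2Sq (v n) ≤ A) (hvA' : ∀ n, normH1DotSq (v n) ≤ A)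
    (hwA : ∀ n, normL2Sq (w n) ≤ A)
    (hvB : ∀ n, ∫ x, ‖v n x‖ ^ 3 ≤ A) (hwB : ∀ n, ∫ x, ‖w n x‖ ^ 3 ≤ A) (hv0 : WeakConv v 0) :
    Tendsto (fun n => ∫ x, ‖f x‖ * ‖v n x‖ * ‖w n x‖) atTop (𝓝 0) := by
  have hA0 : 0 ≤ A := (normL2Sq_nonneg _).trans (hvA 0)
  rw [Metric.tendsto_atTop]
  intro ε hε
  -- Where `f` is large or `x` is far away, the weights `l ^ 2`, `l⁻¹`, `l⁻¹` in the inequality for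
  -- `a b c` leave a large multiple of a small integral of `|f| ^ 3`; elsewhere `f` is bounded by `N`,
  -- and Rellich's theorem applies to `v`.
  obtain ⟨l, hl0, hl⟩ : ∃ l : ℝ, 0 < l ∧ (l ^ 3)⁻¹ * (A + A) ≤ ε / 4 := by
    refine ⟨((A + A + 1) * 4 / ε + 1), by positivity, ?_⟩
    set y := (A + A + 1) * 4 / ε + 1 with hy
    have hy1 : 1 ≤ y := by rw [hy]; have : 0 ≤ (A + A + 1) * 4 / ε := by positivity
                           linarith
    have hy3 : y ≤ y ^ 3 := by nlinarith [sq_nonneg (y - 1), sq_nonneg y]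
    rw [inv_mul_le_iff₀ (by positivity)]
    have : (A + A + 1) * 4 / ε ≤ y ^ 3 := by linarith
    rw [div_le_iff₀ hε] at this
    nlinarith
  let S : ℕ → Set E5 := fun N => {x | ‖x‖ < N ∧ ‖f x‖ ≤ N}
  obtain ⟨N, hN⟩ : ∃ N : ℕ, l ^ 6 * ∫ x, (S N)ᶜ.indicator (fun x => ‖f x‖ ^ 3) x ≤ ε / 4 := by
    have hlim : Tendsto (fun N : ℕ => l ^ 6 * ∫ x, (S N)ᶜ.indicator (fun x => ‖f x‖ ^ 3) x) atTop
        (𝓝 (l ^ 6 * ∫ x : E5, (0 : ℝ))) := by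
      refine Tendsto.const_mul _ (tendsto_integral_of_dominated_convergence (fun x => ‖f x‖ ^ 3)
        (fun N => ?_) (integrable_cube hf) (fun N => ae_of_all _ fun x => ?_)
        (ae_of_all _ fun x => ?_))
      · have hS : NullMeasurableSet (S N) := by
          refine (measurableSet_lt measurable_norm measurable_const).nullMeasurableSet.inter ?_
          exact nullMeasurableSet_le hf.1.norm.aemeasurable aemeasurable_const
        exact (hf.1.norm.pow 3).indicator₀ hS.compl
      · refine (norm_indicator_le_norm_self _ _).trans (le_of_eq ?_)
        rw [Real.norm_of_nonneg (by positivity)]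
      · refine tendsto_const_nhds.congr' ?_
        filter_upwards [eventually_gt_atTop ⌈max ‖x‖ ‖f x‖⌉₊] with N hN
        have hlt : max ‖x‖ ‖f x‖ < N := Nat.lt_of_ceil_lt hN
        rw [Set.indicator_of_notMem]
        simp only [Set.mem_compl_iff, not_not]
        exact ⟨(le_max_left _ _).trans_lt hlt, ((le_max_right _ _).trans_lt hlt).le⟩
    rw [integral_zero, mul_zero] at hlim
    exact ((hlim.eventually (gt_mem_nhds (by positivity : (0 : ℝ) < ε / 4))).exists).imp
      fun N h => h.le
  obtain ⟨s, hs0, hs⟩ : ∃ s : ℝ, 0 < s ∧ N * (s⁻¹ * A) ≤ ε / 4 := by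
    refine ⟨N * A * 4 / ε + 1, by positivity, ?_⟩
    rw [mul_left_comm, inv_mul_le_iff₀ (by positivity)]
    have : N * A * 4 / ε * (ε / 4) = N * A := by field_simp
    nlinarith
  have hR := (rellich hv hvA hvA' hv0 N).const_mul (N * s)
  rw [mul_zero, Metric.tendsto_atTop] at hR
  obtain ⟨n0, hn0⟩ := hR (ε / 4) (by positivity)
  refine ⟨n0, fun n hn => ?_⟩
  have h1 := hn0 n hn
  rw [Real.dist_eq, sub_zero] at h1 ⊢
  rw [abs_of_nonneg (integral_nonneg fun x => by positivity)]
  have h1' := (le_abs_self _).trans_lt h1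
  have hv3 := (hv n).memLp_three
  have hw3 := (hw n).memLp_three
  have hSm : NullMeasurableSet (S N) := by
    refine (measurableSet_lt measurable_norm measurable_const).nullMeasurableSet.inter ?_
    exact nullMeasurableSet_le hf.1.norm.aemeasurable aemeasurable_const
  have i1 : Integrable (fun x => l ^ 6 * (S N)ᶜ.indicator (fun x => ‖f x‖ ^ 3) x) :=
    ((integrable_cube hf).indicator₀ hSm.compl).const_mul _
  have i2 : Integrable (fun x => (l ^ 3)⁻¹ * (‖v n x‖ ^ 3 + ‖w n x‖ ^ 3)) :=
    ((integrable_cube hv3).add (integrable_cube hw3)).const_mul _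
  have i3 : Integrable (fun x => (N * s) * (Metric.ball (0 : E5) N).indicator
      (fun x => ‖v n x‖ ^ 2) x) :=
    ((integrable_sq (hv n).1).indicator measurableSet_ball).const_mul _
  have i4 : Integrable (fun x => N * (s⁻¹ * ‖w n x‖ ^ 2)) :=
    ((integrable_sq (hw n).1).const_mul _).const_mul _
  have hpt : ∀ x, ‖f x‖ * ‖v n x‖ * ‖w n x‖
      ≤ (l ^ 6 * (S N)ᶜ.indicator (fun x => ‖f x‖ ^ 3) x + (l ^ 3)⁻¹ * (‖v n x‖ ^ 3 + ‖w n x‖ ^ 3))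
        + ((N * s) * (Metric.ball (0 : E5) N).indicator (fun x => ‖v n x‖ ^ 2) x
          + N * (s⁻¹ * ‖w n x‖ ^ 2)) := by
    intro x
    by_cases hx : x ∈ S N
    · have hxb : x ∈ Metric.ball (0 : E5) N := by
        rw [mem_ball_zero_iff]; exact hx.1
      rw [Set.indicator_of_notMem (by simpa using hx), Set.indicator_of_mem hxb]
      have e1 : ‖f x‖ * ‖v n x‖ * ‖w n x‖ ≤ N * (‖v n x‖ * ‖w n x‖) := by
        rw [mul_assoc]
        exact mul_le_mul_of_nonneg_right hx.2 (by positivity)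
      have e2 : ‖v n x‖ * ‖w n x‖ ≤ s * ‖v n x‖ ^ 2 + s⁻¹ * ‖w n x‖ ^ 2 := by
        have e3 : 0 ≤ s⁻¹ * (s * ‖v n x‖ - ‖w n x‖) ^ 2 := by positivity
        have e4 : s⁻¹ * (s * ‖v n x‖ - ‖w n x‖) ^ 2
            = s * ‖v n x‖ ^ 2 + s⁻¹ * ‖w n x‖ ^ 2 - 2 * (‖v n x‖ * ‖w n x‖) := by
          field_simp; ring
        have e5 : 0 ≤ ‖v n x‖ * ‖w n x‖ := by positivity
        linarith
      have e3 := mul_le_mul_of_nonneg_left e2 (Nat.cast_nonneg (α := ℝ) N)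
      have e4 : 0 ≤ (l ^ 3)⁻¹ * (‖v n x‖ ^ 3 + ‖w n x‖ ^ 3) := by positivity
      linarith
    · rw [Set.indicator_of_mem (by simpa using hx)]
      have e1 := mul_mul_le_cubes (a := l ^ 2 * ‖f x‖) (b := l⁻¹ * ‖v n x‖) (c := l⁻¹ * ‖w n x‖)
        (by positivity) (by positivity) (by positivity)
      have e2 : l ^ 2 * ‖f x‖ * (l⁻¹ * ‖v n x‖) * (l⁻¹ * ‖w n x‖) = ‖f x‖ * ‖v n x‖ * ‖w n x‖ := by
        field_simp
      have e3 : (l ^ 2 * ‖f x‖) ^ 3 + (l⁻¹ * ‖v n x‖) ^ 3 + (l⁻¹ * ‖w n x‖) ^ 3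
          = l ^ 6 * ‖f x‖ ^ 3 + (l ^ 3)⁻¹ * (‖v n x‖ ^ 3 + ‖w n x‖ ^ 3) := by
        rw [mul_pow, mul_pow, mul_pow, inv_pow]; ring
      rw [e2, e3] at e1
      have e4 : 0 ≤ l ^ 6 * ‖f x‖ ^ 3 + (l ^ 3)⁻¹ * (‖v n x‖ ^ 3 + ‖w n x‖ ^ 3) := by positivity
      have e5 : 0 ≤ (N * s) * (Metric.ball (0 : E5) N).indicator (fun x => ‖v n x‖ ^ 2) x :=
        mul_nonneg (by positivity) (Set.indicator_nonneg (fun x _ => by positivity) x)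
      have e6 : 0 ≤ N * (s⁻¹ * ‖w n x‖ ^ 2) := by positivity
      linarith
  have i12 : Integrable (fun x => l ^ 6 * (S N)ᶜ.indicator (fun x => ‖f x‖ ^ 3) x
    + (l ^ 3)⁻¹ * (‖v n x‖ ^ 3 + ‖w n x‖ ^ 3)) := i1.add i2
  have i34 : Integrable (fun x => (N * s) * (Metric.ball (0 : E5) N).indicator
      (fun x => ‖v n x‖ ^ 2) x + N * (s⁻¹ * ‖w n x‖ ^ 2)) := i3.add i4
  have h2 := integral_mono (integrable_mul_mul hf hv3 hw3) (i12.add i34) hpt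
  simp only [Pi.add_apply] at h2
  rw [integral_add i12 i34, integral_add i1 i2, integral_add i3 i4, integral_const_mul,
    integral_const_mul, integral_const_mul, integral_const_mul, integral_const_mul,
    integral_add (integrable_cube hv3) (integrable_cube hw3),
    integral_indicator measurableSet_ball] at h2
  have h3 : (l ^ 3)⁻¹ * ((∫ x, ‖v n x‖ ^ 3) + ∫ x, ‖w n x‖ ^ 3) ≤ ε / 4 :=
    (mul_le_mul_of_nonneg_left (add_le_add (hvB n) (hwB n)) (by positivity)).trans hl
  have h4 : (N : ℝ) * (s⁻¹ * ∫ x, ‖w n x‖ ^ 2) ≤ ε / 4 :=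
    (mul_le_mul_of_nonneg_left (mul_le_mul_of_nonneg_left (hwA n) (by positivity))
      (by positivity)).trans hs
  linarith

/-! ### Splitting along weakly convergent sequences -/

lemma exists_cube_bound (A : ℝ) : ∃ B : ℝ, ∀ u : E5 → ℂ, MemH1 u → normL2Sq u ≤ A →
    normH1DotSq u ≤ A → ∫ x, ‖u x‖ ^ 3 ≤ B := by
  obtain ⟨C, hC0, hC⟩ := exists_gagliardo_nirenberg
  refine ⟨C * (A ^ (1 / 4 : ℝ) * A ^ (5 / 4 : ℝ)), fun u hu h1 h2 => (hC u hu).2.trans ?_⟩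
  have hA : 0 ≤ A := (normL2Sq_nonneg u).trans h1
  refine mul_le_mul_of_nonneg_left (mul_le_mul ?_ ?_ ?_ ?_) hC0
  · exact Real.rpow_le_rpow (normL2Sq_nonneg u) h1 (by norm_num)
  · exact Real.rpow_le_rpow (normH1DotSq_nonneg u) h2 (by norm_num)
  · exact Real.rpow_nonneg (normH1DotSq_nonneg u) _
  · positivity

/-- Weak lower semicontinuity of the `L²` norm of a finite family. -/
lemma sum_normL2Sq_le_of_weakConv {ι : Type*} [Fintype ι] {f : ℕ → ι → E5 → ℂ} {g : ι → E5 → ℂ}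
    (hf : ∀ n i, MemLp (f n i) 2) (hg : ∀ i, MemLp (g i) 2)
    (h : ∀ i, WeakConv (fun n => f n i) (g i)) {A : ℝ} (hA : ∀ n, ∑ i, normL2Sq (f n i) ≤ A) :
    ∑ i, normL2Sq (g i) ≤ A := by
  refine le_of_tendsto (tendsto_finsetSum Finset.univ fun i _ =>
    (h i).tendsto_normL2Sq_sub (fun n => hf n i) (hg i)) (Eventually.of_forall fun n => ?_)
  refine le_trans (Finset.sum_le_sum fun i _ => ?_) (hA n)
  linarith [normL2Sq_nonneg (f n i - g i)]

lemma normL2Sq_le_of_weakConv {f : ℕ → E5 → ℂ} {g : E5 → ℂ}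
    (hf : ∀ n, MemLp (f n) 2) (hg : MemLp g 2)
    (h : WeakConv f g) {A : ℝ} (hA : ∀ n, normL2Sq (f n) ≤ A) : normL2Sq g ≤ A := by
  have := sum_normL2Sq_le_of_weakConv (ι := Unit) (f := fun n _ => f n) (g := fun _ => g)
    (fun n _ => hf n) (fun _ => hg) (fun _ => h) (A := A) (by simpa using hA)
  simpa using this

/-- Weak convergence in `H¹`: weak convergence in `L²` of the functions and their gradients. -/
structure WeakConvH1 (u : ℕ → E5 → ℂ) (w : E5 → ℂ) : Prop where
  mem : ∀ n, MemH1 (u n)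
  mem_lim : MemH1 w
  conv : WeakConv u w
  conv_partial : ∀ i, WeakConv (fun n => weakPartial i (u n)) (weakPartial i w)

/-- Bounded sequences of triples in `H¹` have weakly convergent subsequences. -/
lemma exists_weakConvH1_subseq {U : ℕ → Fin 3 → E5 → ℂ} (hU : ∀ n j, MemH1 (U n j)) {A : ℝ}
    (hA : ∀ n j, normL2Sq (U n j) ≤ A) (hA' : ∀ n j, normH1DotSq (U n j) ≤ A) :
    ∃ φ : ℕ → ℕ, StrictMono φ ∧ ∃ W : Fin 3 → E5 → ℂ,
      ∀ j, WeakConvH1 (fun n => U (φ n) j) (W j) := by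
  let f : ℕ → Fin 3 × Option (Fin 5) → E5 → ℂ := fun n p =>
    p.2.elim (U n p.1) (fun i => weakPartial i (U n p.1))
  obtain ⟨φ, hφ, g, hg⟩ := exists_weakConv_subseq_family (f := f) (A := A)
    (by
      rintro n ⟨j, _ | i⟩
      · exact (hU n j).1
      · exact (hU n j).memLp_weakPartial i)
    (by
      rintro n ⟨j, _ | i⟩
      · exact hA n j
      · exact (Finset.single_le_sum (f := fun i => normL2Sq (weakPartial i (U n j)))
          (fun i _ => normL2Sq_nonneg _) (Finset.mem_univ i)).trans (hA' n j))
  have hw : ∀ j i, HasWeakPartial i (g (j, none)) (g (j, some i)) := fun j i =>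
    HasWeakPartial.of_weakConv (fun n => (hU (φ n) j).hasWeakPartial i) (hg (j, none)).2
      (hg (j, some i)).2
  refine ⟨φ, hφ, fun j => g (j, none), fun j => ⟨fun n => hU _ _,
    memH1_of (hg (j, none)).1 (fun i => (hg (j, some i)).1) (hw j), (hg (j, none)).2, fun i => ?_⟩⟩
  intro h hh
  have e := weakPartial_ae_eq (hg (j, some i)).1 (hw j i)
  have : ∫ x, h x * weakPartial i (g (j, none)) x = ∫ x, h x * g (j, some i) x :=
    integral_congr_ae (by filter_upwards [e] with x hx; rw [hx])
  rw [this]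
  exact (hg (j, some i)).2 h hh

lemma WeakConvH1.tendsto_normH1DotSq_sub {u : ℕ → E5 → ℂ} {w : E5 → ℂ} (h : WeakConvH1 u w) :
    Tendsto (fun n => normH1DotSq (u n) - normH1DotSq (u n - w)) atTop (𝓝 (normH1DotSq w)) := by
  have h1 := tendsto_finsetSum Finset.univ fun i _ =>
    (h.conv_partial i).tendsto_normL2Sq_sub (fun n => (h.mem n).memLp_weakPartial i)
      (h.mem_lim.memLp_weakPartial i)
  refine h1.congr fun n => ?_
  rw [Finset.sum_sub_distrib]
  congr 1
  exact Finset.sum_congr rfl fun i _ => (normL2Sq_congr (weakPartial_sub (h.mem n) h.mem_lim i)).symm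

lemma normL2Sq_sub_le {f g : E5 → ℂ} (hf : MemLp f 2) (hg : MemLp g 2) :
    normL2Sq (f - g) ≤ 2 * normL2Sq f + 2 * normL2Sq g := by
  have h1 := normL2Sq_sub hf hg
  have h2 := normL2Sq_add hf hg
  have h3 := normL2Sq_nonneg (f + g)
  rw [ip_comm] at h2
  linarith

lemma normH1DotSq_sub_le {f g : E5 → ℂ} (hf : MemH1 f) (hg : MemH1 g) :
    normH1DotSq (f - g) ≤ 2 * normH1DotSq f + 2 * normH1DotSq g := by
  have h : normH1DotSq (f - g) = ∑ i, normL2Sq (weakPartial i f - weakPartial i g) :=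
    Finset.sum_congr rfl fun i _ => normL2Sq_congr (weakPartial_sub hf hg i)
  rw [h, normH1DotSq, normH1DotSq, Finset.mul_sum, Finset.mul_sum, ← Finset.sum_add_distrib]
  exact Finset.sum_le_sum fun i _ =>
    normL2Sq_sub_le (hf.memLp_weakPartial i) (hg.memLp_weakPartial i)

/-- The potential energy splits along weakly convergent bounded sequences. -/
lemma tendsto_V_sub {U : ℕ → Fin 3 → E5 → ℂ} {W : Fin 3 → E5 → ℂ} {A : ℝ}
    (hA : ∀ n j, normL2Sq (U n j) ≤ A) (hA' : ∀ n j, normH1DotSq (U n j) ≤ A)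
    (h : ∀ j, WeakConvH1 (fun n => U n j) (W j)) :
    Tendsto (fun n => V (U n) - V (U n - W)) atTop (𝓝 (V W)) := by
  have hA0 : 0 ≤ A := (normL2Sq_nonneg _).trans (hA 0 0)
  have hU : ∀ n j, MemH1 (U n j) := fun n j => (h j).mem n
  have hW : ∀ j, MemH1 (W j) := fun j => (h j).mem_lim
  have hd : ∀ n j, MemH1 ((U n - W) j) := fun n j => (hU n j).sub (hW j)
  have hWA : ∀ j, normL2Sq (W j) ≤ A := fun j =>
    normL2Sq_le_of_weakConv (fun n => (hU n j).1) (hW j).1 (h j).conv (fun n => hA n j)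
  have hWA' : ∀ j, normH1DotSq (W j) ≤ A := fun j =>
    sum_normL2Sq_le_of_weakConv (fun n i => (hU n j).memLp_weakPartial i)
      (hW j).memLp_weakPartial (h j).conv_partial (fun n => hA' n j)
  have hdA : ∀ n j, normL2Sq ((U n - W) j) ≤ 4 * A := fun n j =>
    (normL2Sq_sub_le (hU n j).1 (hW j).1).trans (by linarith [hA n j, hWA j])
  have hdA' : ∀ n j, normH1DotSq ((U n - W) j) ≤ 4 * A := fun n j =>
    (normH1DotSq_sub_le (hU n j) (hW j)).trans (by linarith [hA' n j, hWA' j])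
  obtain ⟨B, hB⟩ := exists_cube_bound (4 * A)
  have hd0 : ∀ j, WeakConv (fun n => (U n - W) j) 0 := fun j =>
    (h j).conv.sub_self (fun n => (hU n j).1) (hW j).1
  set D : ℝ := max (4 * A) B
  have key : ∀ (a b : Fin 3) (w : ℕ → E5 → ℂ), (∀ n, MemH1 (w n)) →
      (∀ n, normL2Sq (w n) ≤ 4 * A) → (∀ n, normH1DotSq (w n) ≤ 4 * A) →
      Tendsto (fun n => ∫ x, ‖W a x‖ * ‖(U n - W) b x‖ * ‖w n x‖) atTop (𝓝 0) := by
    intro a b w hw hw1 hw2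
    exact tendsto_integral_mul_mul (A := D) (hW a).memLp_three (fun n => hd n b) hw
      (fun n => (hdA n b).trans (le_max_left _ _)) (fun n => (hdA' n b).trans (le_max_left _ _))
      (fun n => (hw1 n).trans (le_max_left _ _))
      (fun n => (hB _ (hd n b) (hdA n b) (hdA' n b)).trans (le_max_right _ _))
      (fun n => (hB _ (hw n) (hw1 n) (hw2 n)).trans (le_max_right _ _)) (hd0 b)
  have kW : ∀ a b c : Fin 3, Tendsto (fun n => ∫ x, ‖W a x‖ * ‖(U n - W) b x‖ * ‖W c x‖) atTop
      (𝓝 0) := fun a b c => key a b (fun _ => W c) (fun _ => hW c)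
        (fun _ => (hWA c).trans (by linarith)) (fun _ => (hWA' c).trans (by linarith))
  have kd : ∀ a b c : Fin 3, Tendsto (fun n => ∫ x, ‖W a x‖ * ‖(U n - W) b x‖ * ‖(U n - W) c x‖)
      atTop (𝓝 0) := fun a b c => key a b (fun n => (U n - W) c) (fun n => hd n c)
        (fun n => hdA n c) (fun n => hdA' n c)
  have hW3 : ∀ j, MemLp (W j) 3 := fun j => (hW j).memLp_three
  have hd3 : ∀ n j, MemLp ((U n - W) j) 3 := fun n j => (hd n j).memLp_three
  have hU3 : ∀ n j, MemLp (U n j) 3 := fun n j => (hU n j).memLp_three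
  -- The six mixed terms of the trilinear expansion all tend to zero.
  have t1 : Tendsto (fun n => tri ((U n - W) 0) (W 1) (W 2)) atTop (𝓝 0) :=
    squeeze_zero_norm (fun n => (abs_tri_le (hd3 n 0) (hW3 1) (hW3 2)).trans
      (le_of_eq (integral_congr_ae (ae_of_all _ fun x => by simp only; ring)))) (kW 1 0 2)
  have t2 : Tendsto (fun n => tri (W 0) ((U n - W) 1) (W 2)) atTop (𝓝 0) :=
    squeeze_zero_norm (fun n => (abs_tri_le (hW3 0) (hd3 n 1) (hW3 2)).trans
      (le_of_eq (integral_congr_ae (ae_of_all _ fun x => by simp only))))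
      (kW 0 1 2)
  have t3 : Tendsto (fun n => tri (W 0) (W 1) ((U n - W) 2)) atTop (𝓝 0) :=
    squeeze_zero_norm (fun n => (abs_tri_le (hW3 0) (hW3 1) (hd3 n 2)).trans
      (le_of_eq (integral_congr_ae (ae_of_all _ fun x => by simp only; ring)))) (kW 0 2 1)
  have t4 : Tendsto (fun n => tri (W 0) ((U n - W) 1) ((U n - W) 2)) atTop (𝓝 0) :=
    squeeze_zero_norm (fun n => (abs_tri_le (hW3 0) (hd3 n 1) (hd3 n 2)).trans
      (le_of_eq (integral_congr_ae (ae_of_all _ fun x => by simp only)))) (kd 0 1 2)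
  have t5 : Tendsto (fun n => tri ((U n - W) 0) (W 1) ((U n - W) 2)) atTop (𝓝 0) :=
    squeeze_zero_norm (fun n => (abs_tri_le (hd3 n 0) (hW3 1) (hd3 n 2)).trans
      (le_of_eq (integral_congr_ae (ae_of_all _ fun x => by simp only; ring)))) (kd 1 0 2)
  have t6 : Tendsto (fun n => tri ((U n - W) 0) ((U n - W) 1) (W 2)) atTop (𝓝 0) :=
    squeeze_zero_norm (fun n => (abs_tri_le (hd3 n 0) (hd3 n 1) (hW3 2)).trans
      (le_of_eq (integral_congr_ae (ae_of_all _ fun x => by simp only; ring)))) (kd 2 0 1)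
  have t := (((((t1.add t2).add t3).add t4).add t5).add t6).const_add (V W)
  simp only [add_zero] at t
  refine t.congr fun n => ?_
  have e : ∀ j, U n j = W j + (U n - W) j := fun j => by
    funext x; simp [Pi.sub_apply]
  have eV : V (U n) = tri (W 0 + (U n - W) 0) (W 1 + (U n - W) 1) (W 2 + (U n - W) 2) := by
    rw [V_eq_tri (hU3 n), ← e 0, ← e 1, ← e 2]
  rw [eV, V_eq_tri hW3, V_eq_tri (hd3 n),
    tri_add_left (hW3 0) (hd3 n 0) ((hW3 1).add (hd3 n 1)) ((hW3 2).add (hd3 n 2)),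
    tri_add_middle (hW3 0) (hW3 1) (hd3 n 1) ((hW3 2).add (hd3 n 2)),
    tri_add_middle (hd3 n 0) (hW3 1) (hd3 n 1) ((hW3 2).add (hd3 n 2)),
    tri_add_right (hW3 0) (hW3 1) (hW3 2) (hd3 n 2),
    tri_add_right (hW3 0) (hd3 n 1) (hW3 2) (hd3 n 2),
    tri_add_right (hd3 n 0) (hW3 1) (hW3 2) (hd3 n 2),
    tri_add_right (hd3 n 0) (hd3 n 1) (hW3 2) (hd3 n 2)]
  ring

lemma abs_V_le_cubes {u : Fin 3 → E5 → ℂ} (hu : ∀ j, MemLp (u j) 3) :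
    |V u| ≤ (∑ j, ∫ x, ‖u j x‖ ^ 3) / 3 := by
  rw [V_eq_tri hu]
  refine (abs_tri_le (hu 0) (hu 1) (hu 2)).trans ?_
  have h01 : Integrable (fun x => ‖u 0 x‖ ^ 3 + ‖u 1 x‖ ^ 3) :=
    (integrable_cube (hu 0)).add (integrable_cube (hu 1))
  have hle : ∫ x, ‖u 0 x‖ * ‖u 1 x‖ * ‖u 2 x‖
      ≤ ∫ x, (‖u 0 x‖ ^ 3 + ‖u 1 x‖ ^ 3 + ‖u 2 x‖ ^ 3) / 3 :=
    integral_mono (integrable_mul_mul (hu 0) (hu 1) (hu 2))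
      ((h01.add (integrable_cube (hu 2))).div_const 3)
      fun x => mul_mul_le_cubes (norm_nonneg _) (norm_nonneg _) (norm_nonneg _)
  refine hle.trans (le_of_eq ?_)
  rw [integral_div, integral_add h01 (integrable_cube (hu 2)),
    integral_add (integrable_cube (hu 0)) (integrable_cube (hu 1)), Fin.sum_univ_three]

/-- Sequences with potential energy bounded below do not vanish: some mollification is bounded below
at some point. -/
lemma nonvanishing (A : ℝ) {c : ℝ} (hc : 0 < c) : ∃ (m : ℕ) (δ : ℝ), 0 < δ ∧
    ∀ U : Fin 3 → E5 → ℂ, (∀ j, MemH1 (U j)) → (∀ j, normL2Sq (U j) ≤ A) →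
      (∀ j, normH1DotSq (U j) ≤ A) → c ≤ V U →
      ∃ x j, δ ≤ ‖conv (mollifier m) (U j) x‖ := by
  obtain ⟨C, hC0, hC⟩ := exists_gagliardo_nirenberg
  set A' : ℝ := |A| + 1
  have hAA : A ≤ A' := (le_abs_self A).trans (by linarith)
  have hA'0 : 0 < A' := by positivity
  have hlim : Tendsto (fun m : ℕ => 4 * (C * (((1 / ((m : ℝ) + 1)) ^ 2 * A') ^ (1 / 4 : ℝ)
      * (4 * A') ^ (5 / 4 : ℝ)))) atTop (𝓝 0) := by
    have h1 : Tendsto (fun m : ℕ => (1 / ((m : ℝ) + 1)) ^ 2 * A') atTop (𝓝 0) := by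
      have := ((tendsto_one_div_add_atTop_nhds_zero_nat (𝕜 := ℝ)).pow 2).mul_const A'
      simpa using this
    have h2 := ((h1.rpow_const (p := (1 / 4 : ℝ)) (Or.inr (by norm_num))).mul_const
      ((4 * A') ^ (5 / 4 : ℝ))).const_mul C |>.const_mul 4
    rw [Real.zero_rpow (by norm_num)] at h2
    simpa using h2
  obtain ⟨m, hm⟩ := (hlim.eventually (gt_mem_nhds (half_pos hc))).exists
  refine ⟨m, c / (16 * A'), by positivity, fun U hU h1 h2 hV => ?_⟩
  by_contra hcon
  push Not at hcon
  have hmol := isMollifier_mollifier m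
  -- If all mollifications are small, then so are their `L³` norms, by interpolation with `L²`; the
  -- mollification error is small in `L³` by the Gagliardo–Nirenberg inequality.
  have hj : ∀ j, ∫ x, ‖U j x‖ ^ 3 < c := by
    intro j
    have hcv := memH1_conv hmol (hU j)
    have hsub := hcv.sub (hU j)
    have g1 := (hC _ hsub).2
    have g2 : ∫ x, ‖(conv (mollifier m) (U j) - U j) x‖ ^ 3
        ≤ C * (((1 / ((m : ℝ) + 1)) ^ 2 * A') ^ (1 / 4 : ℝ) * (4 * A') ^ (5 / 4 : ℝ)) := by
      refine g1.trans (mul_le_mul_of_nonneg_left (mul_le_mul ?_ ?_ ?_ ?_) hC0)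
      · refine Real.rpow_le_rpow (normL2Sq_nonneg _) ?_ (by norm_num)
        exact (normL2Sq_conv_mollifier_sub_le (hU j) m).trans
          (mul_le_mul_of_nonneg_left ((h2 j).trans hAA) (by positivity))
      · refine Real.rpow_le_rpow (normH1DotSq_nonneg _) ?_ (by norm_num)
        refine (normH1DotSq_sub_le hcv (hU j)).trans ?_
        linarith [normH1DotSq_conv_le hmol (hU j), h2 j]
      · exact Real.rpow_nonneg (normH1DotSq_nonneg _) _
      · positivity
    have g3 : ∫ x, ‖conv (mollifier m) (U j) x‖ ^ 3 ≤ c / (16 * A') * A' := by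
      have hle : ∫ x, ‖conv (mollifier m) (U j) x‖ ^ 3
          ≤ ∫ x, c / (16 * A') * ‖conv (mollifier m) (U j) x‖ ^ 2 := by
        refine integral_mono (integrable_cube hcv.memLp_three)
          ((integrable_sq hcv.1).const_mul _) fun x => ?_
        simp only
        rw [pow_succ, mul_comm]
        exact mul_le_mul_of_nonneg_right (hcon x j).le (by positivity)
      refine hle.trans ?_
      rw [integral_const_mul]
      refine mul_le_mul_of_nonneg_left ?_ (by positivity)
      exact (normL2Sq_conv_le hmol (hU j).1).trans ((h1 j).trans hAA)
    have g4 : ∫ x, ‖U j x‖ ^ 3 ≤ ∫ x, (4 * ‖(conv (mollifier m) (U j) - U j) x‖ ^ 3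
        + 4 * ‖conv (mollifier m) (U j) x‖ ^ 3) := by
      refine integral_mono (integrable_cube (hU j).memLp_three)
        (((integrable_cube hsub.memLp_three).const_mul 4).add
          ((integrable_cube hcv.memLp_three).const_mul 4)) fun x => ?_
      simp only
      set p := ‖(conv (mollifier m) (U j) - U j) x‖
      set q := ‖conv (mollifier m) (U j) x‖
      have hp : 0 ≤ p := norm_nonneg _
      have hq : 0 ≤ q := norm_nonneg _
      have hpq : ‖U j x‖ ≤ p + q := by
        have := norm_sub_le (conv (mollifier m) (U j) x) ((conv (mollifier m) (U j) - U j) x)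
        rw [Pi.sub_apply, sub_sub_cancel] at this
        exact this.trans (le_of_eq (add_comm _ _))
      refine (pow_le_pow_left₀ (norm_nonneg _) hpq 3).trans ?_
      nlinarith [mul_nonneg (add_nonneg hp hq) (sq_nonneg (p - q))]
    rw [integral_add ((integrable_cube hsub.memLp_three).const_mul 4)
      ((integrable_cube hcv.memLp_three).const_mul 4), integral_const_mul, integral_const_mul] at g4
    have g5 : c / (16 * A') * A' = c / 16 := by field_simp
    rw [g5] at g3
    linarith
  have hfin := abs_V_le_cubes fun j => (hU j).memLp_three
  rw [Fin.sum_univ_three] at hfin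
  linarith [hj 0, hj 1, hj 2, le_abs_self (V U)]

/-! ### Scaling and the existence of optimizers -/

/-- The rescaled and translated triple `m u(l x + b)`. -/
def rescale (m l : ℝ) (b : E5) (u : Fin 3 → E5 → ℂ) : Fin 3 → E5 → ℂ :=
  fun j => (m : ℂ) • fun x => u j (l • x + b)

lemma memH1_rescale {u : Fin 3 → E5 → ℂ} (hu : ∀ j, MemH1 (u j)) (m : ℝ) {l : ℝ} (hl : 0 < l)
    (b : E5) (j : Fin 3) : MemH1 (rescale m l b u j) :=
  ((hu j).comp_affine hl b).const_smul _

lemma normL2Sq_rescale (u : Fin 3 → E5 → ℂ) (m : ℝ) {l : ℝ} (hl : 0 < l) (b : E5) (j : Fin 3) :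
    normL2Sq (rescale m l b u j) = m ^ 2 * (l ^ 5)⁻¹ * normL2Sq (u j) := by
  rw [rescale, normL2Sq_const_smul, normL2Sq_comp_affine _ hl]
  simp [mul_assoc]

lemma normH1DotSq_rescale {u : Fin 3 → E5 → ℂ} (hu : ∀ j, MemH1 (u j)) (m : ℝ) {l : ℝ} (hl : 0 < l)
    (b : E5) (j : Fin 3) :
    normH1DotSq (rescale m l b u j) = m ^ 2 * (l ^ 2 * (l ^ 5)⁻¹) * normH1DotSq (u j) := by
  rw [rescale, normH1DotSq_const_smul ((hu j).comp_affine hl b), normH1DotSq_comp_affine (hu j) hl]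
  simp [mul_assoc]

lemma M_rescale (u : Fin 3 → E5 → ℂ) (m : ℝ) {l : ℝ} (hl : 0 < l) (b : E5) :
    M (rescale m l b u) = m ^ 2 * (l ^ 5)⁻¹ * M u := by
  simp only [M, normL2Sq_rescale u m hl b]; ring

lemma K_rescale (κ : Fin 3 → ℝ) {u : Fin 3 → E5 → ℂ} (hu : ∀ j, MemH1 (u j)) (m : ℝ) {l : ℝ}
    (hl : 0 < l) (b : E5) :
    K κ (rescale m l b u) = m ^ 2 * (l ^ 2 * (l ^ 5)⁻¹) * K κ u := by
  simp only [K, normH1DotSq_rescale hu m hl b, Finset.mul_sum]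
  exact Finset.sum_congr rfl fun j _ => by ring

lemma V_rescale (u : Fin 3 → E5 → ℂ) (m : ℝ) {l : ℝ} (hl : 0 < l) (b : E5) :
    V (rescale m l b u) = m ^ 3 * (l ^ 5)⁻¹ * V u := by
  have h : ∀ x, starRingEnd ℂ (rescale m l b u 0 x) * starRingEnd ℂ (rescale m l b u 1 x)
      * rescale m l b u 2 x = ((m ^ 3 : ℝ) : ℂ) * (fun y => starRingEnd ℂ (u 0 y)
        * starRingEnd ℂ (u 1 y) * u 2 y) (l • x + b) := by
    intro x
    simp only [rescale, Pi.smul_apply, smul_eq_mul, map_mul, Complex.conj_ofReal]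
    push_cast; ring
  rw [V]
  simp_rw [h]
  rw [integral_const_mul, integral_comp_affine (fun y => starRingEnd ℂ (u 0 y)
        * starRingEnd ℂ (u 1 y) * u 2 y) hl b, Complex.re_ofReal_mul, Complex.smul_re, V, smul_eq_mul]
  ring

/-- Flipping the sign of the first component flips the sign of the potential energy only. -/
def flip (u : Fin 3 → E5 → ℂ) : Fin 3 → E5 → ℂ :=
  fun j => ((if j = 0 then -1 else 1 : ℝ) : ℂ) • u j

lemma memH1_flip {u : Fin 3 → E5 → ℂ} (hu : ∀ j, MemH1 (u j)) (j : Fin 3) : MemH1 (flip u j) :=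
  (hu j).const_smul _

lemma M_flip (u : Fin 3 → E5 → ℂ) : M (flip u) = M u := by
  simp [M, flip, normL2Sq]

lemma K_flip (κ : Fin 3 → ℝ) {u : Fin 3 → E5 → ℂ} (hu : ∀ j, MemH1 (u j)) :
    K κ (flip u) = K κ u := by
  refine Finset.sum_congr rfl fun j _ => ?_
  rw [flip, normH1DotSq_const_smul (hu j)]
  split_ifs <;> simp

lemma V_flip (u : Fin 3 → E5 → ℂ) : V (flip u) = -V u := by
  have h : ∀ x, starRingEnd ℂ (flip u 0 x) * starRingEnd ℂ (flip u 1 x) * flip u 2 x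
      = -(starRingEnd ℂ (u 0 x) * starRingEnd ℂ (u 1 x) * u 2 x) := by
    intro x; simp [flip]
  rw [V]
  simp_rw [h]
  rw [integral_neg, Complex.neg_re, V]

lemma M_eq_zero_iff {u : Fin 3 → E5 → ℂ} (hu : ∀ j, MemLp (u j) 2) :
    M u = 0 ↔ ∀ j, ∀ᵐ x, u j x = 0 := by
  have h0 := normL2Sq_nonneg (u 0)
  have h1 := normL2Sq_nonneg (u 1)
  have h2 := normL2Sq_nonneg (u 2)
  simp_rw [← normL2Sq_eq_zero_iff (hu _)]
  rw [Fin.forall_fin_succ, Fin.forall_fin_succ, Fin.forall_fin_succ]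
  simp only [M, Fin.succ_zero_eq_one, IsEmpty.forall_iff, and_true]
  constructor
  · intro h
    exact ⟨by linarith, by linarith, by change normL2Sq (u 2) = 0; linarith⟩
  · rintro ⟨e0, e1, e2⟩
    change normL2Sq (u 2) = 0 at e2
    rw [e0, e1, e2]; ring

lemma M_pos {u : Fin 3 → E5 → ℂ} (hu : u ∈ H1Nonzero) : 0 < M u :=
  (M_nonneg u).lt_of_ne' fun h => hu.2 ((M_eq_zero_iff fun j => (hu.1 j).1).1 h)

/-- An `H¹` function with vanishing gradient vanishes. -/
lemma ae_zero_of_normH1DotSq_eq_zero {u : E5 → ℂ} (hu : MemH1 u) (h : normH1DotSq u = 0) :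
    ∀ᵐ x, u x = 0 := by
  obtain ⟨C, hC0, hC⟩ := exists_gagliardo_nirenberg
  obtain ⟨h3, hle⟩ := hC u hu
  rw [h, Real.zero_rpow (by norm_num), mul_zero, mul_zero] at hle
  have h0 : ∫ x, ‖u x‖ ^ 3 = 0 := le_antisymm hle (integral_nonneg fun x => by positivity)
  rw [integral_eq_zero_iff_of_nonneg (fun x => by positivity) (integrable_cube h3)] at h0
  filter_upwards [h0] with x hx
  simpa using hx

lemma K_pos {κ : Fin 3 → ℝ} (hκ : ∀ j, 0 < κ j) {u : Fin 3 → E5 → ℂ} (hu : u ∈ H1Nonzero) :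
    0 < K κ u := by
  refine (K_nonneg hκ u).lt_of_ne' fun h => hu.2 fun j => ?_
  refine ae_zero_of_normH1DotSq_eq_zero (hu.1 j) (le_antisymm ?_ (normH1DotSq_nonneg _))
  have := normH1DotSq_le_K hκ u j
  rwa [h, mul_zero] at this

/-- Optimizers of the inequality `V⁴ ≤ C M K⁵`. -/
structure IsOpt (κ : Fin 3 → ℝ) (u : Fin 3 → E5 → ℂ) : Prop where
  mem : ∀ j, MemH1 (u j)
  M_pos : 0 < M u
  K_pos : 0 < K κ u
  V_ne : V u ≠ 0
  le : ∀ w : Fin 3 → E5 → ℂ, (∀ j, MemH1 (w j)) →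
    V w ^ 4 * (M u * K κ u ^ 5) ≤ V u ^ 4 * (M w * K κ w ^ 5)

/-- The value of `V` on triples of unit mass and unit kinetic energy. -/
def unitValues (κ : Fin 3 → ℝ) : Set ℝ :=
  {y | ∃ u : Fin 3 → E5 → ℂ, (∀ j, MemH1 (u j)) ∧ M u = 1 ∧ K κ u = 1 ∧ V u = y}

/-- Every nonzero triple can be rescaled to unit mass and unit kinetic energy. -/
lemma exists_rescale_unit {κ : Fin 3 → ℝ} {u : Fin 3 → E5 → ℂ} (hu : ∀ j, MemH1 (u j))
    (hM : 0 < M u) (hK : 0 < K κ u) : ∃ r : ℝ, 0 < r ∧ r ^ 4 = M u * K κ u ^ 5 ∧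
      V u / r ∈ unitValues κ := by
  set l := Real.sqrt (M u / K κ u) with hl
  have hl0 : 0 < l := Real.sqrt_pos.2 (by positivity)
  have hl2 : l ^ 2 = M u / K κ u := Real.sq_sqrt (by positivity)
  set m := Real.sqrt (l ^ 5 / M u) with hm
  have hm0 : 0 < m := Real.sqrt_pos.2 (by positivity)
  have hm2 : m ^ 2 = l ^ 5 / M u := Real.sq_sqrt (by positivity)
  refine ⟨M u / m, by positivity, ?_, rescale m l 0 u, memH1_rescale hu m hl0 0, ?_, ?_, ?_⟩
  · have h4 : m ^ 4 = l ^ 10 / M u ^ 2 := by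
      rw [show m ^ 4 = (m ^ 2) ^ 2 by ring, hm2]; ring
    have h10 : l ^ 10 = M u ^ 5 / K κ u ^ 5 := by
      rw [show l ^ 10 = (l ^ 2) ^ 5 by ring, hl2]; ring
    rw [div_pow, h4, h10]
    field_simp
  · rw [M_rescale u m hl0, hm2]; field_simp
  · rw [K_rescale κ hu m hl0, hm2, hl2]; field_simp
  · rw [V_rescale u m hl0, show m ^ 3 = m * m ^ 2 by ring, hm2]; field_simp

lemma memH1_of_contDiff {v : E5 → ℂ} (hv : ContDiff ℝ ∞ v) (hc : HasCompactSupport v) :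
    MemH1 v := by
  refine memH1_of (hv.continuous.memLp_of_hasCompactSupport hc) (fun i => ?_)
    (fun i => hasWeakPartial_of_contDiff hv i)
  exact ((hv.continuous_fderiv (by simp)).clm_apply
    continuous_const).memLp_of_hasCompactSupport (hc.fderiv_apply (𝕜 := ℝ) _)

/-- There are triples with positive potential energy. -/
lemma exists_V_pos : ∃ u : Fin 3 → E5 → ℂ, (∀ j, MemH1 (u j)) ∧ 0 < V u := by
  set v : E5 → ℂ := fun x => ((cutoffBump x : ℝ) : ℂ) with hv
  have hvc : ContDiff ℝ ∞ v := Complex.ofRealCLM.contDiff.comp cutoffBump.contDiff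
  have hvs : HasCompactSupport v := cutoffBump.hasCompactSupport.comp_left Complex.ofReal_zero
  have hH := memH1_of_contDiff hvc hvs
  refine ⟨fun _ => v, fun _ => hH, ?_⟩
  rw [V_eq_tri fun _ => hH.memLp_three, tri]
  have e : ∀ x, (starRingEnd ℂ (v x) * starRingEnd ℂ (v x) * v x).re = cutoffBump x ^ 3 := by
    intro x
    simp only [hv, Complex.conj_ofReal]
    rw [← Complex.ofReal_mul, ← Complex.ofReal_mul, Complex.ofReal_re]; ring
  simp_rw [e]
  have hcont : Continuous fun x : E5 => cutoffBump x ^ 3 := cutoffBump.continuous.pow 3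
  refine hcont.integral_pos_of_hasCompactSupport_nonneg_nonzero (x := 0) ?_ ?_ ?_
  · exact cutoffBump.hasCompactSupport.comp_left (g := fun y : ℝ => y ^ 3) (by norm_num)
  · intro x; exact pow_nonneg cutoffBump.nonneg 3
  · have : cutoffBump (0 : E5) = 1 := cutoffBump.one_of_mem_closedBall (by simp [cutoffBump])
    simp [this]

/-- Strict superadditivity of `a ^ (1 / 4) * b ^ (5 / 4)`, which excludes a splitting of optimizers. -/
lemma eq_one_of_le_add {a b p q : ℝ} (ha : 0 ≤ a) (ha1 : a ≤ 1) (hb : 0 < b) (hb1 : b ≤ 1)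
    (hp4 : p ^ 4 = a * b ^ 5)
    (hq4 : q ^ 4 = (1 - a) * (1 - b) ^ 5) (h : 1 ≤ p + q) : a = 1 ∧ b = 1 := by
  have h1b : 0 ≤ 1 - b := by linarith
  have hq' : q ≤ 1 - b := by
    refine le_of_pow_le_pow_left₀ (n := 4) (by norm_num) h1b ?_
    rw [hq4, pow_succ (1 - b) 4]
    have : (1 - a) * (1 - b) ≤ 1 := by nlinarith
    have h4 : 0 ≤ (1 - b) ^ 4 := by positivity
    nlinarith
  have hpb : b ≤ p := by linarith
  have h4 : b ^ 4 ≤ a * b ^ 5 := by rw [← hp4]; exact pow_le_pow_left₀ hb.le hpb 4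
  have hab : 1 ≤ a * b := by
    have h5 : b ^ 4 * 1 ≤ b ^ 4 * (a * b) := by nlinarith
    exact le_of_mul_le_mul_left h5 (by positivity)
  constructor <;> nlinarith

lemma conv_comp_add {F : Type*} [NormedAddCommGroup F] [NormedSpace ℝ F] (ρ : E5 → ℝ)
    (u : E5 → F) (b x : E5) : conv ρ (fun y => u (y + b)) x = conv ρ u (x + b) := by
  simp only [conv]
  congr 1; funext t; congr 2; abel

lemma V_congr {u v : Fin 3 → E5 → ℂ} (h : ∀ j, u j =ᵐ[volume] v j) : V u = V v := by
  rw [V, V]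
  congr 1
  exact integral_congr_ae (by
    filter_upwards [h 0, h 1, h 2] with x h0 h1 h2
    rw [h0, h1, h2])

/-- Optimizers exist. -/
lemma exists_isOpt {κ : Fin 3 → ℝ} (hκ : ∀ j, 0 < κ j) :
    ∃ u : Fin 3 → E5 → ℂ, IsOpt κ u ∧ 0 < V u := by
  obtain ⟨C, hC0, hC⟩ := exists_V_pow_le hκ
  have hbdd : BddAbove (unitValues κ) := by
    refine ⟨C + 1, ?_⟩
    rintro y ⟨u, hu, hM, hK, rfl⟩
    have h := hC u hu
    rw [hM, hK] at h
    by_contra hlt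
    push Not at hlt
    have h1 : C + 1 ≤ V u ^ 4 := by
      have : V u ^ 1 ≤ V u ^ 4 := pow_le_pow_right₀ (by linarith) (by norm_num)
      linarith
    linarith
  set c := sSup (unitValues κ) with hc
  have hmk : ∀ w : Fin 3 → E5 → ℂ, (∀ j, MemH1 (w j)) →
      V w ≤ c * (M w * K κ w ^ 5) ^ (1 / 4 : ℝ) ∧ (V w ≠ 0 → 0 < M w ∧ 0 < K κ w) := by
    intro w hw
    have hM := M_nonneg w
    have hK := K_nonneg hκ w
    have hpos : V w ≠ 0 → 0 < M w ∧ 0 < K κ w := by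
      intro hV
      have h1 := hC w hw
      have h2 : 0 < V w ^ 4 := by positivity
      constructor
      · refine hM.lt_of_ne' fun h0 => ?_
        rw [h0] at h1; simp at h1; linarith
      · refine hK.lt_of_ne' fun h0 => ?_
        rw [h0] at h1; simp at h1; linarith
    refine ⟨?_, hpos⟩
    by_cases hMK : 0 < M w ∧ 0 < K κ w
    · obtain ⟨r, hr0, hr4, hr⟩ := exists_rescale_unit hw hMK.1 hMK.2
      have h1 := le_csSup hbdd hr
      rw [div_le_iff₀ hr0] at h1
      have h2 : (M w * K κ w ^ 5) ^ (1 / 4 : ℝ) = r := by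
        rw [← hr4, ← Real.rpow_natCast, ← Real.rpow_mul hr0.le]; norm_num
      rwa [h2]
    · have hV : V w = 0 := by
        by_contra h; exact hMK (hpos h)
      have h0 : M w * K κ w ^ 5 = 0 := by
        rw [not_and_or, not_lt, not_lt] at hMK
        rcases hMK with h | h
        · rw [le_antisymm h hM]; simp
        · rw [le_antisymm h hK]; simp
      rw [hV, h0, Real.zero_rpow (by norm_num), mul_zero]
  obtain ⟨u0, hu0, hV0⟩ := exists_V_pos
  have hc0 : 0 < c := by
    have h1 := (hmk u0 hu0).1
    by_contra hneg
    push Not at hneg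
    have h2 : 0 ≤ (M u0 * K κ u0 ^ 5) ^ (1 / 4 : ℝ) := by
      have := M_nonneg u0
      have := K_nonneg hκ u0
      positivity
    nlinarith
  have hne : (unitValues κ).Nonempty := by
    obtain ⟨r, -, -, hr⟩ := exists_rescale_unit hu0 ((hmk u0 hu0).2 hV0.ne').1
      ((hmk u0 hu0).2 hV0.ne').2
    exact ⟨_, hr⟩
  -- A maximizing sequence, translated so that it does not vanish.
  obtain ⟨y, -, hylim, hy⟩ := exists_seq_tendsto_sSup hne hbdd
  choose u hu hMu hKu hVu using hy
  set A : ℝ := 2 + ∑ j, 2 / κ j with hA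
  have hκ2 : ∀ j, 0 < 2 / κ j := fun j => by have := hκ j; positivity
  have hsum : 0 ≤ ∑ j, 2 / κ j := Finset.sum_nonneg fun j _ => (hκ2 j).le
  have bN : ∀ w : Fin 3 → E5 → ℂ, M w = 1 → ∀ j, normL2Sq (w j) ≤ A := by
    intro w hw j
    have := normL2Sq_le_M w j
    rw [hw] at this; linarith
  have bD : ∀ w : Fin 3 → E5 → ℂ, K κ w = 1 → ∀ j, normH1DotSq (w j) ≤ A := by
    intro w hw j
    have h1 := normH1DotSq_le_K hκ w j
    have h2 : 2 / κ j ≤ ∑ j, 2 / κ j :=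
      Finset.single_le_sum (f := fun j => 2 / κ j) (fun j _ => (hκ2 j).le) (Finset.mem_univ j)
    rw [hw, mul_one] at h1; linarith
  obtain ⟨m, δ, hδ, hnv⟩ := nonvanishing A (half_pos hc0)
  obtain ⟨N, hN⟩ := (hylim.eventually (lt_mem_nhds (half_lt_self hc0))).exists_forall_of_atTop
  have hx : ∀ n, ∃ x j, δ ≤ ‖conv (mollifier m) (u (N + n) j) x‖ := fun n =>
    hnv _ (hu _) (bN _ (hMu _)) (bD _ (hKu _)) (by
      rw [hVu]; exact (hN (N + n) (Nat.le_add_right _ _)).le)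
  choose b hb using hx
  set U : ℕ → Fin 3 → E5 → ℂ := fun n => rescale 1 1 (b n) (u (N + n)) with hUdef
  have hU : ∀ n j, MemH1 (U n j) := fun n j => memH1_rescale (hu _) 1 one_pos _ j
  have hMU : ∀ n, M (U n) = 1 := fun n => by
    rw [hUdef]; simp only [M_rescale _ _ one_pos, hMu]; norm_num
  have hKU : ∀ n, K κ (U n) = 1 := fun n => by
    rw [hUdef]; simp only [K_rescale κ (hu _) _ one_pos, hKu]; norm_num
  have hVU : ∀ n, V (U n) = y (N + n) := fun n => by
    rw [hUdef]; simp only [V_rescale _ _ one_pos, hVu]; norm_num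
  obtain ⟨φ, hφ, W, hW⟩ := exists_weakConvH1_subseq hU (fun n j => bN _ (hMU n) j)
    (fun n j => bD _ (hKU n) j)
  have hWm : ∀ j, MemH1 (W j) := fun j => (hW j).mem_lim
  -- The weak limit does not vanish.
  have hWne : W ∈ H1Nonzero := by
    refine ⟨hWm, fun h0 => ?_⟩
    have h1 := tendsto_finsetSum Finset.univ fun j _ =>
      ((hW j).conv.tendsto_conv (isMollifier_mollifier m).test 0).norm
    have h2 : ∑ j, ‖conv (mollifier m) (W j) 0‖ = 0 := by
      refine Finset.sum_eq_zero fun j _ => ?_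
      have : conv (mollifier m) (W j) = conv (mollifier m) 0 := conv_congr (h0 j)
      rw [this]; simp [conv]
    rw [h2] at h1
    refine absurd (ge_of_tendsto h1 (Eventually.of_forall fun n => ?_)) (not_le.2 hδ)
    obtain ⟨j, hj⟩ := hb (φ n)
    have h3 : conv (mollifier m) (U (φ n) j) 0 = conv (mollifier m) (u (N + φ n) j) (b (φ n)) := by
      have : U (φ n) j = fun y => u (N + φ n) j (y + b (φ n)) := by
        funext y; simp [hUdef, rescale]
      rw [this, conv_comp_add, zero_add]
    rw [← h3] at hj
    exact hj.trans (Finset.single_le_sum (f := fun j => ‖conv (mollifier m) (U (φ n) j) 0‖)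
      (fun j _ => norm_nonneg _) (Finset.mem_univ j))
  have hMW := NLSSystem.M_pos hWne
  have hKW := NLSSystem.K_pos hκ hWne
  have hd : ∀ n j, MemH1 ((U (φ n) - W) j) := fun n j => (hU _ j).sub (hWm j)
  -- Mass, kinetic and potential energy split between the limit and the remainder.
  have sN := fun j => (hW j).conv.tendsto_normL2Sq_sub (fun n => (hU (φ n) j).1) (hWm j).1
  have sM : Tendsto (fun n => M (U (φ n) - W)) atTop (𝓝 (1 - M W)) := by
    have h1 := ((((sN 0).const_mul (1 / 2)).add ((sN 1).const_mul (1 / 2))).add (sN 2)).const_sub 1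
    refine h1.congr fun n => ?_
    have h2 := hMU (φ n)
    simp only [M, Pi.sub_apply] at h2 ⊢
    linarith
  have sK : Tendsto (fun n => K κ (U (φ n) - W)) atTop (𝓝 (1 - K κ W)) := by
    have h1 := (tendsto_finsetSum Finset.univ fun j _ =>
      (hW j).tendsto_normH1DotSq_sub.const_mul (κ j / 2)).const_sub 1
    refine h1.congr fun n => ?_
    rw [← hKU (φ n)]
    simp only [K, Pi.sub_apply, mul_sub, Finset.sum_sub_distrib]; ring
  have sV : Tendsto (fun n => V (U (φ n) - W)) atTop (𝓝 (c - V W)) := by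
    have h0 : Tendsto (fun n => V (U (φ n))) atTop (𝓝 c) := by
      simp_rw [hVU]
      refine hylim.comp (tendsto_atTop_mono (fun n => Nat.le_add_left _ _) hφ.tendsto_atTop)
    have h1 := tendsto_V_sub (fun n j => bN _ (hMU (φ n)) j) (fun n j => bD _ (hKU (φ n)) j) hW
    refine (h0.sub h1).congr fun n => ?_
    ring
  have ha1 : 0 ≤ 1 - M W := ge_of_tendsto' sM fun n => M_nonneg _
  have hb1 : 0 ≤ 1 - K κ W := ge_of_tendsto' sK fun n => K_nonneg hκ _
  have hlim : c - V W ≤ c * ((1 - M W) * (1 - K κ W) ^ 5) ^ (1 / 4 : ℝ) := by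
    refine le_of_tendsto_of_tendsto' sV
      (((sM.mul (sK.pow 5)).rpow_const (Or.inr (by norm_num))).const_mul c) fun n => ?_
    exact (hmk _ (hd n)).1
  have hVW := (hmk W hWm).1
  set p := (M W * K κ W ^ 5) ^ (1 / 4 : ℝ) with hp
  set q := ((1 - M W) * (1 - K κ W) ^ 5) ^ (1 / 4 : ℝ) with hq
  have hp4 : p ^ 4 = M W * K κ W ^ 5 := by
    rw [hp, ← Real.rpow_natCast, ← Real.rpow_mul (by positivity)]; norm_num
  have hq4 : q ^ 4 = (1 - M W) * (1 - K κ W) ^ 5 := by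
    rw [hq, ← Real.rpow_natCast, ← Real.rpow_mul (by positivity)]; norm_num
  have hpq : 1 ≤ p + q := by
    have : c * 1 ≤ c * (p + q) := by linarith
    exact le_of_mul_le_mul_left this hc0
  -- The limit and the remainder cannot both carry mass and energy.
  obtain ⟨eM, eK⟩ := eq_one_of_le_add hMW.le (by linarith) hKW (by linarith)
    hp4 hq4 hpq
  have hq0 : q = 0 := by
    rw [hq, eM]; simp
  have hVge : c ≤ V W := by rw [hq0] at hlim; linarith
  have hVpos : 0 < V W := hc0.trans_le hVge
  refine ⟨W, ⟨hWm, hMW, hKW, hVpos.ne', fun w hw => ?_⟩, hVpos⟩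
  rw [eM, eK]
  have habs : |V w| ≤ c * (M w * K κ w ^ 5) ^ (1 / 4 : ℝ) := by
    refine abs_le'.2 ⟨(hmk w hw).1, ?_⟩
    -- Negative values of `V` are covered by a change of sign of one component.
    have := (hmk (flip w) (memH1_flip hw)).1
    rwa [V_flip, M_flip, K_flip κ hw] at this
  have hMw := M_nonneg w
  have hKw := K_nonneg hκ w
  calc V w ^ 4 * (1 * 1 ^ 5) = |V w| ^ 4 := by
        rw [← abs_pow, abs_of_nonneg (by positivity : 0 ≤ V w ^ 4)]; ring
    _ ≤ (c * (M w * K κ w ^ 5) ^ (1 / 4 : ℝ)) ^ 4 := pow_le_pow_left₀ (abs_nonneg _) habs 4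
    _ = c ^ 4 * (M w * K κ w ^ 5) := by
        rw [mul_pow, ← Real.rpow_natCast ((M w * K κ w ^ 5) ^ (1 / 4 : ℝ)),
          ← Real.rpow_mul (by positivity)]; norm_num
    _ ≤ V W ^ 4 * (M w * K κ w ^ 5) :=
        mul_le_mul_of_nonneg_right (pow_le_pow_left₀ hc0.le hVge 4) (by positivity)

/-! ### Optimizers are the minimizers of the Weinstein functional -/

lemma J_eq_of_V_ne {κ : Fin 3 → ℝ} {u : Fin 3 → E5 → ℂ} (hV : V u ≠ 0) :
    J κ u = ENNReal.ofReal (M u ^ (1 / 2 : ℝ) * K κ u ^ (5 / 2 : ℝ) / V u ^ 2) := by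
  rw [J, ENNReal.ofReal_div_of_pos (by positivity)]

lemma J_eq_top {κ : Fin 3 → ℝ} (hκ : ∀ j, 0 < κ j) {u : Fin 3 → E5 → ℂ} (hu : u ∈ H1Nonzero)
    (hV : V u = 0) : J κ u = ⊤ := by
  have hM := M_pos hu
  have hK := K_pos hκ hu
  rw [J, hV]
  simp only [ne_eq, OfNat.ofNat_ne_zero, not_false_eq_true, zero_pow, ENNReal.ofReal_zero]
  refine ENNReal.div_zero ?_
  rw [ne_eq, ENNReal.ofReal_eq_zero, not_le]
  positivity

lemma sq_weinstein {M K V : ℝ} (hM : 0 ≤ M) (hK : 0 ≤ K) :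
    (M ^ (1 / 2 : ℝ) * K ^ (5 / 2 : ℝ) / V ^ 2) ^ 2 = M * K ^ 5 / V ^ 4 := by
  rw [div_pow, mul_pow, ← Real.rpow_natCast (M ^ (1 / 2 : ℝ)), ← Real.rpow_natCast (K ^ (5 / 2 : ℝ)),
    ← Real.rpow_mul hM, ← Real.rpow_mul hK, ← pow_mul, ← Real.rpow_natCast K 5]
  norm_num

lemma J_le_J_iff {κ : Fin 3 → ℝ} (hκ : ∀ j, 0 < κ j) {u w : Fin 3 → E5 → ℂ}
    (hu : V u ≠ 0) (hw : V w ≠ 0) :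
    J κ u ≤ J κ w ↔ V w ^ 4 * (M u * K κ u ^ 5) ≤ V u ^ 4 * (M w * K κ w ^ 5) := by
  have h0 := M_nonneg u
  have h1 := M_nonneg w
  have h2 := K_nonneg hκ u
  have h3 := K_nonneg hκ w
  rw [J_eq_of_V_ne hu, J_eq_of_V_ne hw, ENNReal.ofReal_le_ofReal_iff (by positivity),
    ← pow_le_pow_iff_left₀ (by positivity) (by positivity) (two_ne_zero), sq_weinstein h0 h2,
    sq_weinstein h1 h3, div_le_div_iff₀ (by positivity) (by positivity)]
  constructor <;> intro h <;> linarith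

lemma IsOpt.mem_H1Nonzero {κ : Fin 3 → ℝ} {u : Fin 3 → E5 → ℂ} (hu : IsOpt κ u) :
    u ∈ H1Nonzero :=
  ⟨hu.mem, fun h => hu.M_pos.ne' ((M_eq_zero_iff fun j => (hu.mem j).1).2 h)⟩

lemma IsOpt.J_eq {κ : Fin 3 → ℝ} (hκ : ∀ j, 0 < κ j) {u : Fin 3 → E5 → ℂ} (hu : IsOpt κ u) :
    J κ u = Jmin κ := by
  refine le_antisymm (le_iInf₂ fun w hw => ?_) (iInf₂_le u hu.mem_H1Nonzero)
  by_cases hV : V w = 0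
  · rw [J_eq_top hκ hw hV]; exact le_top
  · exact (J_le_J_iff hκ hu.V_ne hV).2 (hu.le w hw.1)

lemma Jmin_lt_top {κ : Fin 3 → ℝ} (hκ : ∀ j, 0 < κ j) : Jmin κ < ⊤ := by
  obtain ⟨u, hu, -⟩ := exists_isOpt hκ
  rw [← hu.J_eq hκ, J_eq_of_V_ne hu.V_ne]
  exact ENNReal.ofReal_lt_top

lemma isOpt_of_J_eq {κ : Fin 3 → ℝ} (hκ : ∀ j, 0 < κ j) {u : Fin 3 → E5 → ℂ} (hu : u ∈ H1Nonzero)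
    (h : J κ u = Jmin κ) : IsOpt κ u := by
  have hV : V u ≠ 0 := fun h0 => by
    rw [J_eq_top hκ hu h0] at h
    exact (Jmin_lt_top hκ).ne h.symm
  refine ⟨hu.1, M_pos hu, K_pos hκ hu, hV, fun w hw => ?_⟩
  have hr : 0 ≤ V u ^ 4 * (M w * K κ w ^ 5) := by
    have := M_nonneg w
    have := K_nonneg hκ w
    positivity
  by_cases hVw : V w = 0
  · rw [hVw]; simpa using hr
  · refine (J_le_J_iff hκ hV hVw).1 (h.trans_le (iInf₂_le w ⟨hw, fun h0 => hVw ?_⟩))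
    have := V_congr (u := w) (v := fun _ => 0) h0
    rw [this]; simp [V]

/-! ### A derivative-free description of the kinetic energy -/

/-- The second moment of the ball of radius `ε` in a coordinate direction. -/
def ballMoment (ε : ℝ) : ℝ := ∫ h in Metric.ball (0 : E5) ε, inner ℝ h (EuclideanSpace.single 0 1) ^ 2

lemma integrableOn_ball {F : Type*} [NormedAddCommGroup F] {f : E5 → F} (hf : Continuous f) (ε : ℝ) :
    IntegrableOn f (Metric.ball (0 : E5) ε) :=
  (hf.continuousOn.integrableOn_compact (isCompact_closedBall (0 : E5) ε)).mono_set
    Metric.ball_subset_closedBall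

lemma setIntegral_ball_comp_isometry {F : Type*} [NormedAddCommGroup F] [NormedSpace ℝ F]
    (T : E5 ≃ₗᵢ[ℝ] E5) (f : E5 → F) (ε : ℝ) :
    ∫ h in Metric.ball (0 : E5) ε, f (T h) = ∫ h in Metric.ball (0 : E5) ε, f h := by
  have h1 := T.measurePreserving.setIntegral_preimage_emb
    T.toHomeomorph.measurableEmbedding f (Metric.ball (0 : E5) ε)
  have h2 : (T ⁻¹' Metric.ball (0 : E5) ε) = Metric.ball (0 : E5) ε := by
    ext x; simp
  rwa [h2] at h1

/-- Balls are isotropic. -/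
lemma integral_inner_sq (ε : ℝ) (a : E5) :
    ∫ h in Metric.ball (0 : E5) ε, inner ℝ h a ^ 2 = ballMoment ε * ‖a‖ ^ 2 := by
  set e : E5 := EuclideanSpace.single 0 1 with he
  have hn : ‖‖a‖ • e‖ = ‖a‖ := by simp [he, norm_smul]
  set T := (ℝ ∙ (‖a‖ • e - a))ᗮ.reflection with hT
  have hTa : T (‖a‖ • e) = a := Submodule.reflection_sub hn
  have h1 := setIntegral_ball_comp_isometry T (fun h => inner ℝ h a ^ 2) ε
  rw [← h1]
  conv_lhs => rw [← hTa]
  simp only [LinearIsometryEquiv.inner_map_map, inner_smul_right, mul_pow]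
  rw [integral_const_mul, ballMoment, mul_comm]

lemma integral_inner_mul_inner (ε : ℝ) (a b : E5) :
    ∫ h in Metric.ball (0 : E5) ε, inner ℝ h a * inner ℝ h b = ballMoment ε * inner ℝ a b := by
  have h1 := integral_inner_sq ε (a + b)
  have h2 := integral_inner_sq ε a
  have h3 := integral_inner_sq ε b
  have ia : IntegrableOn (fun h : E5 => inner ℝ h a ^ 2) (Metric.ball (0 : E5) ε) :=
    integrableOn_ball (by fun_prop) ε
  have ib : IntegrableOn (fun h : E5 => inner ℝ h b ^ 2) (Metric.ball (0 : E5) ε) :=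
    integrableOn_ball (by fun_prop) ε
  have iab : IntegrableOn (fun h : E5 => 2 * (inner ℝ h a * inner ℝ h b)) (Metric.ball (0 : E5) ε) :=
    integrableOn_ball (by fun_prop) ε
  have e : ∀ h : E5, inner ℝ h (a + b) ^ 2
      = (inner ℝ h a ^ 2 + inner ℝ h b ^ 2) + 2 * (inner ℝ h a * inner ℝ h b) := by
    intro h; rw [inner_add_right]; ring
  simp_rw [e] at h1
  have iab' : IntegrableOn (fun h : E5 => inner ℝ h a ^ 2 + inner ℝ h b ^ 2)
    (Metric.ball (0 : E5) ε) := ia.add ib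
  rw [integral_add iab' iab, integral_add ia ib, integral_const_mul, h2, h3, norm_add_sq_real] at h1
  linarith

lemma inner_single_right (h : E5) (i : Fin 5) : inner ℝ h (EuclideanSpace.single i (1 : ℝ)) = h i := by
  simp [EuclideanSpace.inner_single_right]

lemma ballMoment_pos {ε : ℝ} (hε : 0 < ε) : 0 < ballMoment ε := by
  rw [ballMoment, setIntegral_pos_iff_support_of_nonneg_ae (ae_of_all _ fun h => sq_nonneg _)
    (integrableOn_ball (by fun_prop) ε)]
  have hopen : IsOpen (Function.support (fun h : E5 =>
      inner ℝ h (EuclideanSpace.single 0 (1 : ℝ)) ^ 2) ∩ Metric.ball (0 : E5) ε) := by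
    refine IsOpen.inter ?_ Metric.isOpen_ball
    exact (by fun_prop : Continuous fun h : E5 =>
      inner ℝ h (EuclideanSpace.single 0 (1 : ℝ)) ^ 2).isOpen_support
  refine hopen.measure_pos volume ⟨EuclideanSpace.single 0 (ε / 2), ?_, ?_⟩
  · rw [Function.mem_support, inner_single_right]
    simp [hε.ne']
  · simp [abs_of_pos hε, hε]

lemma integral_norm_sq_ball (ε : ℝ) :
    ∫ h in Metric.ball (0 : E5) ε, ‖h‖ ^ 2 = 5 * ballMoment ε := by
  have e : ∀ h : E5, ‖h‖ ^ 2 = ∑ i, inner ℝ h (EuclideanSpace.single i (1 : ℝ)) ^ 2 := by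
    intro h
    rw [EuclideanSpace.norm_sq_eq]
    exact Finset.sum_congr rfl fun i _ => by rw [inner_single_right]; simp
  simp_rw [e]
  rw [integral_finsetSum _ fun i _ => integrableOn_ball (by fun_prop) ε]
  simp_rw [integral_inner_sq]
  simp

lemma norm_sum_smul_sq (z : Fin 5 → ℂ) (h : E5) :
    ‖∑ i, (h i : ℂ) * z i‖ ^ 2
      = inner ℝ h (WithLp.toLp 2 fun i => (z i).re) ^ 2
        + inner ℝ h (WithLp.toLp 2 fun i => (z i).im) ^ 2 := by
  rw [← Complex.normSq_eq_norm_sq, Complex.normSq_apply, Complex.re_sum, Complex.im_sum]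
  simp only [PiLp.inner_apply, Complex.re_ofReal_mul, Complex.im_ofReal_mul]
  simp only [RCLike.inner_apply, conj_trivial, mul_comm]
  ring

lemma integral_norm_sum_smul_sq (ε : ℝ) (z : Fin 5 → ℂ) :
    ∫ h in Metric.ball (0 : E5) ε, ‖∑ i, (h i : ℂ) * z i‖ ^ 2 = ballMoment ε * ∑ i, ‖z i‖ ^ 2 := by
  simp_rw [norm_sum_smul_sq]
  rw [integral_add (integrableOn_ball (by fun_prop) ε) (integrableOn_ball (by fun_prop) ε),
    integral_inner_sq, integral_inner_sq, ← mul_add]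
  congr 1
  rw [EuclideanSpace.norm_sq_eq, EuclideanSpace.norm_sq_eq, ← Finset.sum_add_distrib]
  refine Finset.sum_congr rfl fun i _ => ?_
  rw [← Complex.normSq_eq_norm_sq, Complex.normSq_apply]
  simp [sq]

/-- The integral of the squared translation differences over the translations in a ball. Divided by
`ballMoment ε` it tends to the Dirichlet integral as `ε → 0`. -/
def dq (ε : ℝ) (u : E5 → ℂ) : ℝ≥0∞ :=
  ∫⁻ h in Metric.ball (0 : E5) ε, lsq (fun x => u (x - h) - u x)

/-- The upper half of the derivative-free description of the Dirichlet integral: translation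
differences are bounded by directional derivatives, whose average over a ball is isotropic. -/
lemma dq_le {u : E5 → ℂ} (hu : MemH1 u) (ε : ℝ) :
    dq ε u ≤ ENNReal.ofReal (ballMoment ε * normH1DotSq u) := by
  set g := fun i => weakPartial i u with hg
  have hgm : ∀ i, MemLp (g i) 2 := hu.memLp_weakPartial
  have hm : AEMeasurable (fun p : E5 × E5 => ‖dirDeriv g (-p.1) p.2‖ₑ ^ 2)
      ((volume.restrict (Metric.ball (0 : E5) ε)).prod volume) := by
    refine AEMeasurable.pow_const (AEStronglyMeasurable.enorm ?_) 2
    refine Finset.aestronglyMeasurable_fun_sum _ fun i _ => ?_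
    refine AEStronglyMeasurable.mul ?_ ((hgm i).1.comp_snd)
    exact (by fun_prop : Continuous fun p : E5 × E5 => (((-p.1) i : ℝ) : ℂ)).aestronglyMeasurable
  calc dq ε u ≤ ∫⁻ h in Metric.ball (0 : E5) ε, ∫⁻ x, ‖dirDeriv g (-h) x‖ₑ ^ 2 := by
        refine lintegral_mono fun h => ?_
        have := lsq_translate_sub_le hu.1 hgm hu.hasWeakPartial (-h)
        simp only [← sub_eq_add_neg] at this
        exact this
    _ = ∫⁻ x, ∫⁻ h in Metric.ball (0 : E5) ε, ‖dirDeriv g (-h) x‖ₑ ^ 2 := lintegral_lintegral_swap hm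
    _ = ∫⁻ x, ENNReal.ofReal (ballMoment ε * ∑ i, ‖g i x‖ ^ 2) := by
        refine lintegral_congr fun x => ?_
        rw [← integral_norm_sum_smul_sq, ofReal_integral_eq_lintegral_ofReal
          (integrableOn_ball (by fun_prop) ε) (ae_of_all _ fun h => by positivity)]
        refine lintegral_congr fun h => ?_
        rw [← ofReal_norm, ← ENNReal.ofReal_pow (norm_nonneg _)]
        congr 2
        rw [dirDeriv, ← norm_neg, ← Finset.sum_neg_distrib]
        congr 1
        exact Finset.sum_congr rfl fun i _ => by simp
    _ = ENNReal.ofReal (∫ x, ballMoment ε * ∑ i, ‖g i x‖ ^ 2) := by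
        have hb : 0 ≤ ballMoment ε := integral_nonneg fun h => sq_nonneg _
        rw [ofReal_integral_eq_lintegral_ofReal]
        · exact (integrable_finsetSum _ fun i _ => integrable_sq (hgm i)).const_mul _
        · exact ae_of_all _ fun x => mul_nonneg hb (Finset.sum_nonneg fun i _ => sq_nonneg _)
    _ = ENNReal.ofReal (ballMoment ε * normH1DotSq u) := by
        rw [integral_const_mul, integral_finsetSum _ fun i _ => integrable_sq (hgm i), normH1DotSq]

/-- Averaged difference quotients, approximating the partial derivatives. The sign accounts for the
use of `u (x - h)`. -/
def avgQuot (ε : ℝ) (i : Fin 5) (u : E5 → ℂ) : E5 → ℂ := fun x =>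
  (-(ballMoment ε)⁻¹) • ∫ h in Metric.ball (0 : E5) ε, h i • (u (x - h) - u x)

/-- **Bessel's inequality** for the coordinate functions on a ball. -/
lemma bessel_ball {ε : ℝ} (hε : 0 < ε) {w : E5 → ℂ}
    (hw : MemLp w 2 (volume.restrict (Metric.ball (0 : E5) ε))) :
    ballMoment ε * ∑ i : Fin 5, ‖(-(ballMoment ε)⁻¹) • ∫ h in Metric.ball (0 : E5) ε, h i • w h‖ ^ 2
      ≤ ∫ h in Metric.ball (0 : E5) ε, ‖w h‖ ^ 2 := by
  set μ := volume.restrict (Metric.ball (0 : E5) ε)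
  set c := ballMoment ε
  have hc : 0 < c := ballMoment_pos hε
  set G : Fin 5 → ℂ := fun i => (-c⁻¹) • ∫ h, h i • w h ∂μ with hG
  have hGi : ∀ i, ∫ h, h i • w h ∂μ = (-c) • G i := by
    intro i
    simp only [hG, smul_smul]
    rw [neg_mul_neg, mul_inv_cancel₀ hc.ne', one_smul]
  have hfin : IsFiniteMeasure μ := ⟨by
    rw [Measure.restrict_apply_univ]; exact measure_ball_lt_top⟩
  have hi : ∀ i : Fin 5, Integrable (fun h : E5 => h i • w h) μ := by
    intro i
    have h1 : MemLp (fun h : E5 => h i) 2 μ := by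
      refine (memLp_two_iff_integrable_sq (by fun_prop)).2 ?_
      exact integrableOn_ball (by fun_prop) ε
    exact ((h1.ofReal (K := ℂ)).integrable_mul hw).congr
      (ae_of_all _ fun x => (Complex.real_smul (x := x i) (z := w x)).symm)
  have hcross : ∫ h, inner ℝ (w h) (∑ i, (h i : ℂ) * G i) ∂μ = -c * ∑ i, ‖G i‖ ^ 2 := by
    have e : ∀ h : E5, inner ℝ (w h) (∑ i, (h i : ℂ) * G i)
        = ∑ i, inner ℝ (G i) (h i • w h) := by
      intro h
      rw [inner_sum]
      refine Finset.sum_congr rfl fun i _ => ?_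
      rw [← Complex.real_smul, inner_smul_right, real_inner_comm, inner_smul_right]
    simp_rw [e]
    rw [integral_finsetSum _ fun i _ => (hi i).const_inner (G i), Finset.mul_sum]
    refine Finset.sum_congr rfl fun i _ => ?_
    rw [integral_inner (hi i), hGi i, inner_smul_right, real_inner_self_eq_norm_sq]
  have hcrossi : Integrable (fun h => inner ℝ (w h) (∑ i, (h i : ℂ) * G i)) μ := by
    have e : ∀ h : E5, inner ℝ (w h) (∑ i, (h i : ℂ) * G i)
        = ∑ i, inner ℝ (G i) (h i • w h) := by
      intro h
      rw [inner_sum]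
      refine Finset.sum_congr rfl fun i _ => ?_
      rw [← Complex.real_smul, inner_smul_right, real_inner_comm, inner_smul_right]
    simp_rw [e]
    exact integrable_finsetSum _ fun i _ => (hi i).const_inner (G i)
  have hw2 : Integrable (fun h => ‖w h‖ ^ 2) μ := hw.integrable_norm_pow two_ne_zero
  have hs2 : Integrable (fun h : E5 => ‖∑ i, (h i : ℂ) * G i‖ ^ 2) μ :=
    integrableOn_ball (by fun_prop) ε
  have hpos : 0 ≤ ∫ h, ‖w h + ∑ i, (h i : ℂ) * G i‖ ^ 2 ∂μ := integral_nonneg fun h => by positivity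
  simp_rw [norm_add_sq_real] at hpos
  have hi2 : Integrable (fun h => ‖w h‖ ^ 2 + 2 * inner ℝ (w h) (∑ i, (h i : ℂ) * G i)) μ :=
    hw2.add (hcrossi.const_mul 2)
  rw [integral_add hi2 hs2, integral_add hw2 (hcrossi.const_mul 2), integral_const_mul, hcross,
    integral_norm_sum_smul_sq] at hpos
  linarith

lemma aestronglyMeasurable_diff {u : E5 → ℂ} (hu : AEStronglyMeasurable u) (s : Set E5) :
    AEStronglyMeasurable (fun p : E5 × E5 => u (p.1 - p.2) - u p.1)
      (volume.prod (volume.restrict s)) := by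
  have h := (aestronglyMeasurable_comp_sub hu).sub (hu.comp_fst (ν := (volume : Measure E5)))
  refine h.mono_ac ?_
  exact Measure.AbsolutelyContinuous.prod Measure.AbsolutelyContinuous.rfl
    Measure.restrict_le_self.absolutelyContinuous

lemma aestronglyMeasurable_avgQuot {u : E5 → ℂ} (hu : AEStronglyMeasurable u) (ε : ℝ) (i : Fin 5) :
    AEStronglyMeasurable (avgQuot ε i u) := by
  have h : AEStronglyMeasurable (fun p : E5 × E5 => p.2 i • (u (p.1 - p.2) - u p.1))
      (volume.prod (volume.restrict (Metric.ball (0 : E5) ε))) :=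
    (by fun_prop : Continuous fun p : E5 × E5 => p.2 i).aestronglyMeasurable.smul
      (aestronglyMeasurable_diff hu _)
  exact h.integral_prod_right'.const_smul (-(ballMoment ε)⁻¹)

lemma sum_lsq_avgQuot_le {u : E5 → ℂ} (hu : MemLp u 2) {ε A : ℝ} (hε : 0 < ε)
    (h : dq ε u ≤ ENNReal.ofReal (ballMoment ε * A)) :
    ∑ i, lsq (avgQuot ε i u) ≤ ENNReal.ofReal A := by
  have hc := ballMoment_pos hε
  have hm : AEMeasurable (fun p : E5 × E5 => ‖u (p.1 - p.2) - u p.1‖ₑ ^ 2)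
      (volume.prod (volume.restrict (Metric.ball (0 : E5) ε))) :=
    (aestronglyMeasurable_diff hu.1 _).enorm.pow_const 2
  have hswap : dq ε u = ∫⁻ x, ∫⁻ h in Metric.ball (0 : E5) ε, ‖u (x - h) - u x‖ₑ ^ 2 :=
    (lintegral_lintegral_swap hm).symm
  have hfin : ∀ᵐ x, ∫⁻ h in Metric.ball (0 : E5) ε, ‖u (x - h) - u x‖ₑ ^ 2 < ⊤ := by
    refine ae_lt_top' hm.lintegral_prod_right' ?_
    rw [← hswap]
    exact (h.trans_lt ENNReal.ofReal_lt_top).ne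
  have hpt : ∀ᵐ x, ENNReal.ofReal (ballMoment ε) * ∑ i, ‖avgQuot ε i u x‖ₑ ^ 2
      ≤ ∫⁻ h in Metric.ball (0 : E5) ε, ‖u (x - h) - u x‖ₑ ^ 2 := by
    filter_upwards [hfin, (aestronglyMeasurable_diff hu.1 (Metric.ball (0 : E5) ε)).prodMk_left]
      with x hx hxm
    have hL : MemLp (fun h => u (x - h) - u x) 2 (volume.restrict (Metric.ball (0 : E5) ε)) := by
      refine ⟨hxm, ?_⟩
      rw [eLpNorm_lt_top_iff_lintegral_rpow_enorm_lt_top (by norm_num) (by norm_num)]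
      simpa using hx
    have hb := ENNReal.ofReal_le_ofReal (bessel_ball hε hL)
    rw [ENNReal.ofReal_mul hc.le, ENNReal.ofReal_sum_of_nonneg fun i _ => sq_nonneg _,
      ofReal_integral_eq_lintegral_ofReal (hL.integrable_norm_pow two_ne_zero)
        (ae_of_all _ fun h => by positivity)] at hb
    simp only [ENNReal.ofReal_pow (norm_nonneg _), ofReal_norm] at hb
    exact hb
  have h2 : ENNReal.ofReal (ballMoment ε) * ∑ i, lsq (avgQuot ε i u)
      ≤ ENNReal.ofReal (ballMoment ε) * ENNReal.ofReal A := by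
    have e : ∑ i, lsq (avgQuot ε i u) = ∫⁻ x, ∑ i, ‖avgQuot ε i u x‖ₑ ^ 2 :=
      (lintegral_finsetSum' _ fun i _ =>
        (aestronglyMeasurable_avgQuot hu.1 ε i).enorm.pow_const 2).symm
    rw [e, ← lintegral_const_mul' _ _ ENNReal.ofReal_ne_top, ← ENNReal.ofReal_mul hc.le]
    refine (lintegral_mono_ae hpt).trans ?_
    rw [← hswap]; exact h
  exact (ENNReal.mul_le_mul_iff_right (by simpa using hc) ENNReal.ofReal_ne_top).1 h2

/-- A joint integrability criterion: the slices are dominated by functions of bounded integral. -/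
lemma integrable_prod_of_slices {μ : Measure E5} [IsFiniteMeasure μ] {f : E5 × E5 → ℂ}
    (hf : AEStronglyMeasurable f (volume.prod μ)) {g : E5 → E5 → ℝ} {C : ℝ}
    (hfg : ∀ᵐ h ∂μ, ∀ x, ‖f (x, h)‖ ≤ g h x) (hg : ∀ h, Integrable (g h))
    (hC : ∀ h, ∫ x, g h x ≤ C) : Integrable f (volume.prod μ) := by
  rw [integrable_prod_iff' hf]
  have hm := hf.prod_swap.prodMk_left
  have h1 : ∀ᵐ h ∂μ, Integrable (fun x => f (x, h)) := by
    filter_upwards [hfg, hm] with h hh hmh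
    exact (hg h).mono' hmh (ae_of_all _ hh)
  refine ⟨h1, ?_⟩
  refine (integrable_const C).mono' (hf.norm.prod_swap.integral_prod_right') ?_
  filter_upwards [hfg, h1] with h hh hi
  rw [Real.norm_of_nonneg (integral_nonneg fun x => norm_nonneg _)]
  exact (integral_mono hi.norm (hg h) hh).trans (hC h)

/-- Averaged difference quotients of a test function, adjoint to `avgQuot` up to sign. -/
def avgQuotTest (ε : ℝ) (i : Fin 5) (ψ : E5 → ℝ) : E5 → ℝ := fun y =>
  (ballMoment ε)⁻¹ * ∫ h in Metric.ball (0 : E5) ε, h i * (ψ (y + h) - ψ y)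

lemma abs_coord_le (h : E5) (i : Fin 5) : |h i| ≤ ‖h‖ := by
  simpa using PiLp.norm_apply_le h i

lemma abs_average_le {ε : ℝ} (hε : 0 < ε) (i : Fin 5) {r : E5 → ℝ} {L : ℝ}
    (hr : ∀ h, ‖h‖ < ε → |r h| ≤ L * ‖h‖) :
    |(ballMoment ε)⁻¹ * ∫ h in Metric.ball (0 : E5) ε, h i * r h| ≤ 5 * L := by
  have hc := ballMoment_pos hε
  have h1 : ‖∫ h in Metric.ball (0 : E5) ε, h i * r h‖
      ≤ ∫ h in Metric.ball (0 : E5) ε, L * ‖h‖ ^ 2 := by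
    refine norm_integral_le_of_norm_le (integrableOn_ball (by fun_prop) ε) ?_
    refine (ae_restrict_iff' measurableSet_ball).2 (ae_of_all _ fun h hh => ?_)
    rw [mem_ball_zero_iff] at hh
    rw [Real.norm_eq_abs, abs_mul]
    calc |h i| * |r h| ≤ ‖h‖ * (L * ‖h‖) :=
          mul_le_mul (abs_coord_le h i) (hr h hh) (abs_nonneg _) (norm_nonneg _)
      _ = L * ‖h‖ ^ 2 := by ring
  rw [integral_const_mul, integral_norm_sq_ball, Real.norm_eq_abs] at h1
  rw [abs_mul, abs_of_pos (inv_pos.2 hc)]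
  calc (ballMoment ε)⁻¹ * |∫ h in Metric.ball (0 : E5) ε, h i * r h|
      ≤ (ballMoment ε)⁻¹ * (L * (5 * ballMoment ε)) := by gcongr
    _ = 5 * L := by field_simp

lemma tendsto_avgQuotTest {ψ : E5 → ℝ} (hψ : IsTest ψ) (i : Fin 5) {e : ℕ → ℝ}
    (he : ∀ n, 0 < e n) (he0 : Tendsto e atTop (𝓝 0)) (y : E5) :
    Tendsto (fun n => avgQuotTest (e n) i ψ y) atTop
      (𝓝 (fderiv ℝ ψ y (EuclideanSpace.single i 1))) := by
  rw [Metric.tendsto_atTop]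
  intro δ hδ
  have hd := (hψ.1.differentiable (by simp) y).hasFDerivAt
  rw [hasFDerivAt_iff_isLittleO_nhds_zero] at hd
  have hd' := hd.def (show 0 < δ / 10 by positivity)
  obtain ⟨r, hr, hball⟩ := Metric.eventually_nhds_iff.1 hd'
  obtain ⟨N, hN⟩ := eventually_atTop.1 (he0.eventually (gt_mem_nhds hr))
  refine ⟨N, fun n hn => ?_⟩
  have hc := ballMoment_pos (he n)
  set b : E5 := (InnerProductSpace.toDual ℝ E5).symm (fderiv ℝ ψ y) with hb
  have hbi : ∀ h : E5, inner ℝ h b = fderiv ℝ ψ y h := by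
    intro h; rw [real_inner_comm, hb, InnerProductSpace.toDual_symm_apply]
  have hlin : fderiv ℝ ψ y (EuclideanSpace.single i 1)
      = (ballMoment (e n))⁻¹ * ∫ h in Metric.ball (0 : E5) (e n), h i * fderiv ℝ ψ y h := by
    have h1 := integral_inner_mul_inner (e n) (EuclideanSpace.single i 1) b
    simp only [inner_single_right, hbi] at h1
    rw [h1, inv_mul_cancel_left₀ hc.ne']
  have hcont := hψ.1.continuous
  have hdiff : avgQuotTest (e n) i ψ y - fderiv ℝ ψ y (EuclideanSpace.single i 1)
      = (ballMoment (e n))⁻¹ * ∫ h in Metric.ball (0 : E5) (e n),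
          h i * (ψ (y + h) - ψ y - fderiv ℝ ψ y h) := by
    rw [hlin, avgQuotTest, ← mul_sub, ← integral_sub (integrableOn_ball (by fun_prop) _)
      (integrableOn_ball (by fun_prop) _)]
    congr 1
    exact integral_congr_ae (ae_of_all _ fun h => by ring)
  rw [Real.dist_eq, hdiff]
  have h5 := abs_average_le (he n) i (r := fun h => ψ (y + h) - ψ y - fderiv ℝ ψ y h) (L := δ / 10)
    (fun h hh => by
      have := hball (y := h) (by rw [dist_zero_right]; exact hh.trans (hN n hn))
      simpa using this)
  linarith

lemma abs_avgQuotTest_le {ψ : E5 → ℝ} (hψ : IsTest ψ) (i : Fin 5) :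
    ∃ C : ℝ, 0 ≤ C ∧ ∀ ε, 0 < ε → ∀ y, |avgQuotTest ε i ψ y| ≤ C := by
  obtain ⟨L, hL⟩ := ContDiff.lipschitzWith_of_hasCompactSupport hψ.2 hψ.1 (by simp)
  refine ⟨5 * L, by positivity, fun ε hε y => abs_average_le hε i fun h _ => ?_⟩
  have := hL.dist_le_mul (y + h) y
  simpa [Real.dist_eq] using this

lemma avgQuotTest_eq_zero {ψ : E5 → ℝ} (i : Fin 5) {ε : ℝ} (hε : ε ≤ 1) {y : E5}
    (hy : y ∉ Metric.cthickening 1 (tsupport ψ)) : avgQuotTest ε i ψ y = 0 := by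
  have h0 : ∀ h : E5, ‖h‖ ≤ 1 → ψ (y + h) = 0 := by
    intro h hh
    by_contra hne
    refine hy (Metric.mem_cthickening_of_dist_le y (y + h) 1 _ (subset_tsupport _ hne) ?_)
    simpa [dist_eq_norm] using hh
  rw [avgQuotTest, setIntegral_eq_zero_of_forall_eq_zero, mul_zero]
  intro h hh
  rw [mem_ball_zero_iff] at hh
  have := h0 0 (by simp)
  rw [add_zero] at this
  rw [h0 h (hh.le.trans hε), this]; simp

/-- Discrete integration by parts. -/
lemma integral_smul_avgQuot {u : E5 → ℂ} (hu : MemLp u 2) {ψ : E5 → ℝ} (hψ : IsTest ψ) {ε : ℝ}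
    (i : Fin 5) :
    ∫ x, ψ x • avgQuot ε i u x = -∫ x, avgQuotTest ε i ψ x • u x := by
  set μ := volume.restrict (Metric.ball (0 : E5) ε) with hμ
  have hfin : IsFiniteMeasure μ := ⟨by
    rw [hμ, Measure.restrict_apply_univ]; exact measure_ball_lt_top⟩
  have hc := hψ.1.continuous
  have hψ2 : Integrable (fun x => ψ x ^ 2) := (hψ.memLp 2).integrable_sq
  have hu2 := integrable_sq hu
  have hball : ∀ᵐ h ∂μ, |h i| ≤ ε := by
    refine (ae_restrict_iff' measurableSet_ball).2 (ae_of_all _ fun h hh => ?_)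
    rw [mem_ball_zero_iff] at hh
    exact (abs_coord_le h i).trans hh.le
  have hI1 : Integrable (fun p : E5 × E5 => (p.2 i * ψ p.1) • (u (p.1 - p.2) - u p.1))
      (volume.prod μ) := by
    refine integrable_prod_of_slices
      (g := fun h x => ε * (ψ x ^ 2 + 2 * ‖u (x - h)‖ ^ 2 + 2 * ‖u x‖ ^ 2))
      (C := ε * ((∫ x, ψ x ^ 2) + 2 * (∫ x, ‖u x‖ ^ 2) + 2 * ∫ x, ‖u x‖ ^ 2)) ?_ ?_ ?_ ?_
    · exact (by fun_prop : Continuous fun p : E5 × E5 => p.2 i * ψ p.1).aestronglyMeasurable.smul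
        (aestronglyMeasurable_diff hu.1 _)
    · filter_upwards [hball] with h hh x
      rw [norm_smul, Real.norm_eq_abs, abs_mul, mul_assoc]
      have h1 := norm_sub_le (u (x - h)) (u x)
      have h2 := abs_nonneg (h i)
      have h3 : |ψ x| * ‖u (x - h) - u x‖ ≤ ψ x ^ 2 + 2 * ‖u (x - h)‖ ^ 2 + 2 * ‖u x‖ ^ 2 := by
        have h4 : |ψ x| * ‖u (x - h) - u x‖ ≤ |ψ x| * (‖u (x - h)‖ + ‖u x‖) := by gcongr
        have h5 := sq_abs (ψ x)
        nlinarith [sq_nonneg (|ψ x| - ‖u (x - h)‖ - ‖u x‖), sq_nonneg (‖u (x - h)‖ - ‖u x‖),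
          sq_nonneg (|ψ x|), sq_nonneg ‖u (x - h)‖, sq_nonneg ‖u x‖]
      exact mul_le_mul hh h3 (by positivity) (h2.trans hh)
    · intro h
      exact ((hψ2.add ((hu2.comp_sub_right h).const_mul 2)).add (hu2.const_mul 2)).const_mul ε
    · intro h
      have e1 : Integrable (fun x => ψ x ^ 2 + 2 * ‖u (x - h)‖ ^ 2) :=
        hψ2.add ((hu2.comp_sub_right h).const_mul 2)
      rw [integral_const_mul, integral_add e1 (hu2.const_mul 2),
        integral_add hψ2 ((hu2.comp_sub_right h).const_mul 2), integral_const_mul, integral_const_mul,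
        integral_sub_right_eq_self (fun x => ‖u x‖ ^ 2) h]
  have hI2 : Integrable (fun p : E5 × E5 => (p.2 i * (ψ (p.1 + p.2) - ψ p.1)) • u p.1)
      (volume.prod μ) := by
    refine integrable_prod_of_slices
      (g := fun h x => ε * (2 * ψ (x + h) ^ 2 + 2 * ψ x ^ 2 + ‖u x‖ ^ 2))
      (C := ε * (2 * (∫ x, ψ x ^ 2) + 2 * (∫ x, ψ x ^ 2) + ∫ x, ‖u x‖ ^ 2)) ?_ ?_ ?_ ?_
    · exact (by fun_prop : Continuous fun p : E5 × E5 =>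
        p.2 i * (ψ (p.1 + p.2) - ψ p.1)).aestronglyMeasurable.smul hu.1.comp_fst
    · filter_upwards [hball] with h hh x
      rw [norm_smul, Real.norm_eq_abs, abs_mul, mul_assoc]
      have h2 := abs_nonneg (h i)
      have h3 : |ψ (x + h) - ψ x| * ‖u x‖ ≤ 2 * ψ (x + h) ^ 2 + 2 * ψ x ^ 2 + ‖u x‖ ^ 2 := by
        nlinarith [sq_nonneg (|ψ (x + h) - ψ x| - ‖u x‖), sq_abs (ψ (x + h) - ψ x),
          sq_nonneg (ψ (x + h) + ψ x), sq_nonneg (|ψ (x + h) - ψ x|), sq_nonneg ‖u x‖]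
      exact mul_le_mul hh h3 (by positivity) (h2.trans hh)
    · intro h
      exact ((((hψ2.comp_add_right h).const_mul 2).add (hψ2.const_mul 2)).add hu2).const_mul ε
    · intro h
      have e1 : Integrable (fun x => 2 * ψ (x + h) ^ 2 + 2 * ψ x ^ 2) :=
        ((hψ2.comp_add_right h).const_mul 2).add (hψ2.const_mul 2)
      rw [integral_const_mul, integral_add e1 hu2, integral_add ((hψ2.comp_add_right h).const_mul 2)
        (hψ2.const_mul 2), integral_const_mul, integral_const_mul,
        integral_add_right_eq_self (fun x => ψ x ^ 2) h]
  have hslice : ∀ h : E5, ∫ x, (h i * ψ x) • (u (x - h) - u x)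
      = ∫ x, (h i * (ψ (x + h) - ψ x)) • u x := by
    intro h
    simp only [mul_smul]
    rw [integral_smul, integral_smul]
    congr 1
    have hloc : LocallyIntegrable (fun x => u (x - h)) :=
      locInt (hu.comp_measurePreserving (measurePreserving_sub_right volume h))
    have i1 := hψ.integrable_smul hloc
    have i2 := hψ.integrable_smul (locInt hu)
    have i3 : Integrable (fun x => ψ (x + h) • u x) := by
      have := i1.comp_add_right h
      simpa using this
    simp only [smul_sub, sub_smul]
    rw [integral_sub i1 i2, integral_sub i3 i2]
    congr 1
    rw [← integral_add_right_eq_self (fun x => ψ x • u (x - h)) h]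
    simp
  calc ∫ x, ψ x • avgQuot ε i u x
      = ∫ x, (-(ballMoment ε)⁻¹) • ∫ h, (h i * ψ x) • (u (x - h) - u x) ∂μ := by
        refine integral_congr_ae (ae_of_all _ fun x => ?_)
        simp only [avgQuot]
        rw [smul_comm, ← integral_smul]
        congr 1
        exact integral_congr_ae (ae_of_all _ fun h => by simp only [smul_smul, mul_comm])
    _ = (-(ballMoment ε)⁻¹) • ∫ h, (∫ x, (h i * ψ x) • (u (x - h) - u x)) ∂μ := by
        rw [integral_smul, integral_integral_swap hI1]
    _ = (-(ballMoment ε)⁻¹) • ∫ x, ∫ h, (h i * (ψ (x + h) - ψ x)) • u x ∂μ := by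
        simp_rw [hslice]
        exact congrArg _ (integral_integral_swap hI2).symm
    _ = -∫ x, avgQuotTest ε i ψ x • u x := by
        rw [neg_smul, ← integral_smul]
        congr 1
        refine integral_congr_ae (ae_of_all _ fun x => ?_)
        simp only [avgQuotTest]
        rw [integral_smul_const, smul_smul]

/-- The lower half of the derivative-free description of the Dirichlet integral: the averaged difference
quotients are bounded in `L²`, and their weak limits are the weak derivatives. -/
lemma memH1_of_dq_le_ofReal {u : E5 → ℂ} (hu : MemLp u 2) {A : ℝ} (hA : 0 ≤ A)
    (h : ∀ ε, 0 < ε → dq ε u ≤ ENNReal.ofReal (ballMoment ε * A)) :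
    MemH1 u ∧ normH1DotSq u ≤ A := by
  set e : ℕ → ℝ := fun n => 1 / ((n : ℝ) + 1) with he
  have hepos : ∀ n, 0 < e n := fun n => by simp only [he]; positivity
  have he1 : ∀ n, e n ≤ 1 := fun n => by
    simp only [he]; rw [div_le_one (by positivity)]; linarith [n.cast_nonneg (α := ℝ)]
  have he0 : Tendsto e atTop (𝓝 0) := tendsto_one_div_add_atTop_nhds_zero_nat
  have hsum := fun n => sum_lsq_avgQuot_le hu (hepos n) (h _ (hepos n))
  have hmem : ∀ n i, MemLp (avgQuot (e n) i u) 2 := fun n i =>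
    memLp_two_iff_lsq.2 ⟨aestronglyMeasurable_avgQuot hu.1 _ i,
      ((Finset.single_le_sum (f := fun i => lsq (avgQuot (e n) i u)) (fun _ _ => zero_le)
        (Finset.mem_univ i)).trans (hsum n)).trans_lt ENNReal.ofReal_lt_top⟩
  have hsum' : ∀ n, ∑ i, normL2Sq (avgQuot (e n) i u) ≤ A := by
    intro n
    have := hsum n
    simp_rw [lsq_eq_normL2Sq (hmem n _)] at this
    rw [← ENNReal.ofReal_sum_of_nonneg fun i _ => normL2Sq_nonneg _] at this
    exact (ENNReal.ofReal_le_ofReal_iff hA).1 this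
  have hone : ∀ n i, normL2Sq (avgQuot (e n) i u) ≤ A := fun n i =>
    (Finset.single_le_sum (f := fun i => normL2Sq (avgQuot (e n) i u))
      (fun _ _ => normL2Sq_nonneg _) (Finset.mem_univ i)).trans (hsum' n)
  obtain ⟨φ, hφ, g, hg⟩ := exists_weakConv_subseq_family hmem hone
  have hweak : ∀ i, HasWeakPartial i u (g i) := by
    intro i ψ hψ
    have h1 := (hg i).2 _ hψ.memLp_ofReal
    simp_rw [← Complex.real_smul] at h1
    obtain ⟨C, hC0, hC⟩ := abs_avgQuotTest_le hψ i
    have hK : IsCompact (Metric.cthickening 1 (tsupport ψ)) := hψ.2.isCompact.cthickening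
    have h2 : Tendsto (fun n => ∫ x, avgQuotTest (e (φ n)) i ψ x • u x) atTop
        (𝓝 (∫ x, (fderiv ℝ ψ x (EuclideanSpace.single i 1)) • u x)) := by
      have hloc : IntegrableOn u (Metric.cthickening 1 (tsupport ψ)) :=
        (locInt hu).integrableOn_isCompact hK
      refine tendsto_integral_of_dominated_convergence
        ((Metric.cthickening 1 (tsupport ψ)).indicator fun x => C * ‖u x‖) ?_ ?_ ?_ ?_
      · intro n
        have hc := hψ.1.continuous
        have : AEStronglyMeasurable (fun p : E5 × E5 => p.2 i * (ψ (p.1 + p.2) - ψ p.1))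
            (volume.prod (volume.restrict (Metric.ball (0 : E5) (e (φ n))))) :=
          (by fun_prop : Continuous fun p : E5 × E5 =>
            p.2 i * (ψ (p.1 + p.2) - ψ p.1)).aestronglyMeasurable
        have h6 : AEStronglyMeasurable (avgQuotTest (e (φ n)) i ψ) :=
          this.integral_prod_right'.const_mul _
        exact h6.smul hu.1
      · rw [integrable_indicator_iff hK.measurableSet]
        exact hloc.norm.const_mul C
      · intro n
        refine ae_of_all _ fun x => ?_
        by_cases hx : x ∈ Metric.cthickening 1 (tsupport ψ)
        · rw [Set.indicator_of_mem hx, norm_smul]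
          gcongr
          exact hC _ (hepos _) x
        · rw [Set.indicator_of_notMem hx, avgQuotTest_eq_zero i (he1 _) hx]; simp
      · refine ae_of_all _ fun x => ?_
        exact ((tendsto_avgQuotTest hψ i hepos he0 x).comp hφ.tendsto_atTop).smul_const _
    have h3 : Tendsto (fun n => ∫ x, ψ x • avgQuot (e (φ n)) i u x) atTop
        (𝓝 (-∫ x, (fderiv ℝ ψ x (EuclideanSpace.single i 1)) • u x)) := by
      simp_rw [integral_smul_avgQuot hu hψ i]
      exact h2.neg
    have h4 := tendsto_nhds_unique h1 h3
    rw [h4, neg_neg]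
  have hgm : ∀ i, MemLp (g i) 2 := fun i => (hg i).1
  refine ⟨memH1_of hu hgm hweak, ?_⟩
  rw [normH1DotSq_eq hgm hweak]
  exact sum_normL2Sq_le_of_weakConv (fun n i => hmem (φ n) i) hgm (fun i => (hg i).2)
    (fun n => hsum' (φ n))

/-- A transformation that does not increase the averaged translation differences preserves `H¹` and
does not increase the Dirichlet integral. -/
lemma memH1_of_dq_le {u v : E5 → ℂ} (hu : MemH1 u) (hv : MemLp v 2)
    (h : ∀ ε, 0 < ε → dq ε v ≤ dq ε u) : MemH1 v ∧ normH1DotSq v ≤ normH1DotSq u :=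
  memH1_of_dq_le_ofReal hv (normH1DotSq_nonneg u) fun ε hε => (h ε hε).trans (dq_le hu ε)

/-- The **diamagnetic inequality** `‖∇|u|‖ ≤ ‖∇u‖`. -/
lemma memH1_norm {u : E5 → ℂ} (hu : MemH1 u) :
    MemH1 (fun x => (‖u x‖ : ℂ)) ∧ normH1DotSq (fun x => (‖u x‖ : ℂ)) ≤ normH1DotSq u := by
  refine memH1_of_dq_le hu hu.1.norm.ofReal fun ε _ => ?_
  refine lintegral_mono fun h => lintegral_mono fun x => ?_
  refine pow_le_pow_left' ?_ 2
  change ‖((‖u (x - h)‖ : ℂ) - (‖u x‖ : ℂ))‖ₑ ≤ ‖u (x - h) - u x‖ₑ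
  rw [← Complex.ofReal_sub, ← ofReal_norm, ← ofReal_norm, Complex.norm_real]
  exact ENNReal.ofReal_le_ofReal (abs_norm_sub_norm_le _ _)

/-! ### Polarization -/

/-- The reflection in the hyperplane through the origin orthogonal to `e`. -/
def refl (e : E5) : E5 ≃ₗᵢ[ℝ] E5 := (ℝ ∙ e)ᗮ.reflection

lemma refl_refl (e x : E5) : refl e (refl e x) = x := Submodule.reflection_reflection _ x

lemma refl_apply {e : E5} (he : ‖e‖ = 1) (x : E5) : refl e x = x - (2 * inner ℝ e x) • e := by
  rw [refl, Submodule.reflection_orthogonal_apply, Submodule.reflection_singleton_apply, he]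
  simp [mul_smul, two_smul]

lemma inner_refl {e : E5} (he : ‖e‖ = 1) (x : E5) : inner ℝ e (refl e x) = -inner ℝ e x := by
  rw [refl_apply he, inner_sub_right, inner_smul_right, real_inner_self_eq_norm_sq, he]; ring

lemma dist_refl_sq {e : E5} (he : ‖e‖ = 1) (x y : E5) :
    dist x (refl e y) ^ 2 = dist x y ^ 2 + 4 * inner ℝ e x * inner ℝ e y := by
  rw [dist_eq_norm, dist_eq_norm, refl_apply he, sub_sub_eq_add_sub, add_sub_right_comm,
    norm_add_sq_real, norm_smul, he, inner_smul_right, inner_sub_left, real_inner_comm x e,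
    real_inner_comm y e, Real.norm_eq_abs, mul_one, sq_abs]
  ring

lemma measurePreserving_refl (e : E5) : MeasurePreserving (refl e) := (refl e).measurePreserving

lemma integral_comp_refl {F : Type*} [NormedAddCommGroup F] [NormedSpace ℝ F] (e : E5)
    (f : E5 → F) : ∫ x, f (refl e x) = ∫ x, f x :=
  (measurePreserving_refl e).integral_comp (refl e).toHomeomorph.measurableEmbedding f

lemma lintegral_comp_refl (e : E5) (f : E5 → ℝ≥0∞) : ∫⁻ x, f (refl e x) = ∫⁻ x, f x :=
  (measurePreserving_refl e).lintegral_comp_emb (refl e).toHomeomorph.measurableEmbedding f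

lemma Integrable.comp_refl {F : Type*} [NormedAddCommGroup F] (e : E5) {f : E5 → F}
    (hf : Integrable f) : Integrable (fun x => f (refl e x)) :=
  (measurePreserving_refl e).integrable_comp_of_integrable hf

lemma integral_le_of_add_refl_le (e : E5) {f g : E5 → ℝ} (hf : Integrable f) (hg : Integrable g)
    (h : ∀ x, f x + f (refl e x) ≤ g x + g (refl e x)) : ∫ x, f x ≤ ∫ x, g x := by
  have h1 := integral_mono (hf.add (Integrable.comp_refl e hf)) (hg.add (Integrable.comp_refl e hg)) h
  simp only [Pi.add_apply] at h1
  rw [integral_add hf (Integrable.comp_refl e hf), integral_add hg (Integrable.comp_refl e hg),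
    integral_comp_refl, integral_comp_refl] at h1
  linarith

/-- The polarization of `f` with respect to the half-space `0 ≤ ⟪e, x⟫`: of the two values of `f` at
`x` and at its mirror image, the larger is put on the side of `e`. -/
def pol (e : E5) (f : E5 → ℝ) : E5 → ℝ := fun x =>
  if 0 ≤ inner ℝ e x then max (f x) (f (refl e x)) else min (f x) (f (refl e x))

lemma pol_of_nonneg {e : E5} (f : E5 → ℝ) {x : E5} (hx : 0 ≤ inner ℝ e x) :
    pol e f x = max (f x) (f (refl e x)) := if_pos hx

lemma pol_refl_of_nonneg {e : E5} (he : ‖e‖ = 1) (f : E5 → ℝ) {x : E5} (hx : 0 ≤ inner ℝ e x) :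
    pol e f (refl e x) = min (f x) (f (refl e x)) := by
  rcases hx.eq_or_lt with h0 | h0
  · have hfix : refl e x = x := by rw [refl_apply he, ← h0]; simp
    rw [hfix, pol_of_nonneg f hx, hfix]; simp
  · rw [pol, inner_refl he, if_neg (by linarith), refl_refl, min_comm]

/-- Of two mirror points one lies in the half-space. -/
lemma forall_of_refl {e : E5} (he : ‖e‖ = 1) {p : E5 → Prop} (h1 : ∀ x, 0 ≤ inner ℝ e x → p x)
    (h2 : ∀ x, p (refl e x) → p x) (x : E5) : p x := by
  rcases le_total 0 (inner ℝ e x) with h | h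
  · exact h1 x h
  · exact h2 x (h1 _ (by rw [inner_refl he]; linarith))

lemma measurable_pol (e : E5) {f : E5 → ℝ} (hf : Measurable f) : Measurable (pol e f) := by
  have h1 : Measurable fun x => f (refl e x) := hf.comp (refl e).continuous.measurable
  refine Measurable.ite ?_ (hf.max h1) (hf.min h1)
  exact measurableSet_le measurable_const (by fun_prop)

lemma pol_sq_add {e : E5} (he : ‖e‖ = 1) (f : E5 → ℝ) (x : E5) :
    pol e f x ^ 2 + pol e f (refl e x) ^ 2 = f x ^ 2 + f (refl e x) ^ 2 := by
  refine forall_of_refl he (p := fun x => pol e f x ^ 2 + pol e f (refl e x) ^ 2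
    = f x ^ 2 + f (refl e x) ^ 2) (fun x hx => ?_) (fun x hx => ?_) x
  · rw [pol_of_nonneg f hx, pol_refl_of_nonneg he f hx]
    rcases le_total (f x) (f (refl e x)) with h | h <;> simp [h, add_comm]
  · rw [refl_refl] at hx; linarith

lemma memLp_ofReal_iff {f : E5 → ℝ} : MemLp (fun x => (f x : ℂ)) 2 ↔ MemLp f 2 :=
  ⟨fun h => by simpa using h.re, fun h => h.ofReal⟩

lemma memLp_pol {e : E5} (he : ‖e‖ = 1) {f : E5 → ℝ} (hf : Measurable f) (h : MemLp f 2) :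
    MemLp (pol e f) 2 := by
  refine (memLp_two_iff_integrable_sq (measurable_pol e hf).aestronglyMeasurable).2 ?_
  have h1 : Integrable (fun x => f x ^ 2 + f (refl e x) ^ 2) :=
    h.integrable_sq.add (Integrable.comp_refl e h.integrable_sq)
  refine h1.mono' ((measurable_pol e hf).pow_const 2).aestronglyMeasurable (ae_of_all _ fun x => ?_)
  rw [← pol_sq_add he, Real.norm_of_nonneg (sq_nonneg _)]
  linarith [sq_nonneg (pol e f (refl e x))]

lemma normL2Sq_pol {e : E5} (he : ‖e‖ = 1) {f : E5 → ℝ} (hf : Measurable f) (h : MemLp f 2) :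
    normL2Sq (fun x => (pol e f x : ℂ)) = normL2Sq (fun x => (f x : ℂ)) := by
  simp only [normL2Sq, Complex.norm_real, Real.norm_eq_abs, sq_abs]
  have hp := (memLp_pol he hf h).integrable_sq
  exact le_antisymm (integral_le_of_add_refl_le e hp h.integrable_sq fun x => (pol_sq_add he f x).le)
    (integral_le_of_add_refl_le e h.integrable_sq hp fun x => (pol_sq_add he f x).ge)

/-! ### The Dirichlet integral under polarization -/

/-- The integrand of `dq` as a double integral. -/
def dqKernel (ε : ℝ) (f : E5 → ℝ) (x y : E5) : ℝ :=
  (if dist x y < ε then 1 else 0) * (f x - f y) ^ 2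

lemma dqKernel_nonneg (ε : ℝ) (f : E5 → ℝ) (x y : E5) : 0 ≤ dqKernel ε f x y := by
  rw [dqKernel]; positivity

lemma measurable_dqKernel (ε : ℝ) {f : E5 → ℝ} (hf : Measurable f) :
    Measurable (fun p : E5 × E5 => ENNReal.ofReal (dqKernel ε f p.1 p.2)) := by
  refine ENNReal.measurable_ofReal.comp (Measurable.mul ?_ ?_)
  · exact Measurable.ite (measurableSet_lt (by fun_prop) measurable_const) measurable_const
      measurable_const
  · exact ((hf.comp measurable_fst).sub (hf.comp measurable_snd)).pow_const 2

lemma dq_ofReal (ε : ℝ) {f : E5 → ℝ} (hf : Measurable f) :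
    dq ε (fun x => (f x : ℂ)) = ∫⁻ x, ∫⁻ y, ENNReal.ofReal (dqKernel ε f x y) := by
  have hm : Measurable (fun p : E5 × E5 => ENNReal.ofReal (dqKernel ε f p.2 (p.2 - p.1))) :=
    Measurable.comp (g := fun p : E5 × E5 => ENNReal.ofReal (dqKernel ε f p.1 p.2))
      (f := fun p : E5 × E5 => (p.2, p.2 - p.1)) (measurable_dqKernel ε hf) (by fun_prop)
  have h1 : dq ε (fun x => (f x : ℂ))
      = ∫⁻ h, ∫⁻ x, ENNReal.ofReal (dqKernel ε f x (x - h)) := by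
    rw [dq, ← lintegral_indicator measurableSet_ball]
    refine lintegral_congr fun h => ?_
    by_cases hh : h ∈ Metric.ball (0 : E5) ε
    · rw [Set.indicator_of_mem hh, lsq]
      refine lintegral_congr fun x => ?_
      rw [mem_ball_zero_iff] at hh
      have hd : dist x (x - h) < ε := by simpa [dist_eq_norm] using hh
      rw [dqKernel, if_pos hd, one_mul, ← Complex.ofReal_sub, ← ofReal_norm, Complex.norm_real,
        ← ENNReal.ofReal_pow (norm_nonneg _), Real.norm_eq_abs, sq_abs]
      congr 1; ring
    · rw [Set.indicator_of_notMem hh]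
      rw [mem_ball_zero_iff] at hh
      symm
      have : ∀ x : E5, ENNReal.ofReal (dqKernel ε f x (x - h)) = 0 := by
        intro x
        have hd : ¬ dist x (x - h) < ε := by simpa [dist_eq_norm] using hh
        rw [dqKernel, if_neg hd]; simp
      simp [this]
  rw [h1, lintegral_lintegral_swap hm.aemeasurable]
  exact lintegral_congr fun x =>
    lintegral_sub_left_eq_self (fun y => ENNReal.ofReal (dqKernel ε f x y)) x

/-- The sum of the integrand over the four pairs of mirror images. -/
def dqFour (e : E5) (ε : ℝ) (f : E5 → ℝ) (x y : E5) : ℝ :=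
  (dqKernel ε f x y + dqKernel ε f x (refl e y))
    + (dqKernel ε f (refl e x) y + dqKernel ε f (refl e x) (refl e y))

/-- The integral `dq` symmetrized under reflection in both variables. -/
lemma four_mul_dq (e : E5) (ε : ℝ) {f : E5 → ℝ} (hf : Measurable f) :
    2 * (2 * dq ε (fun x => (f x : ℂ))) = ∫⁻ x, ∫⁻ y, ENNReal.ofReal (dqFour e ε f x y) := by
  have hr : Measurable (refl e) := (refl e).continuous.measurable
  have hm := measurable_dqKernel ε hf
  have hm1 : ∀ x, Measurable fun y => ENNReal.ofReal (dqKernel ε f x y) := fun x =>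
    Measurable.comp (g := fun p : E5 × E5 => ENNReal.ofReal (dqKernel ε f p.1 p.2))
      (f := fun y : E5 => (x, y)) hm (by fun_prop)
  have hm1' : ∀ x, Measurable fun y => ENNReal.ofReal (dqKernel ε f x (refl e y)) := fun x =>
    Measurable.comp (g := fun p : E5 × E5 => ENNReal.ofReal (dqKernel ε f p.1 p.2))
      (f := fun y : E5 => (x, refl e y)) hm (measurable_const.prodMk hr)
  set g : E5 → ℝ≥0∞ := fun x => ∫⁻ y, ENNReal.ofReal (dqKernel ε f x y) with hg
  have hgm : Measurable g := hm.lintegral_prod_right'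
  have h2 : ∀ x, ∫⁻ y, ENNReal.ofReal (dqKernel ε f x y + dqKernel ε f x (refl e y)) = 2 * g x := by
    intro x
    have : ∀ y, ENNReal.ofReal (dqKernel ε f x y + dqKernel ε f x (refl e y))
        = ENNReal.ofReal (dqKernel ε f x y) + ENNReal.ofReal (dqKernel ε f x (refl e y)) := fun y =>
      ENNReal.ofReal_add (dqKernel_nonneg _ _ _ _) (dqKernel_nonneg _ _ _ _)
    simp_rw [this]
    rw [lintegral_add_left (hm1 x), lintegral_comp_refl e (fun y => ENNReal.ofReal (dqKernel ε f x y)),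
      two_mul]
  have h4 : ∀ x, ∫⁻ y, ENNReal.ofReal (dqFour e ε f x y) = 2 * g x + 2 * g (refl e x) := by
    intro x
    rw [← h2, ← h2, ← lintegral_add_left]
    · refine lintegral_congr fun y => ?_
      rw [dqFour, ENNReal.ofReal_add]
      · exact add_nonneg (dqKernel_nonneg _ _ _ _) (dqKernel_nonneg _ _ _ _)
      · exact add_nonneg (dqKernel_nonneg _ _ _ _) (dqKernel_nonneg _ _ _ _)
    · have : ∀ y, ENNReal.ofReal (dqKernel ε f x y + dqKernel ε f x (refl e y))
          = ENNReal.ofReal (dqKernel ε f x y) + ENNReal.ofReal (dqKernel ε f x (refl e y)) := fun y =>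
        ENNReal.ofReal_add (dqKernel_nonneg _ _ _ _) (dqKernel_nonneg _ _ _ _)
      simp_rw [this]
      exact (hm1 x).add (hm1' x)
  simp_rw [h4]
  rw [lintegral_add_left (hgm.const_mul 2), lintegral_comp_refl e (fun x => 2 * g x),
    lintegral_const_mul _ hgm, dq_ofReal ε hf]
  ring

/-- The four-point inequality behind polarization: if like positions have the larger weight `k`, then
sorting both pairs does not increase the weighted sum of squared differences. -/
lemma four_point {a b c d k l : ℝ} (hlk : l ≤ k) :
    (k * (max a b - max c d) ^ 2 + l * (max a b - min c d) ^ 2)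
      + (l * (min a b - max c d) ^ 2 + k * (min a b - min c d) ^ 2)
    ≤ (k * (a - c) ^ 2 + l * (a - d) ^ 2) + (l * (b - c) ^ 2 + k * (b - d) ^ 2) := by
  rcases le_total a b with h1 | h1 <;> rcases le_total c d with h2 | h2 <;>
    simp only [h1, h2, max_eq_left, max_eq_right, min_eq_left, min_eq_right] <;>
    nlinarith [mul_nonneg (sub_nonneg.2 hlk) (mul_nonneg (sub_nonneg.2 h1) (sub_nonneg.2 h2))]

lemma dqFour_refl_left (e : E5) (ε : ℝ) (f : E5 → ℝ) (x y : E5) :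
    dqFour e ε f (refl e x) y = dqFour e ε f x y := by
  simp only [dqFour, refl_refl]; ring

lemma dqFour_refl_right (e : E5) (ε : ℝ) (f : E5 → ℝ) (x y : E5) :
    dqFour e ε f x (refl e y) = dqFour e ε f x y := by
  simp only [dqFour, refl_refl]; ring

lemma dqFour_pol_le {e : E5} (he : ‖e‖ = 1) (ε : ℝ) (f : E5 → ℝ) (x y : E5) :
    dqFour e ε (pol e f) x y ≤ dqFour e ε f x y := by
  refine forall_of_refl he (p := fun x => dqFour e ε (pol e f) x y ≤ dqFour e ε f x y)
    (fun x hx => ?_) (fun x hx => by simpa only [dqFour_refl_left] using hx) x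
  refine forall_of_refl he (p := fun y => dqFour e ε (pol e f) x y ≤ dqFour e ε f x y)
    (fun y hy => ?_) (fun y hy => by simpa only [dqFour_refl_right] using hy) y
  have d1 : dist (refl e x) (refl e y) = dist x y := (refl e).dist_map x y
  have d2 : dist (refl e x) y = dist x (refl e y) := by
    rw [← (refl e).dist_map (refl e x) y, refl_refl]
  simp only [dqFour, dqKernel, d1, d2, pol_of_nonneg f hx, pol_of_nonneg f hy,
    pol_refl_of_nonneg he f hx, pol_refl_of_nonneg he f hy]
  refine four_point ?_
  have hle : dist x y ≤ dist x (refl e y) := by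
    refine le_of_sq_le_sq ?_ dist_nonneg
    rw [dist_refl_sq he]
    nlinarith [mul_nonneg hx hy]
  split_ifs with h1 h2
  · exact le_rfl
  · exact absurd (hle.trans_lt h1) h2
  · norm_num
  · exact le_rfl

/-- Polarization does not increase the Dirichlet integral. -/
lemma memH1_pol {e : E5} (he : ‖e‖ = 1) {f : E5 → ℝ} (hf : Measurable f)
    (h : MemH1 (fun x => (f x : ℂ))) :
    MemH1 (fun x => (pol e f x : ℂ)) ∧
      normH1DotSq (fun x => (pol e f x : ℂ)) ≤ normH1DotSq (fun x => (f x : ℂ)) := by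
  refine memH1_of_dq_le h (memLp_pol he hf (memLp_ofReal_iff.1 h.1)).ofReal fun ε _ => ?_
  have h4 : 2 * (2 * dq ε (fun x => (pol e f x : ℂ))) ≤ 2 * (2 * dq ε (fun x => (f x : ℂ))) := by
    rw [four_mul_dq e ε hf, four_mul_dq e ε (measurable_pol e hf)]
    exact lintegral_mono fun x => lintegral_mono fun y =>
      ENNReal.ofReal_le_ofReal (dqFour_pol_le he ε f x y)
  have h2 : (2 : ℝ≥0∞) ≠ ⊤ := by norm_num
  rwa [ENNReal.mul_le_mul_iff_right two_ne_zero h2, ENNReal.mul_le_mul_iff_right two_ne_zero h2] at h4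

/-! ### The potential energy under polarization -/

lemma mul_add_mul_le_max_min (a b c d : ℝ) :
    a * c + b * d ≤ max a b * max c d + min a b * min c d := by
  rcases le_total a b with h1 | h1 <;> rcases le_total c d with h2 | h2 <;>
    simp only [h1, h2, max_eq_left, max_eq_right, min_eq_left, min_eq_right] <;>
    nlinarith [mul_nonneg (sub_nonneg.2 h1) (sub_nonneg.2 h2)]

lemma mul_mul_add_le_max_min {a b c d p q : ℝ} (ha : 0 ≤ a) (hc : 0 ≤ c) (hd : 0 ≤ d)
    (hp : 0 ≤ p) (hq : 0 ≤ q) :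
    a * c * p + b * d * q
      ≤ max a b * max c d * max p q + min a b * min c d * min p q := by
  refine (mul_add_mul_le_max_min (a * c) (b * d) p q).trans ?_
  have h1 := mul_add_mul_le_max_min a b c d
  have h2 : max (a * c) (b * d) ≤ max a b * max c d :=
    max_le (mul_le_mul (le_max_left _ _) (le_max_left _ _) hc (ha.trans (le_max_left _ _)))
      (mul_le_mul (le_max_right _ _) (le_max_right _ _) hd (ha.trans (le_max_left _ _)))
  have h3 := max_add_min (a * c) (b * d)
  have h4 : min p q ≤ max p q := min_le_max
  have h5 : 0 ≤ min p q := le_min hp hq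
  nlinarith [mul_nonneg (sub_nonneg.2 h2) (sub_nonneg.2 h4)]

/-- The complex-valued triple with given real components. -/
def toC (f : Fin 3 → E5 → ℝ) : Fin 3 → E5 → ℂ := fun j x => (f j x : ℂ)

lemma integrable_real_mul_mul {f : Fin 3 → E5 → ℝ} (hf : ∀ j, MemH1 (toC f j)) :
    Integrable (fun x => f 0 x * f 1 x * f 2 x) := by
  have h := integrable_tri (hf 0).memLp_three (hf 1).memLp_three (hf 2).memLp_three
  refine h.congr (ae_of_all _ fun x => ?_)
  simp [toC]

lemma V_toC (f : Fin 3 → E5 → ℝ) : V (toC f) = ∫ x, f 0 x * f 1 x * f 2 x := by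
  have h : ∀ x, starRingEnd ℂ (toC f 0 x) * starRingEnd ℂ (toC f 1 x) * toC f 2 x
      = ((f 0 x * f 1 x * f 2 x : ℝ) : ℂ) := fun x => by simp [toC]
  rw [V]
  simp_rw [h]
  exact congrArg Complex.re (integral_ofReal (𝕜 := ℂ))

lemma memH1_toC_pol {e : E5} (he : ‖e‖ = 1) {f : Fin 3 → E5 → ℝ} (hm : ∀ j, Measurable (f j))
    (hf : ∀ j, MemH1 (toC f j)) (j : Fin 3) : MemH1 (toC (fun j => pol e (f j)) j) :=
  (memH1_pol he (hm j) (hf j)).1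

lemma V_le_V_pol {e : E5} (he : ‖e‖ = 1) {f : Fin 3 → E5 → ℝ} (hm : ∀ j, Measurable (f j))
    (hf : ∀ j, MemH1 (toC f j)) (h0 : ∀ j x, 0 ≤ f j x) :
    V (toC f) ≤ V (toC fun j => pol e (f j)) := by
  rw [V_toC, V_toC]
  refine integral_le_of_add_refl_le e (integrable_real_mul_mul hf)
    (integrable_real_mul_mul (memH1_toC_pol he hm hf)) fun x => ?_
  refine forall_of_refl he (p := fun x => f 0 x * f 1 x * f 2 x
    + f 0 (refl e x) * f 1 (refl e x) * f 2 (refl e x)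
    ≤ pol e (f 0) x * pol e (f 1) x * pol e (f 2) x
      + pol e (f 0) (refl e x) * pol e (f 1) (refl e x) * pol e (f 2) (refl e x))
    (fun x hx => ?_) (fun x hx => ?_) x
  · simp only [pol_of_nonneg _ hx, pol_refl_of_nonneg he _ hx]
    exact mul_mul_add_le_max_min (h0 0 _) (h0 1 _) (h0 1 _) (h0 2 _) (h0 2 _)
  · simp only [refl_refl] at hx; linarith

/-! ### Comparison of optimal triples -/

lemma K_le_K {κ : Fin 3 → ℝ} (hκ : ∀ j, 0 < κ j) {u v : Fin 3 → E5 → ℂ}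
    (h : ∀ j, normH1DotSq (v j) ≤ normH1DotSq (u j)) : K κ v ≤ K κ u :=
  Finset.sum_le_sum fun j _ => mul_le_mul_of_nonneg_left (h j) (half_pos (hκ j)).le

/-- A competitor of the same mass, no more kinetic energy and no less potential energy than an
optimal triple is optimal, with the same energies. -/
lemma IsOpt.of_comparison {κ : Fin 3 → ℝ} (hκ : ∀ j, 0 < κ j) {u v : Fin 3 → E5 → ℂ}
    (hu : IsOpt κ u) (hv : ∀ j, MemH1 (v j)) (hM : M v = M u) (hK : K κ v ≤ K κ u)
    (hV : |V u| ≤ |V v|) : IsOpt κ v ∧ K κ v = K κ u ∧ |V v| = |V u| := by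
  have hVv : V v ≠ 0 := abs_pos.1 ((abs_pos.2 hu.V_ne).trans_le hV)
  have hM0 := hu.M_pos
  have hK0 := hu.K_pos
  have hKv : 0 ≤ K κ v := K_nonneg hκ v
  have hle := hu.le v hv
  rw [hM] at hle
  have hV4 : V u ^ 4 ≤ V v ^ 4 := by
    have := pow_le_pow_left₀ (abs_nonneg _) hV 4
    rwa [Even.pow_abs (by decide), Even.pow_abs (by decide)] at this
  have hK5 : K κ v ^ 5 ≤ K κ u ^ 5 := pow_le_pow_left₀ hKv hK 5
  have hVu : 0 < V u ^ 4 := by have := hu.V_ne; positivity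
  have hle' : V v ^ 4 * K κ u ^ 5 ≤ V u ^ 4 * K κ v ^ 5 := by
    refine le_of_mul_le_mul_left ?_ hM0
    linarith
  have hKeq5 : K κ v ^ 5 = K κ u ^ 5 := by
    refine le_antisymm hK5 ?_
    refine le_of_mul_le_mul_left ?_ hVu
    exact (mul_le_mul_of_nonneg_right hV4 (by positivity)).trans hle'
  have hKeq : K κ v = K κ u := (pow_left_inj₀ hKv hK0.le (by norm_num)).1 hKeq5
  have hVeq4 : V v ^ 4 = V u ^ 4 := by
    refine le_antisymm ?_ hV4
    rw [hKeq5] at hle'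
    exact le_of_mul_le_mul_right hle' (by positivity)
  have hVeq : |V v| = |V u| := by
    refine (pow_left_inj₀ (abs_nonneg _) (abs_nonneg _) (n := 4) (by norm_num)).1 ?_
    rwa [Even.pow_abs (by decide), Even.pow_abs (by decide)]
  refine ⟨⟨hv, hM ▸ hM0, hKeq ▸ hK0, hVv, fun w hw => ?_⟩, hKeq, hVeq⟩
  rw [hM, hKeq, hVeq4]
  exact hu.le w hw

lemma normL2Sq_norm (u : E5 → ℂ) : normL2Sq (fun x => (‖u x‖ : ℂ)) = normL2Sq u := by
  simp [normL2Sq]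

/-- The moduli of an optimal triple are optimal. -/
lemma IsOpt.norm {κ : Fin 3 → ℝ} (hκ : ∀ j, 0 < κ j) {u : Fin 3 → E5 → ℂ} (hu : IsOpt κ u) :
    IsOpt κ (toC fun j x => ‖u j x‖) ∧ K κ (toC fun j x => ‖u j x‖) = K κ u ∧
      V (toC fun j x => ‖u j x‖) = |V u| := by
  have hnn : 0 ≤ V (toC fun j x => ‖u j x‖) := by
    rw [V_toC]; exact integral_nonneg fun x => by positivity
  have h := hu.of_comparison hκ (v := toC fun j x => ‖u j x‖) (fun j => (memH1_norm (hu.mem j)).1)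
    (by
      have h : ∀ j, normL2Sq (toC (fun j x => ‖u j x‖) j) = normL2Sq (u j) :=
        fun j => normL2Sq_norm (u j)
      simp only [M, h]) (K_le_K hκ fun j => (memH1_norm (hu.mem j)).2) (by
      rw [abs_of_nonneg hnn, V_toC, V]
      refine (Complex.abs_re_le_norm _).trans ((norm_integral_le_integral_norm _).trans (le_of_eq ?_))
      exact integral_congr_ae (ae_of_all _ fun x => by simp))
  rw [abs_of_nonneg hnn] at h
  exact h

/-- The polarization of a nonnegative optimal triple is optimal. -/
lemma IsOpt.pol {κ : Fin 3 → ℝ} (hκ : ∀ j, 0 < κ j) {f : Fin 3 → E5 → ℝ} (hu : IsOpt κ (toC f))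
    (hm : ∀ j, Measurable (f j)) (h0 : ∀ j x, 0 ≤ f j x) {e : E5} (he : ‖e‖ = 1) :
    IsOpt κ (toC fun j => pol e (f j)) ∧ K κ (toC fun j => pol e (f j)) = K κ (toC f) ∧
      M (toC fun j => pol e (f j)) = M (toC f) ∧ V (toC fun j => pol e (f j)) = V (toC f) := by
  have hV := V_le_V_pol he hm hu.mem h0
  have hnn : 0 ≤ V (toC f) := by
    rw [V_toC]
    exact integral_nonneg fun x => mul_nonneg (mul_nonneg (h0 0 x) (h0 1 x)) (h0 2 x)
  have hM : M (toC fun j => NLSSystem.pol e (f j)) = M (toC f) := by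
    have h : ∀ j, normL2Sq (toC (fun j => NLSSystem.pol e (f j)) j) = normL2Sq (toC f j) :=
      fun j => normL2Sq_pol he (hm j) (memLp_ofReal_iff.1 (hu.mem j).1)
    simp only [M, h]
  have h := hu.of_comparison hκ (memH1_toC_pol he hm hu.mem) hM
    (K_le_K hκ fun j => (memH1_pol he (hm j) (hu.mem j)).2)
    (by rwa [abs_of_nonneg hnn, abs_of_nonneg (hnn.trans hV)])
  rw [abs_of_nonneg hnn, abs_of_nonneg (hnn.trans hV)] at h
  exact ⟨h.1, h.2.1, hM, h.2.2⟩

/-! ### The Euler–Lagrange equations -/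

lemma laplacian_eq_sum {F : Type*} [NormedAddCommGroup F] [NormedSpace ℝ F] {ψ : E5 → F}
    (hψ : ContDiff ℝ ∞ ψ) (x : E5) :
    Laplacian.laplacian ψ x = ∑ i : Fin 5,
      fderiv ℝ (fun y => fderiv ℝ ψ y (EuclideanSpace.single i 1)) x (EuclideanSpace.single i 1) := by
  rw [InnerProductSpace.laplacian_eq_iteratedFDeriv_orthonormalBasis ψ
    (EuclideanSpace.basisFun (Fin 5) ℝ)]
  refine Finset.sum_congr rfl fun i _ => ?_
  have hd : DifferentiableAt ℝ (fderiv ℝ ψ) x :=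
    (hψ.fderiv_right (m := ∞) (by simp)).differentiable (by simp) x
  rw [iteratedFDeriv_two_apply, fderiv_clm_apply hd (differentiableAt_const _)]
  simp

lemma IsTest.laplacian {ψ : E5 → ℝ} (hψ : IsTest ψ) : IsTest (Laplacian.laplacian ψ) := by
  have h : Laplacian.laplacian ψ = fun x => ∑ i : Fin 5,
      _root_.fderiv ℝ (fun y => _root_.fderiv ℝ ψ y
        (EuclideanSpace.single i 1)) x (EuclideanSpace.single i 1) := by
    funext x; exact laplacian_eq_sum hψ.1 x
  rw [h]
  have hi : ∀ i : Fin 5, IsTest (fun x => _root_.fderiv ℝ (fun y => _root_.fderiv ℝ ψ y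
        (EuclideanSpace.single i 1)) x (EuclideanSpace.single i 1)) := fun i =>
    (hψ.fderiv (EuclideanSpace.single i 1)).fderiv (EuclideanSpace.single i 1)
  refine ⟨ContDiff.sum fun i _ => (hi i).1, ?_⟩
  simp only [Fin.sum_univ_five]
  exact ((((hi 0).2.add (hi 1).2).add (hi 2).2).add (hi 3).2).add (hi 4).2

/-- The coefficients of the zeroth order terms in the equations, which are twice the coefficients of
the squared norms in the mass. -/
def massCoef : Fin 3 → ℝ := ![1, 1, 2]

/-- The nonlinear terms, which are the derivatives of `V`. -/
def nonlin (u : Fin 3 → E5 → ℂ) : Fin 3 → E5 → ℂ :=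
  ![fun x => starRingEnd ℂ (u 1 x) * u 2 x, fun x => starRingEnd ℂ (u 0 x) * u 2 x,
    fun x => u 0 x * u 1 x]

lemma M_update {u : Fin 3 → E5 → ℂ} (hu : ∀ j, MemLp (u j) 2) {v : E5 → ℂ} (hv : MemLp v 2)
    (j : Fin 3) (t : ℝ) : M (Function.update u j (u j + (t : ℂ) • v))
      = M u + t * (massCoef j * ip (u j) v) + t ^ 2 * (massCoef j / 2 * normL2Sq v) := by
  have h := normL2Sq_add_smul (hu j) hv t
  fin_cases j <;> simp [M, massCoef] at h ⊢ <;> rw [h] <;> ring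

lemma K_update {κ : Fin 3 → ℝ} {u : Fin 3 → E5 → ℂ} (hu : ∀ j, MemH1 (u j)) {v : E5 → ℂ}
    (hv : MemH1 v) (j : Fin 3) (t : ℝ) : K κ (Function.update u j (u j + (t : ℂ) • v))
      = K κ u + t * (κ j * gip (u j) v) + t ^ 2 * (κ j / 2 * normH1DotSq v) := by
  have h := normH1DotSq_add_smul (hu j) hv t
  simp only [K, Fin.sum_univ_three]
  fin_cases j <;> simp at h ⊢ <;> rw [h] <;> ring

/-- The potential energy is affine in each component. -/
lemma V_update {u : Fin 3 → E5 → ℂ} (hu : ∀ j, MemH1 (u j)) {v : E5 → ℂ} (hv : MemH1 v)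
    (j : Fin 3) (t : ℝ) : V (Function.update u j (u j + (t : ℂ) • v))
      = V u + t * ∫ x, inner ℝ (v x) (nonlin u j x) := by
  have h3 := fun j => (hu j).memLp_three
  have hv3 := hv.memLp_three
  have htv : MemLp ((t : ℂ) • v) 3 := hv3.const_smul _
  rw [V_eq_tri h3, V_eq_tri (fun k => by
    rcases eq_or_ne k j with rfl | hk
    · rw [Function.update_self]; exact (h3 k).add htv
    · rw [Function.update_of_ne hk]; exact h3 k)]
  have hin : ∀ z w : ℂ, inner ℝ z w = (starRingEnd ℂ z * w).re := fun z w => by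
    rw [mul_comm]; rfl
  fin_cases j
  · have e : ∫ x, inner ℝ (v x) (nonlin u 0 x) = tri v (u 1) (u 2) :=
      integral_congr_ae (ae_of_all _ fun x => by simp only [hin, nonlin, mul_assoc]; rfl)
    change tri (u 0 + (t : ℂ) • v) (u 1) (u 2) = tri (u 0) (u 1) (u 2)
      + t * ∫ x, inner ℝ (v x) (nonlin u 0 x)
    rw [tri_add_left (h3 0) htv (h3 1) (h3 2), tri_smul_left, e]
  · have e : ∫ x, inner ℝ (v x) (nonlin u 1 x) = tri (u 0) v (u 2) :=
      integral_congr_ae (ae_of_all _ fun x => by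
        simp only [hin, nonlin, mul_assoc, mul_left_comm (starRingEnd ℂ (u 0 x))]; rfl)
    change tri (u 0) (u 1 + (t : ℂ) • v) (u 2) = tri (u 0) (u 1) (u 2)
      + t * ∫ x, inner ℝ (v x) (nonlin u 1 x)
    rw [tri_add_middle (h3 0) (h3 1) htv (h3 2), tri_smul_middle, e]
  · have e : ∫ x, inner ℝ (v x) (nonlin u 2 x) = tri (u 0) (u 1) v :=
      integral_congr_ae (ae_of_all _ fun x => by
        simp only [hin, nonlin]
        rw [← Complex.conj_re]
        simp [mul_comm])
    change tri (u 0) (u 1) (u 2 + (t : ℂ) • v) = tri (u 0) (u 1) (u 2)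
      + t * ∫ x, inner ℝ (v x) (nonlin u 2 x)
    rw [tri_add_right (h3 0) (h3 1) (h3 2) htv, tri_smul_right, e]

/-- The first variation of the optimality inequality. -/
lemma IsOpt.first_variation {κ : Fin 3 → ℝ} {u : Fin 3 → E5 → ℂ} (hu : IsOpt κ u) (j : Fin 3)
    {v : E5 → ℂ} (hv : MemH1 v) :
    massCoef j / (2 * M u) * ip (u j) v + 5 * κ j / (2 * K κ u) * gip (u j) v
      = 2 / V u * ∫ x, inner ℝ (v x) (nonlin u j x) := by
  set V1 := ∫ x, inner ℝ (v x) (nonlin u j x)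
  have hM := M_update (fun j => (hu.mem j).1) hv.1 j
  have hK := K_update (κ := κ) hu.mem hv j
  have hV := V_update hu.mem hv j
  set m1 := massCoef j * ip (u j) v with hm1
  set k1 := κ j * gip (u j) v with hk1
  set m2 := massCoef j / 2 * normL2Sq v
  set k2 := κ j / 2 * normH1DotSq v
  have hM0 := hu.M_pos
  have hK0 := hu.K_pos
  have hV0 := hu.V_ne
  set f : ℝ → ℝ := fun t => V u ^ 4 * ((M u + t * m1 + t ^ 2 * m2) * (K κ u + t * k1 + t ^ 2 * k2) ^ 5)
    - (V u + t * V1) ^ 4 * (M u * K κ u ^ 5) with hf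
  -- By optimality `f` is nonnegative, and it vanishes at `0`; note that it is a polynomial.
  have hmin : IsLocalMin f 0 := by
    refine Eventually.of_forall fun t => ?_
    have h0 : f 0 = 0 := by simp [hf]
    rw [h0]
    have hle := hu.le (Function.update u j (u j + (t : ℂ) • v)) (fun k => by
      rcases eq_or_ne k j with rfl | hk
      · rw [Function.update_self]; exact (hu.mem k).add (hv.const_smul _)
      · rw [Function.update_of_ne hk]; exact hu.mem k)
    rw [hM, hK, hV] at hle
    exact sub_nonneg.2 hle
  have hlin : ∀ a b c : ℝ, HasDerivAt (fun t : ℝ => a + t * b + t ^ 2 * c) b 0 := by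
    intro a b c
    have h := (((hasDerivAt_id (0 : ℝ)).mul_const b).const_add a).add
      (((hasDerivAt_id (0 : ℝ)).pow 2).mul_const c)
    exact h.congr_deriv (by simp)
  have hd : HasDerivAt f (V u ^ 4 * (m1 * K κ u ^ 5 + M u * (5 * K κ u ^ 4 * k1))
      - 4 * V u ^ 3 * V1 * (M u * K κ u ^ 5)) 0 := by
    have h1 := ((hlin (M u) m1 m2).mul ((hlin (K κ u) k1 k2).pow 5)).const_mul (V u ^ 4)
    have h2 := (((((hasDerivAt_id (0 : ℝ)).mul_const V1).const_add (V u))).pow 4).mul_const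
      (M u * K κ u ^ 5)
    have h3 := h1.sub h2
    refine h3.congr_deriv ?_
    simp
  have h0 := hmin.hasDerivAt_eq_zero hd
  have h1 : V u ^ 3 * K κ u ^ 4 * (V u * (m1 * K κ u + 5 * M u * k1) - 4 * V1 * M u * K κ u) = 0 := by
    rw [← h0]; ring
  have h2 : V u * (m1 * K κ u + 5 * M u * k1) - 4 * V1 * M u * K κ u = 0 := by
    rcases mul_eq_zero.1 h1 with h | h
    · exact absurd h (by positivity)
    · exact h
  have e1 : massCoef j / (2 * M u) * ip (u j) v = m1 / (2 * M u) := by rw [hm1]; ring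
  have e2 : 5 * κ j / (2 * K κ u) * gip (u j) v = 5 * k1 / (2 * K κ u) := by rw [hk1]; ring
  rw [e1, e2]
  field_simp
  linarith

/-- Testing with `c ψ` for a complex constant `c`. -/
lemma memH1_test {ψ : E5 → ℝ} (hψ : IsTest ψ) (c : ℂ) : MemH1 (fun x => ψ x • c) :=
  memH1_of_contDiff (hψ.1.smul contDiff_const) hψ.2.smul_right

lemma ip_test {g : E5 → ℂ} (hg : MemLp g 2) {ψ : E5 → ℝ} (hψ : IsTest ψ) (c : ℂ) :
    ip g (fun x => ψ x • c) = inner ℝ c (∫ x, ψ x • g x) := by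
  rw [← integral_inner (hψ.integrable_smul (locInt hg)), ip]
  refine integral_congr_ae (ae_of_all _ fun x => ?_)
  simp only [inner_smul_right]
  rw [real_inner_comm]

lemma gip_test {u : E5 → ℂ} (hu : MemH1 u) {ψ : E5 → ℝ} (hψ : IsTest ψ) (c : ℂ) :
    gip u (fun x => ψ x • c) = -inner ℝ c (∫ x, Laplacian.laplacian ψ x • u x) := by
  have hcd : ContDiff ℝ ∞ (fun x => ψ x • c) := hψ.1.smul contDiff_const
  have hder : ∀ i, (fun x => fderiv ℝ (fun x => ψ x • c) x (EuclideanSpace.single i 1))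
      = fun x => (fderiv ℝ ψ x (EuclideanSpace.single i 1)) • c := by
    intro i; funext x
    rw [fderiv_smul_const (hψ.1.differentiable (by simp) x)]; rfl
  have hi : ∀ i, ip (weakPartial i u) (weakPartial i (fun x => ψ x • c))
      = -inner ℝ c (∫ x, (fderiv ℝ (fun y => fderiv ℝ ψ y (EuclideanSpace.single i 1)) x
          (EuclideanSpace.single i 1)) • u x) := by
    intro i
    have hp := hasWeakPartial_of_contDiff hcd i
    rw [hder i] at hp
    have hpm : MemLp (fun x => (fderiv ℝ ψ x (EuclideanSpace.single i 1)) • c) 2 :=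
      (memH1_test (hψ.fderiv _) c).1
    rw [ip_congr (EventuallyEq.refl _ _) (weakPartial_ae_eq hpm hp),
      ip_test (hu.memLp_weakPartial i) (hψ.fderiv _), hu.hasWeakPartial i _ (hψ.fderiv _),
      inner_neg_right, neg_neg]
  rw [gip, Finset.sum_congr rfl fun i _ => hi i, Finset.sum_neg_distrib, ← inner_sum,
    ← integral_finsetSum]
  · congr 2
    refine integral_congr_ae (ae_of_all _ fun x => ?_)
    simp only [laplacian_eq_sum hψ.1, Finset.sum_smul]
  · intro i _
    exact ((hψ.fderiv _).fderiv _).integrable_smul (locInt hu.1)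

lemma integrable_nonlin {u : Fin 3 → E5 → ℂ} (hu : ∀ j, MemLp (u j) 2) (j : Fin 3) :
    Integrable (nonlin u j) := by
  fin_cases j
  · exact integrable_mul_of_memLp (memLp_conj (hu 1)) (hu 2)
  · exact integrable_mul_of_memLp (memLp_conj (hu 0)) (hu 2)
  · exact integrable_mul_of_memLp (hu 0) (hu 1)

/-- Optimal triples solve the **Euler–Lagrange equations**. -/
lemma IsOpt.solvesWeakly {κ : Fin 3 → ℝ} {u : Fin 3 → E5 → ℂ} (hu : IsOpt κ u) (j : Fin 3) :
    SolvesWeakly (massCoef j / (2 * M u)) (5 * κ j / (2 * K κ u)) (u j)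
      (fun x => ((2 / V u : ℝ) : ℂ) * nonlin u j x) := by
  intro ψ hψ
  set a := massCoef j / (2 * M u)
  set k := 5 * κ j / (2 * K κ u)
  have hloc := locInt (hu.mem j).1
  have hF := (integrable_nonlin (fun j => (hu.mem j).1) j).locallyIntegrable
  set A := ∫ x, ψ x • u j x
  set B := ∫ x, Laplacian.laplacian ψ x • u j x
  set C := ∫ x, ψ x • nonlin u j x
  have e1 : ∫ x, (a * ψ x - k * Laplacian.laplacian ψ x) • u j x = a • A - k • B := by
    simp only [sub_smul, mul_smul]
    have h1 : Integrable fun x => a • ψ x • u j x := (hψ.integrable_smul hloc).smul a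
    have h2 : Integrable fun x => k • Laplacian.laplacian ψ x • u j x :=
      (hψ.laplacian.integrable_smul hloc).smul k
    rw [integral_sub h1 h2, integral_smul, integral_smul]
  have e2 : ∫ x, ψ x • (((2 / V u : ℝ) : ℂ) * nonlin u j x) = (2 / V u) • C := by
    rw [← integral_smul]
    refine integral_congr_ae (ae_of_all _ fun x => ?_)
    simp only [← Complex.real_smul]
    rw [smul_comm]
  rw [e1, e2, ← sub_eq_zero]
  have hc : ∀ c : ℂ, inner ℝ c (a • A - k • B - (2 / V u) • C) = 0 := by
    intro c
    have h := hu.first_variation j (memH1_test hψ c)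
    rw [ip_test (hu.mem j).1 hψ, gip_test (hu.mem j) hψ] at h
    have hC : ∫ x, inner ℝ (ψ x • c) (nonlin u j x) = inner ℝ c C := by
      rw [← integral_inner (hψ.integrable_smul hF)]
      refine integral_congr_ae (ae_of_all _ fun x => ?_)
      simp only [inner_smul_right, inner_smul_left]; rfl
    rw [hC] at h
    rw [inner_sub_right, inner_sub_right, inner_smul_right, inner_smul_right, inner_smul_right]
    linarith
  exact inner_self_eq_zero.1 (hc _)

/-! ### Gaussian averages -/

lemma integrable_exp_neg_mul_norm_sq {b : ℝ} (hb : 0 < b) :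
    Integrable (fun z : E5 => Real.exp (-b * ‖z‖ ^ 2)) := by
  have h := (GaussianFourier.integrable_cexp_neg_mul_sq_norm_add (V := E5) (b := (b : ℂ))
    (by simpa using hb) 0 0).norm
  refine h.congr (ae_of_all _ fun z => ?_)
  simp only [zero_mul, add_zero, Complex.norm_exp]
  rw [← Complex.ofReal_pow, ← Complex.ofReal_neg, ← Complex.ofReal_mul, Complex.ofReal_re]

/-- The standard Gaussian density. -/
def gam (z : E5) : ℝ :=
  (∫ y : E5, Real.exp (-(1 / 2) * ‖y‖ ^ 2))⁻¹ * Real.exp (-(1 / 2) * ‖z‖ ^ 2)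

lemma integral_gaussian_pos : 0 < ∫ y : E5, Real.exp (-(1 / 2) * ‖y‖ ^ 2) :=
  integral_exp_pos (μ := (volume : Measure E5)) (f := fun y : E5 => -(1 / 2 : ℝ) * ‖y‖ ^ 2)
    (integrable_exp_neg_mul_norm_sq (by norm_num))

lemma gam_pos (z : E5) : 0 < gam z := mul_pos (inv_pos.2 integral_gaussian_pos) (Real.exp_pos _)

lemma integrable_gam : Integrable gam :=
  (integrable_exp_neg_mul_norm_sq (by norm_num)).const_mul _

lemma integral_gam : ∫ z, gam z = 1 := by
  simp only [gam]
  rw [integral_const_mul, inv_mul_cancel₀ integral_gaussian_pos.ne']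

lemma contDiff_gam : ContDiff ℝ ∞ gam :=
  contDiff_const.mul (Real.contDiff_exp.comp (contDiff_const.mul (contDiff_norm_sq ℝ)))

lemma gam_neg (z : E5) : gam (-z) = gam z := by simp [gam]

lemma gam_le_gam {z w : E5} (h : ‖w‖ ≤ ‖z‖) : gam z ≤ gam w := by
  have := integral_gaussian_pos
  rw [gam, gam]
  gcongr ?_ * Real.exp ?_
  nlinarith [pow_le_pow_left₀ (norm_nonneg w) h 2]

lemma gam_lt_gam {z w : E5} (h : ‖w‖ < ‖z‖) : gam z < gam w := by
  have := inv_pos.2 integral_gaussian_pos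
  rw [gam, gam]
  refine mul_lt_mul_of_pos_left (Real.exp_lt_exp.2 ?_) this
  nlinarith [pow_lt_pow_left₀ h (norm_nonneg w) two_ne_zero]

lemma gam_le_gam_zero (z : E5) : gam z ≤ gam 0 := gam_le_gam (by simp)

lemma memLp_gam : MemLp gam 2 := by
  refine (memLp_two_iff_integrable_sq contDiff_gam.continuous.aestronglyMeasurable).2 ?_
  refine (integrable_gam.const_mul (gam 0)).mono'
    (contDiff_gam.continuous.pow 2).aestronglyMeasurable (ae_of_all _ fun z => ?_)
  rw [Real.norm_of_nonneg (sq_nonneg _), sq]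
  exact mul_le_mul_of_nonneg_right (gam_le_gam_zero z) (gam_pos z).le

lemma integrable_norm_mul_gam : Integrable (fun z : E5 => ‖z‖ * gam z) := by
  have h := (integrable_exp_neg_mul_norm_sq (b := 1 / 4) (by norm_num)).const_mul
    (2 * (∫ y : E5, Real.exp (-(1 / 2) * ‖y‖ ^ 2))⁻¹)
  refine h.mono' (continuous_norm.mul contDiff_gam.continuous).aestronglyMeasurable
    (ae_of_all _ fun z => ?_)
  rw [Real.norm_of_nonneg (mul_nonneg (norm_nonneg _) (gam_pos z).le), gam]
  have h1 : ‖z‖ ≤ 2 * Real.exp (1 / 4 * ‖z‖ ^ 2) := by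
    nlinarith [Real.add_one_le_exp (1 / 4 * ‖z‖ ^ 2), sq_nonneg (1 - ‖z‖ / 2)]
  have h2 : Real.exp (-(1 / 4) * ‖z‖ ^ 2)
      = Real.exp (1 / 4 * ‖z‖ ^ 2) * Real.exp (-(1 / 2) * ‖z‖ ^ 2) := by
    rw [← Real.exp_add]; congr 1; ring
  rw [h2]
  have h3 := inv_pos.2 integral_gaussian_pos
  have h4 := mul_le_mul_of_nonneg_right h1
    (mul_pos h3 (Real.exp_pos (-(1 / 2) * ‖z‖ ^ 2))).le
  linarith

lemma fderiv_gam (z v : E5) : fderiv ℝ gam z v = -(inner ℝ z v * gam z) := by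
  have h1 : HasFDerivAt (fun z : E5 => ‖z‖ ^ 2) (2 • innerSL ℝ z) z :=
    (hasStrictFDerivAt_norm_sq z).hasFDerivAt
  have h2 := ((h1.const_mul (-(1 / 2))).exp).const_mul
    (∫ y : E5, Real.exp (-(1 / 2) * ‖y‖ ^ 2))⁻¹
  have h3 : HasFDerivAt gam _ z := h2
  rw [h3.fderiv]
  simp only [gam, _root_.smul_apply, smul_eq_mul, innerSL_apply_apply, nsmul_eq_mul]
  push_cast
  ring

/-- The Gaussian average of `f` at scale `r` around `y`. -/
def gauss (r : ℝ) (f : E5 → ℝ) (y : E5) : ℝ := ∫ z, gam z * f (y + r • z)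

lemma integrable_gam_mul {f : E5 → ℝ} (hf : Continuous f) {B : ℝ} (hB : ∀ x, |f x| ≤ B) :
    Integrable (fun z => gam z * f z) := by
  simp_rw [mul_comm (gam _)]
  exact integrable_gam.bdd_mul hf.aestronglyMeasurable (ae_of_all _ hB)

lemma integrable_coord_mul_gam {f : E5 → ℝ} (hf : Continuous f) {B : ℝ} (hB : ∀ x, |f x| ≤ B)
    (i : Fin 5) : Integrable (fun z : E5 => z i * gam z * f z) := by
  simp_rw [mul_comm (_ * gam _)]
  refine Integrable.bdd_mul ?_ hf.aestronglyMeasurable (ae_of_all _ hB)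
  refine integrable_norm_mul_gam.mono' (Continuous.aestronglyMeasurable ?_) (ae_of_all _ fun z => ?_)
  · exact (by fun_prop : Continuous fun z : E5 => z i).mul contDiff_gam.continuous
  · rw [norm_mul, Real.norm_of_nonneg (gam_pos z).le]
    exact mul_le_mul_of_nonneg_right (abs_coord_le z i) (gam_pos z).le

/-- Gaussian integration by parts. -/
lemma integral_coord_mul_gam {g : E5 → ℝ} (hg : ContDiff ℝ ∞ g) {B : ℝ} (hB : ∀ x, |g x| ≤ B)
    (i : Fin 5) (hB' : ∀ x, |fderiv ℝ g x (EuclideanSpace.single i 1)| ≤ B) (r : ℝ) :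
    ∫ z : E5, z i * gam z * g (r • z)
      = r * ∫ z, gam z * fderiv ℝ g (r • z) (EuclideanSpace.single i 1) := by
  have hcomp : ContDiff ℝ ∞ (fun z : E5 => g (r • z)) := hg.comp (contDiff_const_smul r)
  have hd : ∀ z, fderiv ℝ (fun z : E5 => g (r • z)) z (EuclideanSpace.single i 1)
      = r * fderiv ℝ g (r • z) (EuclideanSpace.single i 1) := by
    intro z; rw [fderiv_comp_smul]; rfl
  have hc' : Continuous fun z : E5 => fderiv ℝ g (r • z) (EuclideanSpace.single i 1) :=
    ((hg.continuous_fderiv (by simp)).comp (continuous_const_smul r)).clm_apply continuous_const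
  have hgz : ∀ z : E5, fderiv ℝ gam z (EuclideanSpace.single i 1) = -(z i * gam z) := by
    intro z; rw [fderiv_gam, inner_single_right]
  have i1 := integrable_coord_mul_gam hcomp.continuous (fun x => hB (r • x)) i
  have i2 := (integrable_gam_mul hc' (fun x => hB' (r • x))).const_mul r
  have h := integral_mul_fderiv_eq_neg_fderiv_mul_of_integrable (μ := (volume : Measure E5))
    (f := gam) (g := fun z : E5 => g (r • z)) (v := EuclideanSpace.single i 1)
    (by simp_rw [hgz, neg_mul]; exact i1.neg)
    (by simp_rw [hd, mul_left_comm (gam _)]; exact i2)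
    (integrable_gam_mul hcomp.continuous fun x => hB (r • x))
    (fun x _ => contDiff_gam.differentiable (by simp) x)
    (fun x _ => hcomp.differentiable (by simp) x)
  simp_rw [hgz, hd, neg_mul, integral_neg, neg_neg, mul_left_comm (gam _) r] at h
  rw [← h, integral_const_mul]

/-- The **heat equation** for Gaussian averages, in terms of the scale. -/
lemma hasDerivAt_gauss {v : E5 → ℝ} (hv : ContDiff ℝ ∞ v) {B : ℝ} (hB : ∀ x, |v x| ≤ B)
    (hB1 : ∀ i x, |fderiv ℝ v x (EuclideanSpace.single i 1)| ≤ B)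
    (hB2 : ∀ i x, |fderiv ℝ (fun y => fderiv ℝ v y (EuclideanSpace.single i 1)) x
      (EuclideanSpace.single i 1)| ≤ B) (r : ℝ) :
    HasDerivAt (fun r => ∫ z, gam z * v (r • z))
      (r * ∫ z, gam z * Laplacian.laplacian v (r • z)) r := by
  have hdi : ∀ i, ContDiff ℝ ∞ (fun y => fderiv ℝ v y (EuclideanSpace.single i 1)) := fun i =>
    (hv.fderiv_right (m := ∞) (by simp)).clm_apply contDiff_const
  have hexp : ∀ (r : ℝ) (z : E5), gam z * fderiv ℝ v (r • z) z
      = ∑ i, z i * gam z * fderiv ℝ v (r • z) (EuclideanSpace.single i 1) := by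
    intro r z
    conv_lhs => rw [eq_sum_single z]
    simp only [map_sum, Finset.mul_sum, map_smul, smul_eq_mul]
    refine Finset.sum_congr rfl fun i _ => ?_
    rw [← eq_sum_single z]; ring
  have h := (hasDerivAt_integral_of_dominated_loc_of_deriv_le (μ := (volume : Measure E5))
    (F := fun (r : ℝ) (z : E5) => gam z * v (r • z))
    (F' := fun (r : ℝ) (z : E5) => gam z * fderiv ℝ v (r • z) z)
    (bound := fun z => (5 * B) * (‖z‖ * gam z)) (x₀ := r) (s := Set.univ) univ_mem
    (Eventually.of_forall fun r => (contDiff_gam.continuous.mul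
      (hv.continuous.comp (continuous_const_smul r))).aestronglyMeasurable)
    (integrable_gam_mul (hv.continuous.comp (continuous_const_smul r)) fun x => hB (r • x))
    (contDiff_gam.continuous.mul (((hv.continuous_fderiv (by simp)).comp
      (continuous_const_smul r)).clm_apply continuous_id)).aestronglyMeasurable
    (ae_of_all _ fun z r _ => by
      rw [hexp]
      refine (norm_sum_le _ _).trans ?_
      calc ∑ i : Fin 5, ‖z i * gam z * fderiv ℝ v (r • z) (EuclideanSpace.single i 1)‖
          ≤ ∑ i : Fin 5, ‖z‖ * gam z * B := by
            refine Finset.sum_le_sum fun i _ => ?_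
            rw [norm_mul, norm_mul, Real.norm_of_nonneg (gam_pos z).le]
            exact mul_le_mul (mul_le_mul_of_nonneg_right (abs_coord_le z i) (gam_pos z).le)
              (hB1 i _) (norm_nonneg _) (mul_nonneg (norm_nonneg _) (gam_pos z).le)
        _ = (5 * B) * (‖z‖ * gam z) := by simp; ring)
    (integrable_norm_mul_gam.const_mul _)
    (ae_of_all _ fun z r _ => by
      have h1 : HasDerivAt (fun r : ℝ => r • z) z r := by
        simpa using (hasDerivAt_id r).smul_const z
      exact (((hv.differentiable (by simp) (r • z)).hasFDerivAt).comp_hasDerivAt r h1).const_mul _)).2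
  refine h.congr_deriv ?_
  simp_rw [hexp]
  have hint : ∀ i ∈ Finset.univ, Integrable fun z : E5 =>
      z i * gam z * fderiv ℝ v (r • z) (EuclideanSpace.single i 1) := fun i _ =>
    integrable_coord_mul_gam ((hdi i).continuous.comp (continuous_const_smul r))
      (fun x => hB1 i (r • x)) i
  rw [integral_finsetSum _ hint]
  rw [Finset.sum_congr rfl fun i _ => integral_coord_mul_gam (hdi i) (hB1 i) i (hB2 i) r,
    ← Finset.mul_sum]
  congr 1
  simp_rw [laplacian_eq_sum hv, Finset.mul_sum]
  refine (integral_finsetSum _ fun i _ => ?_).symm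
  exact integrable_gam_mul ((((hdi i).fderiv_right (m := ∞) (by simp)).clm_apply
    contDiff_const).continuous.comp (continuous_const_smul r)) fun x => hB2 i (r • x)

lemma abs_conv_le {ρ : E5 → ℝ} (hρ : IsTest ρ) {D : E5 → ℝ} (hD : MemLp D 2) :
    ∃ B, ∀ x, |conv ρ D x| ≤ B := by
  refine ⟨(∫ x, ρ x ^ 2) + ∫ x, D x ^ 2, fun x => ?_⟩
  have h2 : Integrable fun t => D (x - t) ^ 2 := hD.integrable_sq.comp_sub_left x
  have h1 := (hρ.memLp 2).integrable_sq
  rw [← integral_sub_left_eq_self (fun t => D t ^ 2) volume x, ← integral_add h1 h2]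
  refine norm_integral_le_of_norm_le (f := fun t => ρ t • D (x - t)) (h1.add h2)
    (ae_of_all _ fun t => ?_)
  rw [norm_smul, Real.norm_eq_abs, Real.norm_eq_abs]
  nlinarith [sq_nonneg (|ρ t| - |D (x - t)|), sq_abs (ρ t), sq_abs (D (x - t)),
    sq_nonneg (ρ t), sq_nonneg (D (x - t))]

/-- Gaussian averages in terms of the heat kernel. -/
lemma gauss_eq {r : ℝ} (hr : 0 < r) (f : E5 → ℝ) (y : E5) :
    gauss r f y = (r ^ 5)⁻¹ * ∫ w, gam (r⁻¹ • (w - y)) * f w := by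
  have h := integral_comp_affine (fun w => gam (r⁻¹ • (w - y)) * f w) hr y
  rw [smul_eq_mul] at h
  rw [← h, gauss]
  refine integral_congr_ae (ae_of_all _ fun z => ?_)
  simp only [add_sub_cancel_right, smul_smul, inv_mul_cancel₀ hr.ne', one_smul]
  rw [add_comm y]

lemma integrable_gauss {f : E5 → ℝ} (hf : MemLp f 2) {r : ℝ} (hr : 0 < r) (y : E5) :
    Integrable (fun z => gam z * f (y + r • z)) := by
  have h := (memLp_comp_affine (u := fun x => (f x : ℂ)) hf.ofReal hr y).re
  simp only [RCLike.re_to_complex, Complex.ofReal_re] at h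
  simp only [add_comm _ y] at h
  exact memLp_gam.integrable_mul h

lemma integrable_gauss' {f : E5 → ℝ} (hf : MemLp f 2) {r : ℝ} (hr : 0 < r) (y : E5) :
    Integrable (fun w => gam (r⁻¹ • (w - y)) * f w) := by
  have h := integrable_comp_affine (integrable_gauss hf hr y) (inv_pos.2 hr) (-(r⁻¹ • y))
  refine h.congr (ae_of_all _ fun w => ?_)
  simp only [smul_add, smul_smul, mul_inv_cancel₀ hr.ne', one_smul, smul_neg]
  congr 2
  · rw [smul_sub, sub_eq_add_neg]
  · abel

/-! ### A comparison principle -/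

lemma exists_bound_conv_derivs {ρ : E5 → ℝ} (hρ : IsTest ρ) {D : E5 → ℝ} (hD : MemLp D 2) :
    ∃ B, (∀ x, |conv ρ D x| ≤ B) ∧
      (∀ i x, |fderiv ℝ (conv ρ D) x (EuclideanSpace.single i 1)| ≤ B) ∧
      ∀ i x, |fderiv ℝ (fun y => fderiv ℝ (conv ρ D) y (EuclideanSpace.single i 1)) x
        (EuclideanSpace.single i 1)| ≤ B := by
  have hloc : LocallyIntegrable D := locInt hD
  have h1 : ∀ i, (fun y => fderiv ℝ (conv ρ D) y (EuclideanSpace.single i 1))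
      = conv (fun y => fderiv ℝ ρ y (EuclideanSpace.single i 1)) D := fun i =>
    funext fun y => fderiv_conv hρ hloc y _
  obtain ⟨B0, hB0⟩ := abs_conv_le hρ hD
  choose B1 hB1 using fun i : Fin 5 => abs_conv_le (hρ.fderiv (EuclideanSpace.single i 1)) hD
  choose B2 hB2 using fun i : Fin 5 =>
    abs_conv_le ((hρ.fderiv (EuclideanSpace.single i 1)).fderiv (EuclideanSpace.single i 1)) hD
  obtain ⟨C1, hC1⟩ := Finite.bddAbove_range B1
  obtain ⟨C2, hC2⟩ := Finite.bddAbove_range B2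
  refine ⟨max B0 (max C1 C2), fun x => (hB0 x).trans (le_max_left _ _), fun i x => ?_, fun i x => ?_⟩
  · rw [fderiv_conv hρ hloc]
    exact ((hB1 i x).trans (hC1 ⟨i, rfl⟩)).trans ((le_max_left _ _).trans (le_max_right _ _))
  · rw [h1 i, fderiv_conv (hρ.fderiv _) hloc]
    exact ((hB2 i x).trans (hC2 ⟨i, rfl⟩)).trans ((le_max_right _ _).trans (le_max_right _ _))

lemma laplacian_comp_sub {ρ : E5 → ℝ} (hρ : IsTest ρ) (x t : E5) :
    Laplacian.laplacian (fun y => ρ (x - y)) t = Laplacian.laplacian ρ (x - t) := by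
  rw [laplacian_eq_sum (hρ.comp_sub x).1, laplacian_eq_sum hρ.1]
  refine Finset.sum_congr rfl fun i _ => ?_
  have h : (fun y => fderiv ℝ (fun y => ρ (x - y)) y (EuclideanSpace.single i 1))
      = -fun y => (fun w => fderiv ℝ ρ w (EuclideanSpace.single i 1)) (x - y) :=
    funext fun y => fderiv_comp_sub hρ x y _
  rw [h, fderiv_neg, neg_apply, fderiv_comp_sub (hρ.fderiv _), neg_neg]

lemma laplacian_conv {ρ : E5 → ℝ} (hρ : IsTest ρ) {D : E5 → ℝ} (hD : LocallyIntegrable D) (x : E5) :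
    Laplacian.laplacian (conv ρ D) x = conv (Laplacian.laplacian ρ) D x := by
  rw [laplacian_eq_sum (conv_contDiff hρ hD), conv_apply_swap]
  simp_rw [laplacian_eq_sum hρ.1, Finset.sum_smul]
  rw [integral_finsetSum _ fun i _ => integrable_conv ((hρ.fderiv _).fderiv _) hD x]
  refine Finset.sum_congr rfl fun i _ => ?_
  have h1 : (fun y => fderiv ℝ (conv ρ D) y (EuclideanSpace.single i 1))
      = conv (fun y => fderiv ℝ ρ y (EuclideanSpace.single i 1)) D :=
    funext fun y => fderiv_conv hρ hD y _
  rw [h1, fderiv_conv (hρ.fderiv _) hD, conv_apply_swap]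

/-- The real form of `SolvesWeakly`. -/
def SolvesReal (a k : ℝ) (D F : E5 → ℝ) : Prop :=
  ∀ ψ : E5 → ℝ, IsTest ψ →
    ∫ x, (a * ψ x - k * Laplacian.laplacian ψ x) * D x = ∫ x, ψ x * F x

/-- Regularized solutions solve the regularized equation classically. -/
lemma SolvesReal.conv_eq {a k : ℝ} {D F : E5 → ℝ} (h : SolvesReal a k D F) (hD : LocallyIntegrable D)
    {ρ : E5 → ℝ} (hρ : IsTest ρ) (x : E5) :
    a * conv ρ D x - k * Laplacian.laplacian (conv ρ D) x = conv ρ F x := by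
  have h1 := h _ (hρ.comp_sub x)
  rw [laplacian_conv hρ hD, conv_apply_swap, conv_apply_swap, conv_apply_swap]
  simp only [smul_eq_mul]
  rw [← h1, ← integral_const_mul, ← integral_const_mul, ← integral_sub]
  · refine integral_congr_ae (ae_of_all _ fun t => ?_)
    simp only [laplacian_comp_sub hρ]; ring
  · exact (integrable_conv hρ hD x).const_mul a
  · exact (integrable_conv hρ.laplacian hD x).const_mul k

lemma exists_bound_gauss {f : E5 → ℝ} (hf : MemLp f 2) {r : ℝ} (hr : 0 < r) :
    ∃ C, ∀ y, ∫ z, ‖gam z * f (y + r • z)‖ ≤ C := by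
  refine ⟨(∫ z, gam z ^ 2) + (r ^ 5)⁻¹ * ∫ x, f x ^ 2, fun y => ?_⟩
  have h1 := memLp_gam.integrable_sq
  have h2 := integrable_comp_affine hf.integrable_sq hr y
  have h3 := integral_comp_affine (fun x => f x ^ 2) hr y
  rw [smul_eq_mul] at h3
  rw [← h3, ← integral_add h1 h2]
  refine integral_mono (integrable_gauss hf hr y).norm (h1.add h2) fun z => ?_
  simp only [norm_mul, Real.norm_eq_abs]
  rw [add_comm y]
  nlinarith [sq_nonneg (|gam z| - |f (r • z + y)|), sq_abs (gam z), sq_abs (f (r • z + y)),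
    sq_nonneg (gam z), sq_nonneg (f (r • z + y))]

lemma measurable_gauss {f : E5 → ℝ} (hf : Measurable f) (r : ℝ) : Measurable (gauss r f) := by
  have h : StronglyMeasurable (fun p : E5 × E5 => gam p.2 * f (p.1 + r • p.2)) :=
    ((contDiff_gam.continuous.measurable.comp measurable_snd).mul
      (hf.comp (by fun_prop))).stronglyMeasurable
  exact h.integral_prod_right'.measurable

lemma locallyIntegrable_gauss {f : E5 → ℝ} (hfm : Measurable f) (hf : MemLp f 2) {r : ℝ}
    (hr : 0 < r) : LocallyIntegrable (gauss r f) := by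
  obtain ⟨C, hC⟩ := exists_bound_gauss hf hr
  refine (memLp_top_of_bound (measurable_gauss hfm r).aestronglyMeasurable C
    (ae_of_all _ fun y => ?_)).locallyIntegrable le_top
  exact (norm_integral_le_integral_norm _).trans (hC y)

/-- The Gaussian average of a regularization, at the origin. -/
lemma integral_gam_conv {η : E5 → ℝ} (hη : IsTest η) {f : E5 → ℝ} (hfm : Measurable f)
    (hf : MemLp f 2) {r : ℝ} (hr : 0 < r) :
    ∫ z, gam z * conv (fun w => η (0 - w)) f (r • z) = ∫ y, η y * gauss r f y := by
  obtain ⟨C, hC⟩ := exists_bound_gauss hf hr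
  have hint : Integrable (fun p : E5 × E5 => η p.1 * (gam p.2 * f (p.1 + r • p.2)))
      (volume.prod volume) := by
    have hm : Measurable (fun p : E5 × E5 => η p.1 * (gam p.2 * f (p.1 + r • p.2))) :=
      (hη.1.continuous.measurable.comp measurable_fst).mul
        ((contDiff_gam.continuous.measurable.comp measurable_snd).mul (hfm.comp (by fun_prop)))
    rw [integrable_prod_iff hm.aestronglyMeasurable]
    refine ⟨ae_of_all _ fun y => (integrable_gauss hf hr y).const_mul (η y), ?_⟩
    refine ((memLp_one_iff_integrable.1 (hη.memLp 1)).norm.mul_const C).mono'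
      hm.aestronglyMeasurable.norm.integral_prod_right' (ae_of_all _ fun y => ?_)
    rw [Real.norm_of_nonneg (integral_nonneg fun z => norm_nonneg _)]
    simp_rw [norm_mul (η y)]
    rw [integral_const_mul]
    exact mul_le_mul_of_nonneg_left (hC y) (norm_nonneg _)
  have h2 := integral_integral_swap (μ := (volume : Measure E5)) (ν := (volume : Measure E5))
    (f := fun y z => η y * (gam z * f (y + r • z))) hint
  simp_rw [integral_const_mul] at h2
  change ∫ y, η y * gauss r f y = _ at h2
  rw [h2]
  refine integral_congr_ae (ae_of_all _ fun z => ?_)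
  simp only
  rw [conv_apply_swap, ← integral_const_mul,
    ← integral_add_right_eq_self (fun t => gam z * (η (0 - (r • z - t)) • f t)) (r • z)]
  refine integral_congr_ae (ae_of_all _ fun t => ?_)
  simp only [smul_eq_mul]
  rw [show (0 : E5) - (r • z - (t + r • z)) = t by abel]
  ring

lemma integral_gam_conv' {η : E5 → ℝ} (hη : IsTest η) {F : E5 → ℝ} (hF : Integrable F) (r : ℝ) :
    ∫ z, gam z * conv (fun w => η (0 - w)) F (r • z) = ∫ y, F y * gauss r η y := by
  obtain ⟨B, hB⟩ := hη.1.continuous.bounded_above_of_compact_support hη.2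
  have hint : Integrable (fun p : E5 × E5 => gam p.1 * (η (p.2 - r • p.1) * F p.2))
      (volume.prod volume) := by
    have h1 : Integrable (fun p : E5 × E5 => gam p.1 * F p.2) (volume.prod volume) :=
      integrable_gam.mul_prod hF
    have hc : Continuous fun p : E5 × E5 => η (p.2 - r • p.1) :=
      hη.1.continuous.comp (by fun_prop)
    refine (h1.bdd_mul hc.aestronglyMeasurable (ae_of_all _ fun p => hB _)).congr
      (ae_of_all _ fun p => ?_)
    simp only; ring
  have h2 := integral_integral_swap (μ := (volume : Measure E5)) (ν := (volume : Measure E5))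
    (f := fun z y => gam z * (η (y - r • z) * F y)) hint
  have e1 : ∀ z : E5, ∫ y, gam z * (η (y - r • z) * F y)
      = gam z * conv (fun w => η (0 - w)) F (r • z) := by
    intro z
    rw [integral_const_mul, conv_apply_swap]
    congr 1
    refine integral_congr_ae (ae_of_all _ fun t => ?_)
    simp only [smul_eq_mul, zero_sub, neg_sub]
  have e2 : ∀ y : E5, ∫ z, gam z * (η (y - r • z) * F y) = F y * gauss r η y := by
    intro y
    rw [gauss, ← integral_const_mul, ← integral_neg_eq_self]
    refine integral_congr_ae (ae_of_all _ fun z => ?_)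
    simp only [gam_neg, smul_neg, sub_neg_eq_add]; ring
  simp_rw [e1, e2] at h2
  exact h2

/-- A solution of `a D - k ΔD = F` lies above its (damped) Gaussian averages wherever the heat flow
does not see the negative part of `F`. -/
lemma SolvesReal.gauss_le {a k : ℝ} (hk : 0 < k) {D F : E5 → ℝ} (h : SolvesReal a k D F)
    (hDm : Measurable D) (hD : MemLp D 2) (hF : Integrable F) {H : Set E5} (hH : IsOpen H)
    (hpos : ∀ η : E5 → ℝ, IsTest η → (∀ x, 0 ≤ η x) → (∀ x, x ∉ H → η x = 0) →
      ∀ r, 0 < r → 0 ≤ ∫ y, F y * gauss r η y) {r : ℝ} (hr : 0 < r) :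
    ∀ᵐ x, x ∈ H → Real.exp (-(a * r ^ 2 / (2 * k))) * gauss r D x ≤ D x := by
  have hloc : LocallyIntegrable D := locInt hD
  refine ae_le_of_forall_test ((locallyIntegrable_gauss hDm hD hr).smul
    (Real.exp (-(a * r ^ 2 / (2 * k))))) hloc hH fun η hη h0 hηH => ?_
  -- Regularizing `D` with the reflected test function gives a smooth `v` with `v 0 = ∫ η D`; the claim
  -- tested with `η` says that the damped Gaussian average of `v` at `0` is at most `v 0`.
  set ρ : E5 → ℝ := fun w => η (0 - w) with hρdef
  have hρ : IsTest ρ := hη.comp_sub 0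
  set v := conv ρ D with hv
  have hvc : ContDiff ℝ ∞ v := conv_contDiff hρ hloc
  obtain ⟨B, hB0, hB1, hB2⟩ := exists_bound_conv_derivs hρ hD
  set G : ℝ → ℝ := fun s => ∫ z, gam z * v (s • z) with hG
  have hGd : ∀ s, HasDerivAt G (s * ∫ z, gam z * Laplacian.laplacian v (s • z)) s :=
    hasDerivAt_gauss hvc hB0 hB1 hB2
  have hlap : ∀ s, k * ∫ z, gam z * Laplacian.laplacian v (s • z)
      = a * G s - ∫ y, F y * gauss s η y := by
    intro s
    rw [← integral_gam_conv' hη hF s, ← integral_const_mul, hG]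
    simp only
    rw [← integral_const_mul, ← integral_sub]
    · refine integral_congr_ae (ae_of_all _ fun z => ?_)
      have := h.conv_eq hloc hρ (s • z)
      simp only [← hρdef]
      rw [← this]; ring
    · exact (integrable_gam_mul (hvc.continuous.comp (continuous_const_smul s))
        fun x => hB0 (s • x)).const_mul a
    · have hcF : Continuous (conv ρ F) := (conv_contDiff hρ hF.locallyIntegrable).continuous
      obtain ⟨B', hB'⟩ := hρ.1.continuous.bounded_above_of_compact_support hρ.2
      refine integrable_gam_mul (f := fun z => conv ρ F (s • z)) (B := B' * ∫ x, ‖F x‖)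
        (hcF.comp (continuous_const_smul s)) fun z => ?_
      rw [conv_apply_swap, ← integral_const_mul]
      refine norm_integral_le_of_norm_le (f := fun t => ρ (s • z - t) • F t) (hF.norm.const_mul B')
        (ae_of_all _ fun t => ?_)
      rw [norm_smul]
      exact mul_le_mul_of_nonneg_right (hB' _) (norm_nonneg _)
  -- The damping factor cancels the zeroth order term of the equation, so that the derivative of `E`
  -- is a negative multiple of the right-hand side averaged along the heat flow of `η`.
  set E : ℝ → ℝ := fun s => Real.exp (-(a * s ^ 2 / (2 * k))) * G s with hE
  have hEd : ∀ s, HasDerivAt E (-(s / k) * Real.exp (-(a * s ^ 2 / (2 * k)))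
      * ∫ y, F y * gauss s η y) s := by
    intro s
    have h1 : HasDerivAt (fun s : ℝ => -(a * s ^ 2 / (2 * k))) (-(a * s / k)) s := by
      have h2 := ((((hasDerivAt_id s).pow 2).const_mul a).div_const (2 * k)).neg
      refine h2.congr_deriv ?_
      simp only [id, Nat.cast_ofNat, Nat.add_one_sub_one, pow_one, mul_one]
      field_simp
    refine (h1.exp.mul (hGd s)).congr_deriv ?_
    have h3 : ∫ z, gam z * Laplacian.laplacian v (s • z)
        = (a * G s - ∫ y, F y * gauss s η y) / k := by
      rw [eq_div_iff hk.ne', mul_comm, hlap]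
    rw [h3]
    field_simp
    ring
  have hanti : AntitoneOn E (Set.Ici 0) := by
    refine antitoneOn_of_deriv_nonpos (convex_Ici 0)
      (fun s _ => (hEd s).continuousAt.continuousWithinAt)
      (fun s _ => (hEd s).differentiableAt.differentiableWithinAt) fun s hs => ?_
    rw [interior_Ici] at hs
    have hs' : 0 < s := hs
    rw [(hEd s).deriv, neg_mul, neg_mul]
    have := hpos η hη h0 hηH s hs'
    have : 0 ≤ s / k * Real.exp (-(a * s ^ 2 / (2 * k))) * ∫ y, F y * gauss s η y := by positivity
    linarith
  have hle := hanti (Set.mem_Ici.2 le_rfl) (Set.mem_Ici.2 hr.le) hr.le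
  have hE0 : E 0 = ∫ x, η x * D x := by
    simp only [hE, hG, zero_smul]
    rw [integral_mul_const, integral_gam, hv, conv_apply_swap]
    simp [hρdef]
  rw [hE0] at hle
  simp only [hE, hG] at hle
  rw [hv, integral_gam_conv hη hDm hD hr, ← integral_const_mul] at hle
  refine le_trans (le_of_eq (integral_congr_ae (ae_of_all _ fun x => ?_))) hle
  simp only [Pi.smul_apply, smul_eq_mul]; ring

/-! ### Positivity and phases -/

lemma gauss_nonneg {f : E5 → ℝ} (hf : ∀ x, 0 ≤ f x) (r : ℝ) (x : E5) : 0 ≤ gauss r f x :=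
  integral_nonneg fun z => mul_nonneg (gam_pos z).le (hf _)

/-- The Gaussian average of a nonnegative function vanishes nowhere or the function is zero. -/
lemma ae_zero_of_gauss_eq_zero {f : E5 → ℝ} (hf : MemLp f 2) (h0 : ∀ᵐ x, 0 ≤ f x) {r : ℝ} (hr : 0 < r)
    {x : E5} (h : gauss r f x ≤ 0) : ∀ᵐ x, f x = 0 := by
  rw [gauss_eq hr] at h
  have hnn : 0 ≤ᵐ[volume] fun w => gam (r⁻¹ • (w - x)) * f w := by
    filter_upwards [h0] with w hw
    exact mul_nonneg (gam_pos _).le hw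
  have h1 : ∫ w, gam (r⁻¹ • (w - x)) * f w = 0 := by
    refine le_antisymm ?_ (integral_nonneg_of_ae hnn)
    exact nonpos_of_mul_nonpos_right h (by positivity)
  rw [integral_eq_zero_iff_of_nonneg_ae hnn (integrable_gauss' hf hr x)] at h1
  filter_upwards [h1] with w hw
  exact (mul_eq_zero.1 hw).resolve_left (gam_pos _).ne'

lemma SolvesReal.gauss_le_of_nonneg {a k : ℝ} (hk : 0 < k) {D F : E5 → ℝ} (h : SolvesReal a k D F)
    (hDm : Measurable D) (hD : MemLp D 2) (hF : Integrable F) (hF0 : ∀ᵐ x, 0 ≤ F x) {r : ℝ}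
    (hr : 0 < r) : ∀ᵐ x, Real.exp (-(a * r ^ 2 / (2 * k))) * gauss r D x ≤ D x := by
  have := h.gauss_le hk hDm hD hF isOpen_univ (fun η _ h0 _ r _ => by
    refine integral_nonneg_of_ae ?_
    filter_upwards [hF0] with y hy
    exact mul_nonneg hy (gauss_nonneg h0 r y)) hr
  filter_upwards [this] with x hx using hx (Set.mem_univ x)

/-- The **strong maximum principle**. -/
lemma SolvesReal.ae_pos {a k : ℝ} (hk : 0 < k) {D F : E5 → ℝ} (h : SolvesReal a k D F)
    (hDm : Measurable D) (hD : MemLp D 2) (hF : Integrable F) (hF0 : ∀ᵐ x, 0 ≤ F x)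
    (hD0 : ∀ᵐ x, 0 ≤ D x) (hne : ¬ ∀ᵐ x, D x = 0) : ∀ᵐ x, 0 < D x := by
  filter_upwards [h.gauss_le_of_nonneg hk hDm hD hF hF0 one_pos] with x hx
  refine lt_of_lt_of_le (mul_pos (Real.exp_pos _) ?_) hx
  by_contra hle
  exact hne (ae_zero_of_gauss_eq_zero hD hD0 one_pos (not_lt.1 hle))

lemma SolvesWeakly.re_mul {a k : ℝ} {φ F : E5 → ℂ} (h : SolvesWeakly a k φ F)
    (hφ : LocallyIntegrable φ) (hF : LocallyIntegrable F) (c : ℂ) :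
    SolvesReal a k (fun x => (c * φ x).re) (fun x => (c * F x).re) := by
  intro ψ hψ
  have key : ∀ (η : E5 → ℝ), IsTest η → ∀ g : E5 → ℂ, LocallyIntegrable g →
      ∫ x, η x * (c * g x).re = (c * ∫ x, η x • g x).re := by
    intro η hη g hg
    rw [← integral_const_mul]
    have hi : Integrable fun x => c * (η x • g x) := (hη.integrable_smul hg).const_mul c
    have h1 : ∫ x, RCLike.re (c * (η x • g x)) = RCLike.re (∫ x, c * (η x • g x)) := integral_re hi
    refine Eq.trans (integral_congr_ae (ae_of_all _ fun x => ?_)) h1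
    change η x * (c * g x).re = (c * (η x • g x)).re
    rw [mul_smul_comm, Complex.smul_re, smul_eq_mul]
  have htest : IsTest (fun x => a * ψ x - k * Laplacian.laplacian ψ x) :=
    ⟨(contDiff_const.mul hψ.1).sub (contDiff_const.mul hψ.laplacian.1),
      (hψ.2.mul_left).sub hψ.laplacian.2.mul_left⟩
  rw [key _ htest φ hφ, key ψ hψ F hF, h ψ hψ]

lemma SolvesReal.sub {a k : ℝ} {D D' F F' : E5 → ℝ} (h : SolvesReal a k D F)
    (h' : SolvesReal a k D' F') (hD : LocallyIntegrable D) (hD' : LocallyIntegrable D')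
    (hF : LocallyIntegrable F) (hF' : LocallyIntegrable F') :
    SolvesReal a k (fun x => D x - D' x) (fun x => F x - F' x) := by
  intro ψ hψ
  have htest : IsTest (fun x => a * ψ x - k * Laplacian.laplacian ψ x) :=
    ⟨(contDiff_const.mul hψ.1).sub (contDiff_const.mul hψ.laplacian.1),
      (hψ.2.mul_left).sub hψ.laplacian.2.mul_left⟩
  simp only [mul_sub]
  have h1 := integral_sub (htest.integrable_smul hD) (htest.integrable_smul hD')
  have h2 := integral_sub (hψ.integrable_smul hF) (hψ.integrable_smul hF')
  simp only [smul_eq_mul] at h1 h2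
  rw [h1, h2, h ψ hψ, h' ψ hψ]

lemma norm_le_of_forall_re_le {q : ℂ} {p : ℝ}
    (h : ∀ c : ℂ, ‖c‖ ≤ 1 → (c * q).re ≤ p) : ‖q‖ ≤ p := by
  by_cases hq : q = 0
  · simpa [hq] using h 0 (by simp)
  · have hn : (‖q‖ : ℂ) ≠ 0 := by simpa using hq
    have := h (starRingEnd ℂ q / ‖q‖) (by simp [hq])
    have e : starRingEnd ℂ q / ‖q‖ * q = (‖q‖ : ℂ) := by
      rw [div_mul_eq_mul_div, Complex.conj_mul', sq, mul_div_assoc, div_self hn, mul_one]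
    rwa [e, Complex.ofReal_re] at this

lemma exists_exp_mul_norm (q : ℂ) : ∃ θ : ℝ, q = Complex.exp (Complex.I * (θ : ℂ)) * (‖q‖ : ℂ) :=
  ⟨q.arg, by rw [mul_comm, mul_comm Complex.I]; exact (Complex.norm_mul_exp_arg_mul_I q).symm⟩

lemma eq_norm_of_re_eq {w : ℂ} (h : w.re = ‖w‖) : w = (‖w‖ : ℂ) := by
  have h1 := Complex.sq_norm w
  rw [Complex.normSq_apply, ← h] at h1
  have h2 : w.im = 0 := by nlinarith
  apply Complex.ext
  · simp [h]
  · simp [h2]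

/-- A solution whose modulus is a solution with a dominating right-hand side has constant phase:
the functions `|u| - Re (c u)` with `|c| ≤ 1` lie above their Gaussian averages, which forces equality
in the triangle inequality for the Gaussian average of `u`. -/
lemma exists_phase {a k : ℝ} (hk : 0 < k) {u F : E5 → ℂ} {F₁ : E5 → ℝ} (hu : SolvesWeakly a k u F)
    (hn : SolvesReal a k (fun x => ‖u x‖) F₁) (hum : Measurable u) (hu2 : MemLp u 2)
    (hF : Integrable F) (hF₁ : Integrable F₁) (hle : ∀ᵐ x, ‖F x‖ ≤ F₁ x) :
    ∃ θ : ℝ, ∀ᵐ x, u x = Complex.exp (Complex.I * (θ : ℂ)) * (‖u x‖ : ℂ) := by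
  set τ := Real.exp (-(a * 1 ^ 2 / (2 * k)))
  have hτ : 0 < τ := Real.exp_pos _
  set T : E5 → ℂ := fun x => ∫ z, gam z • u (x + (1 : ℝ) • z) with hT
  set S : E5 → ℝ := gauss 1 fun x => ‖u x‖ with hS
  have hi : ∀ x, Integrable (fun z => gam z • u (x + (1 : ℝ) • z)) := by
    intro x
    have h1 : MemLp (fun z => u ((1 : ℝ) • z + x)) 2 := memLp_comp_affine hu2 one_pos x
    simp_rw [add_comm _ x] at h1
    refine ((memLp_gam.ofReal (K := ℂ)).integrable_mul h1).congr (ae_of_all _ fun z => ?_)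
    exact (Complex.real_smul (x := gam z) (z := u (x + (1 : ℝ) • z))).symm
  have hin : ∀ x, Integrable (fun z => gam z * ‖u (x + (1 : ℝ) • z)‖) := fun x =>
    integrable_gauss hu2.norm one_pos x
  have hgauss : ∀ (c : ℂ) (x : E5),
      gauss 1 (fun x => ‖u x‖ - (c * u x).re) x = S x - (c * T x).re := by
    intro c x
    have h1 : (c * T x).re = ∫ z, gam z * (c * u (x + (1 : ℝ) • z)).re := by
      simp only [hT]
      rw [← integral_const_mul]
      refine Eq.trans (integral_re ((hi x).const_mul c)).symm
        (integral_congr_ae (ae_of_all _ fun z => ?_))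
      change (c * (gam z • u (x + (1 : ℝ) • z))).re = _
      rw [mul_smul_comm, Complex.smul_re, smul_eq_mul]
    have h2 : Integrable (fun z => gam z * (c * u (x + (1 : ℝ) • z)).re) := by
      refine ((hi x).const_mul c).re.congr (ae_of_all _ fun z => ?_)
      change (c * (gam z • u (x + (1 : ℝ) • z))).re = _
      rw [mul_smul_comm, Complex.smul_re, smul_eq_mul]
    rw [h1, hS, gauss, gauss, ← integral_sub (hin x) h2]
    exact integral_congr_ae (ae_of_all _ fun z => by simp only [mul_sub])
  have hcle : ∀ c : ℂ, ‖c‖ ≤ 1 → ∀ᵐ x,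
      τ * (S x - (c * T x).re) ≤ ‖u x‖ - (c * u x).re := by
    intro c hc
    have hs := hn.sub (hu.re_mul (locInt hu2) hF.locallyIntegrable c) (locInt hu2.norm)
      (locInt (hu2.const_mul c).re) hF₁.locallyIntegrable (hF.const_mul c).re.locallyIntegrable
    have := hs.gauss_le_of_nonneg hk
      (hum.norm.sub (Complex.measurable_re.comp (measurable_const.mul hum)))
      (hu2.norm.sub (hu2.const_mul c).re) (hF₁.sub (hF.const_mul c).re) (by
        filter_upwards [hle] with x hx
        have h1 := (Complex.re_le_norm (c * F x)).trans (norm_mul_le c (F x))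
        have h2 := mul_le_mul_of_nonneg_right hc (norm_nonneg (F x))
        linarith) one_pos
    filter_upwards [this] with x hx
    rwa [hgauss] at hx
  -- Countably many `c` suffice by density, so some point `x` serves all `c` in the unit disc at once.
  have hall : ∀ᵐ x, ∀ n : ℕ,
      τ * (S x - ((TopologicalSpace.denseSeq (Metric.closedBall (0 : ℂ) 1) n : ℂ) * T x).re)
        ≤ ‖u x‖ - ((TopologicalSpace.denseSeq (Metric.closedBall (0 : ℂ) 1) n : ℂ) * u x).re := by
    rw [ae_all_iff]
    intro n
    refine hcle _ ?_
    exact mem_closedBall_zero_iff.1 (TopologicalSpace.denseSeq (Metric.closedBall (0 : ℂ) 1) n).2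
  obtain ⟨x, hx⟩ := hall.exists
  have hx' : ∀ c : Metric.closedBall (0 : ℂ) 1,
      τ * (S x - ((c : ℂ) * T x).re) ≤ ‖u x‖ - ((c : ℂ) * u x).re := by
    intro c
    refine (TopologicalSpace.denseRange_denseSeq (Metric.closedBall (0 : ℂ) 1)).induction_on
      (p := fun c => τ * (S x - ((c : ℂ) * T x).re) ≤ ‖u x‖ - ((c : ℂ) * u x).re) c ?_ hx
    exact isClosed_le (by fun_prop) (by fun_prop)
  -- Optimizing over `c` at this point leads to `S x ≤ ‖T x‖`, which is equality in the triangle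
  -- inequality for the average `T x` of `u`.
  have hq : ‖u x - τ * T x‖ ≤ ‖u x‖ - τ * S x := by
    refine norm_le_of_forall_re_le fun c hc => ?_
    have h1 := hx' ⟨c, by simpa using hc⟩
    have e : (c * (u x - τ * T x)).re = (c * u x).re - τ * (c * T x).re := by
      rw [mul_sub, Complex.sub_re, mul_left_comm, Complex.re_ofReal_mul]
    rw [e]
    simp only at h1
    linarith
  have hTS : S x ≤ ‖T x‖ := by
    have h1 := norm_sub_norm_le (u x) (τ * T x)
    rw [norm_mul, Complex.norm_real, Real.norm_of_nonneg hτ.le] at h1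
    exact le_of_mul_le_mul_left (by linarith) hτ
  obtain ⟨θ, hθ⟩ := exists_exp_mul_norm (T x)
  set ζ := Complex.exp (Complex.I * (θ : ℂ)) with hζ
  have hζ1 : ‖ζ‖ = 1 := by rw [hζ, mul_comm]; exact Complex.norm_exp_ofReal_mul_I θ
  have hζc : starRingEnd ℂ ζ * ζ = 1 := by rw [Complex.conj_mul', hζ1]; simp
  have hre : (starRingEnd ℂ ζ * T x).re = ‖T x‖ := by
    rw [hθ, ← mul_assoc, hζc, one_mul, norm_mul, hζ1]
    simp
  -- The phase of `T x` is the phase of `u`: the nonnegative function `|u| - Re (conj ζ u)` has a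
  -- vanishing Gaussian average.
  have hzero := ae_zero_of_gauss_eq_zero (f := fun x => ‖u x‖ - (starRingEnd ℂ ζ * u x).re)
    (hu2.norm.sub (hu2.const_mul _).re) (ae_of_all _ fun x => by
      have h1 := Complex.re_le_norm (starRingEnd ℂ ζ * u x)
      rw [norm_mul, Complex.norm_conj, hζ1, one_mul] at h1
      linarith) one_pos (x := x) (by rw [hgauss, hre]; linarith)
  refine ⟨θ, ?_⟩
  filter_upwards [hzero] with y hy
  have hny : ‖starRingEnd ℂ ζ * u y‖ = ‖u y‖ := by
    rw [norm_mul, Complex.norm_conj, hζ1, one_mul]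
  have h1 := eq_norm_of_re_eq (w := starRingEnd ℂ ζ * u y) (by rw [hny]; linarith)
  rw [hny] at h1
  rw [← hζ, ← h1, ← mul_assoc, mul_comm ζ, hζc, one_mul]

/-! ### Reflection symmetry -/

lemma ae_comp_refl (e : E5) {p : E5 → Prop} (h : ∀ᵐ x, p x) : ∀ᵐ x, p (refl e x) :=
  (measurePreserving_refl e).quasiMeasurePreserving.ae h

lemma norm_sub_le_norm_sub_refl {e : E5} (he : ‖e‖ = 1) {w y : E5} (hw : 0 ≤ inner ℝ e w)
    (hy : 0 ≤ inner ℝ e y) : ‖w - y‖ ≤ ‖w - refl e y‖ := by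
  have h := dist_refl_sq he w y
  rw [dist_eq_norm, dist_eq_norm] at h
  refine le_of_sq_le_sq ?_ (norm_nonneg _)
  nlinarith [mul_nonneg hw hy]

/-- The heat flow of data living in the half-space is larger there than on the other side. -/
lemma gauss_refl_le {e : E5} (he : ‖e‖ = 1) {η : E5 → ℝ} (hη : MemLp η 2) (h0 : ∀ x, 0 ≤ η x)
    (hH : ∀ x, ¬ 0 < inner ℝ e x → η x = 0) {r : ℝ} (hr : 0 < r) {y : E5} (hy : 0 ≤ inner ℝ e y) :
    gauss r η (refl e y) ≤ gauss r η y := by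
  rw [gauss_eq hr, gauss_eq hr]
  refine mul_le_mul_of_nonneg_left ?_ (by positivity)
  refine integral_mono (integrable_gauss' hη hr _) (integrable_gauss' hη hr _) fun w => ?_
  by_cases hw : 0 < inner ℝ e w
  · refine mul_le_mul_of_nonneg_right (gam_le_gam ?_) (h0 w)
    rw [norm_smul, norm_smul]
    exact mul_le_mul_of_nonneg_left (norm_sub_le_norm_sub_refl he hw.le hy) (norm_nonneg _)
  · simp [hH w hw]

/-- Odd functions that are nonnegative on the half-space have positive Gaussian averages there, unless
they vanish: a point of the half-space is closer to `x` than its mirror image. -/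
lemma ae_zero_of_gauss_odd_le {e : E5} (he : ‖e‖ = 1) {D : E5 → ℝ} (hD : MemLp D 2)
    (hodd : ∀ x, D (refl e x) = -D x) (hD0 : ∀ x, 0 ≤ inner ℝ e x → 0 ≤ D x) {x : E5}
    (hx : 0 < inner ℝ e x) (h : gauss 1 D x ≤ 0) : ∀ᵐ w, D w = 0 := by
  have hi := integrable_gauss' hD one_pos x
  rw [gauss_eq one_pos] at h
  simp only [one_pow, inv_one, one_mul, one_smul] at h hi
  have hi2 := Integrable.comp_refl e hi
  have h2 := integral_comp_refl e (fun w => gam (w - x) * D w)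
  simp only [hodd] at h2 hi2
  have hnn : ∀ w, 0 ≤ gam (w - x) * D w + gam (refl e w - x) * -D w := by
    refine forall_of_refl he (fun w hw => ?_) fun w hw => ?_
    · have h3 := norm_sub_le_norm_sub_refl he hx.le hw
      rw [norm_sub_rev, norm_sub_rev x] at h3
      nlinarith [mul_nonneg (sub_nonneg.2 (gam_le_gam h3)) (hD0 w hw)]
    · rw [refl_refl, hodd] at hw; linarith
  have hzero : ∫ w, (gam (w - x) * D w + gam (refl e w - x) * -D w) = 0 := by
    refine le_antisymm ?_ (integral_nonneg hnn)
    rw [integral_add hi hi2, h2]; linarith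
  rw [integral_eq_zero_iff_of_nonneg hnn (hi.add hi2)] at hzero
  filter_upwards [hzero] with w hw
  by_contra hne
  have hw' : (gam (w - x) - gam (refl e w - x)) * D w = 0 := by
    simp only [Pi.zero_apply] at hw; linarith
  have hk : gam (w - x) = gam (refl e w - x) :=
    sub_eq_zero.1 ((mul_eq_zero.1 hw').resolve_right hne)
  have hnorm : ‖w - x‖ = ‖refl e w - x‖ := by
    rcases lt_trichotomy ‖w - x‖ ‖refl e w - x‖ with h3 | h3 | h3
    · exact absurd hk (gam_lt_gam h3).ne'
    · exact h3
    · exact absurd hk (gam_lt_gam h3).ne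
  have hd := dist_refl_sq he x w
  rw [dist_comm, dist_comm x w, dist_eq_norm, dist_eq_norm, hnorm] at hd
  have hw0 : inner ℝ e w = 0 := by
    rcases mul_eq_zero.1 (show inner ℝ e x * inner ℝ e w = 0 by linarith) with h3 | h3
    · exact absurd h3 hx.ne'
    · exact h3
  have hfix : refl e w = w := by rw [refl_apply he, hw0]; simp
  have := hodd w
  rw [hfix] at this
  exact hne (by linarith)

/-- The strong maximum principle on a half-space for odd solutions. As the right-hand side need not
be odd, its sum with its mirror image is assumed to be nonnegative as well. -/
lemma SolvesReal.ae_zero_or_pos_of_odd {a k : ℝ} (hk : 0 < k) {D F : E5 → ℝ}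
    (h : SolvesReal a k D F) (hDm : Measurable D) (hD : MemLp D 2) (hF : Integrable F) {e : E5}
    (he : ‖e‖ = 1) (hodd : ∀ x, D (refl e x) = -D x) (hD0 : ∀ x, 0 ≤ inner ℝ e x → 0 ≤ D x)
    (hF0 : ∀ x, 0 ≤ inner ℝ e x → 0 ≤ F x)
    (hFs : ∀ x, 0 ≤ inner ℝ e x → 0 ≤ F x + F (refl e x)) :
    (∀ᵐ x, D x = 0) ∨ ∀ᵐ x, 0 < inner ℝ e x → 0 < D x := by
  by_cases hz : ∀ᵐ x, D x = 0
  · exact Or.inl hz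
  refine Or.inr ?_
  have hopen : IsOpen {x : E5 | 0 < inner ℝ e x} := isOpen_lt continuous_const (by fun_prop)
  have hg := h.gauss_le hk hDm hD hF hopen (fun η hη h0 hH r hr => by
    have hη2 := hη.memLp 2
    obtain ⟨C, hC⟩ := exists_bound_gauss hη2 hr
    have hi : Integrable fun y => F y * gauss r η y := by
      simp_rw [mul_comm (F _)]
      refine hF.bdd_mul (c := C)
        (measurable_gauss hη.1.continuous.measurable r).aestronglyMeasurable
        (ae_of_all _ fun y => (norm_integral_le_integral_norm _).trans (hC y))
    have := integral_le_of_add_refl_le e (integrable_zero E5 ℝ volume) hi (fun y => by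
      refine forall_of_refl he (p := fun y => (0 : ℝ) + 0 ≤ F y * gauss r η y
        + F (refl e y) * gauss r η (refl e y)) (fun y hy => ?_) (fun y hy => ?_) y
      · have h1 := gauss_refl_le he hη2 h0 hH hr hy
        have h2 := gauss_nonneg h0 r (refl e y)
        nlinarith [mul_nonneg (hF0 y hy) (sub_nonneg.2 h1), mul_nonneg (hFs y hy) h2]
      · rw [refl_refl] at hy; linarith)
    simpa using this) one_pos
  filter_upwards [hg] with x hx hxe
  refine lt_of_lt_of_le (mul_pos (Real.exp_pos _) ?_) (hx hxe)
  by_contra hle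
  exact hz (ae_zero_of_gauss_odd_le he hD hodd hD0 hxe (not_lt.1 hle))

/-- The nonlinear terms of a real triple. -/
def rnonlin (f : Fin 3 → E5 → ℝ) : Fin 3 → E5 → ℝ :=
  ![fun x => f 1 x * f 2 x, fun x => f 0 x * f 2 x, fun x => f 0 x * f 1 x]

lemma nonlin_toC (f : Fin 3 → E5 → ℝ) (j : Fin 3) (x : E5) :
    nonlin (toC f) j x = (rnonlin f j x : ℂ) := by
  fin_cases j <;> simp [nonlin, rnonlin, toC]

lemma memLp_of_toC {f : Fin 3 → E5 → ℝ} (hf : ∀ j, MemH1 (toC f j)) (j : Fin 3) : MemLp (f j) 2 :=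
  memLp_ofReal_iff.1 (hf j).1

lemma integrable_rnonlin {f : Fin 3 → E5 → ℝ} (hf : ∀ j, MemH1 (toC f j)) (j : Fin 3) :
    Integrable (rnonlin f j) := by
  refine (integrable_nonlin (fun j => (hf j).1) j).re.congr (ae_of_all _ fun x => ?_)
  simp only [nonlin_toC]
  exact Complex.ofReal_re _

lemma IsOpt.solvesReal {κ : Fin 3 → ℝ} {f : Fin 3 → E5 → ℝ} (hu : IsOpt κ (toC f)) (j : Fin 3) :
    SolvesReal (massCoef j / (2 * M (toC f))) (5 * κ j / (2 * K κ (toC f))) (f j)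
      (fun x => 2 / V (toC f) * rnonlin f j x) := by
  have h := (hu.solvesWeakly j).re_mul (locInt (hu.mem j).1)
    ((integrable_nonlin (fun j => (hu.mem j).1) j).const_mul _).locallyIntegrable 1
  simp only [nonlin_toC, one_mul, ← Complex.ofReal_mul, Complex.ofReal_re] at h
  exact h

lemma IsOpt.V_pos_of_nonneg {κ : Fin 3 → ℝ} {f : Fin 3 → E5 → ℝ} (hu : IsOpt κ (toC f))
    (h0 : ∀ j x, 0 ≤ f j x) : 0 < V (toC f) := by
  refine lt_of_le_of_ne ?_ hu.V_ne.symm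
  rw [V_toC]
  exact integral_nonneg fun x => mul_nonneg (mul_nonneg (h0 0 x) (h0 1 x)) (h0 2 x)

lemma rnonlin_nonneg {f : Fin 3 → E5 → ℝ} (h0 : ∀ j x, 0 ≤ f j x) (j : Fin 3) (x : E5) :
    0 ≤ rnonlin f j x := by
  fin_cases j
  · exact mul_nonneg (h0 1 x) (h0 2 x)
  · exact mul_nonneg (h0 0 x) (h0 2 x)
  · exact mul_nonneg (h0 0 x) (h0 1 x)

lemma IsOpt.kappa_div_pos {κ : Fin 3 → ℝ} (hκ : ∀ j, 0 < κ j) {u : Fin 3 → E5 → ℂ} (hu : IsOpt κ u)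
    (j : Fin 3) : 0 < 5 * κ j / (2 * K κ u) := by
  have := hκ j
  have := hu.K_pos
  positivity

/-- Nonnegative optimal triples are positive. -/
lemma IsOpt.ae_pos {κ : Fin 3 → ℝ} (hκ : ∀ j, 0 < κ j) {f : Fin 3 → E5 → ℝ} (hu : IsOpt κ (toC f))
    (hm : ∀ j, Measurable (f j)) (h0 : ∀ j x, 0 ≤ f j x) (j : Fin 3) : ∀ᵐ x, 0 < f j x := by
  have hV := hu.V_pos_of_nonneg h0
  refine (hu.solvesReal j).ae_pos (hu.kappa_div_pos hκ j) (hm j) (memLp_of_toC hu.mem j)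
    ((integrable_rnonlin hu.mem j).const_mul _)
    (ae_of_all _ fun x => mul_nonneg (by positivity) (rnonlin_nonneg h0 j x))
    (ae_of_all _ (h0 j)) fun hz => hV.ne' ?_
  rw [V_toC]
  refine integral_eq_zero_of_ae ?_
  filter_upwards [hz] with x hx
  fin_cases j <;> simp_all

/-- An optimal triple is, on each side of a hyperplane through the origin, comparable with its mirror
image: all components at once are at least as large as their mirror images, or the first component is
smaller almost everywhere. -/
lemma IsOpt.reflection_alternative {κ : Fin 3 → ℝ} (hκ : ∀ j, 0 < κ j) {f : Fin 3 → E5 → ℝ}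
    (hu : IsOpt κ (toC f)) (hm : ∀ j, Measurable (f j)) (h0 : ∀ j x, 0 ≤ f j x) {e : E5}
    (he : ‖e‖ = 1) :
    (∀ j, ∀ᵐ x, 0 < inner ℝ e x → f j (refl e x) ≤ f j x) ∨
      ∀ᵐ x, 0 < inner ℝ e x → f 0 x < f 0 (refl e x) := by
  obtain ⟨hp, hpK, hpM, hpV⟩ := hu.pol hκ hm h0 he
  set p : Fin 3 → E5 → ℝ := fun j => NLSSystem.pol e (f j) with hpdef
  have hV := hu.V_pos_of_nonneg h0
  have hs := hp.solvesReal 0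
  rw [hpK, hpM, hpV] at hs
  have hip := (integrable_rnonlin hp.mem 0).const_mul (2 / V (toC f))
  have hif := (integrable_rnonlin hu.mem 0).const_mul (2 / V (toC f))
  -- The polarized triple has the same energies, hence solves the same equations, and the difference of
  -- the first components is odd and nonnegative on the half-space.
  have hsol := hs.sub (hu.solvesReal 0) (locInt (memLp_of_toC hp.mem 0))
    (locInt (memLp_of_toC hu.mem 0)) hip.locallyIntegrable hif.locallyIntegrable
  have hmax : ∀ j x, 0 ≤ inner ℝ e x → p j x = max (f j x) (f j (refl e x)) :=
    fun j x hx => pol_of_nonneg (f j) hx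
  have hmin : ∀ j x, 0 ≤ inner ℝ e x → p j (refl e x) = min (f j x) (f j (refl e x)) :=
    fun j x hx => pol_refl_of_nonneg he (f j) hx
  have hfp : ∀ j x, 0 ≤ inner ℝ e x → f j x ≤ p j x := fun j x hx => by
    rw [hmax j x hx]; exact le_max_left _ _
  have hc : 0 ≤ 2 / V (toC f) := by positivity
  have hr : ∀ (g : Fin 3 → E5 → ℝ) (x : E5), rnonlin g 0 x = g 1 x * g 2 x := fun g x => rfl
  rcases hsol.ae_zero_or_pos_of_odd (hu.kappa_div_pos hκ 0) ((measurable_pol e (hm 0)).sub (hm 0))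
    ((memLp_of_toC hp.mem 0).sub (memLp_of_toC hu.mem 0)) (hip.sub hif) he
    (forall_of_refl he (fun x hx => by
      rw [hmin 0 x hx, hmax 0 x hx]
      linarith [max_add_min (f 0 x) (f 0 (refl e x))]) (fun x hx => by
      rw [refl_refl] at hx; linarith))
    (fun x hx => sub_nonneg.2 (hfp 0 x hx))
    (fun x hx => by
      rw [← mul_sub, hr, hr]
      exact mul_nonneg hc (sub_nonneg.2 (mul_le_mul (hfp 1 x hx) (hfp 2 x hx) (h0 2 x)
        ((h0 1 x).trans (hfp 1 x hx)))))
    (fun x hx => by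
      rw [← mul_sub, ← mul_sub, ← mul_add]
      simp only [hr]
      rw [hmax 1 x hx, hmax 2 x hx, hmin 1 x hx, hmin 2 x hx]
      refine mul_nonneg hc ?_
      linarith [mul_add_mul_le_max_min (f 1 x) (f 1 (refl e x)) (f 2 x) (f 2 (refl e x))])
    with hz | hz
  · left
    -- If the first component is unchanged by polarization, so is the product of the other two, and by
    -- positivity so are these.
    have hF0 : ∀ᵐ x, 2 / V (toC f) * rnonlin p 0 x - 2 / V (toC f) * rnonlin f 0 x = 0 := by
      refine ae_eq_zero_of_integral_contDiff_smul_eq_zero (hip.sub hif).locallyIntegrable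
        fun ψ h1 h2 => ?_
      have h3 := hsol ψ ⟨h1, h2⟩
      refine Eq.trans h3.symm (integral_eq_zero_of_ae ?_)
      filter_upwards [hz] with x hx
      rw [hx, mul_zero]; rfl
    have hpos := hu.ae_pos hκ hm h0
    intro j
    filter_upwards [hz, hF0, hpos 1, hpos 2] with x hx hFx h1 h2 hxe
    have e0 : p 0 x = f 0 x := sub_eq_zero.1 hx
    have hprod : p 1 x * p 2 x = f 1 x * f 2 x := by
      rw [← mul_sub, hr, hr] at hFx
      exact sub_eq_zero.1 ((mul_eq_zero.1 hFx).resolve_left (by positivity))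
    have l1 := hfp 1 x hxe.le
    have l2 := hfp 2 x hxe.le
    have e1 : p 1 x = f 1 x := by
      refine le_antisymm ?_ l1
      refine le_of_mul_le_mul_right ?_ (h2.trans_le l2)
      rw [hprod]
      exact mul_le_mul_of_nonneg_left l2 h1.le
    have e2 : p 2 x = f 2 x := by
      refine mul_left_cancel₀ h1.ne' ?_
      rw [← hprod, e1]
    have hj : p j x = f j x := by fin_cases j <;> assumption
    rw [← hj, hmax j x hxe.le]
    exact le_max_right _ _
  · right
    filter_upwards [hz] with x hx hxe
    have h1 := hx hxe
    rw [hmax 0 x hxe.le] at h1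
    by_contra hle
    rw [max_eq_left (not_lt.1 hle), sub_self] at h1
    exact lt_irrefl _ h1

/-- The sign of a real number, as a real number. -/
def sgn (s : ℝ) : ℝ := if 0 < s then 1 else if s < 0 then -1 else 0

lemma sgn_of_pos {s : ℝ} (h : 0 < s) : sgn s = 1 := if_pos h

lemma sgn_of_neg {s : ℝ} (h : s < 0) : sgn s = -1 := by
  rw [sgn, if_neg (not_lt.2 h.le), if_pos h]

lemma sgn_zero : sgn 0 = 0 := by simp [sgn]

lemma sgn_neg (s : ℝ) : sgn (-s) = -sgn s := by
  rcases lt_trichotomy s 0 with h | rfl | h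
  · rw [sgn_of_neg h, sgn_of_pos (by linarith), neg_neg]
  · simp [sgn_zero]
  · rw [sgn_of_pos h, sgn_of_neg (by linarith)]

lemma abs_sgn_le (s : ℝ) : |sgn s| ≤ 1 := by
  rw [sgn]; split_ifs <;> simp

lemma measurable_sgn : Measurable sgn :=
  Measurable.ite (measurableSet_lt measurable_const measurable_id) measurable_const
    (Measurable.ite (measurableSet_lt measurable_id measurable_const) measurable_const
      measurable_const)

/-- The hyperplane through the origin orthogonal to `e` bisects the density `g`. -/
def Bisects (e : E5) (g : E5 → ℝ) : Prop := ∫ x, sgn (inner ℝ e x) * g x = 0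

lemma integrable_sgn_mul (e : E5) {g : E5 → ℝ} (hg : Integrable g) :
    Integrable fun x => sgn (inner ℝ e x) * g x :=
  hg.bdd_mul (measurable_sgn.comp (by fun_prop)).aestronglyMeasurable
    (ae_of_all _ fun x => abs_sgn_le _)

lemma Bisects.neg {e : E5} {g : E5 → ℝ} (h : Bisects e g) : Bisects (-e) g := by
  rw [Bisects] at h ⊢
  simp only [inner_neg_left, sgn_neg, neg_mul]
  rw [integral_neg, h, neg_zero]

lemma refl_neg {e : E5} (he : ‖e‖ = 1) (x : E5) : refl (-e) x = refl e x := by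
  rw [refl_apply (by rwa [norm_neg]), refl_apply he, inner_neg_left]
  simp

lemma Bisects.not_lt {e : E5} (he : ‖e‖ = 1) {g : E5 → ℝ} (hg : Integrable g) (h : Bisects e g) :
    ¬ ∀ᵐ x, 0 < inner ℝ e x → g x < g (refl e x) := by
  intro hlt
  have hi := integrable_sgn_mul e hg
  have hi2 := Integrable.comp_refl e hi
  have h2 := integral_comp_refl e (fun x => sgn (inner ℝ e x) * g x)
  simp only [inner_refl he, sgn_neg] at hi2 h2
  have hs : 0 ≤ᵐ[volume] fun x => -(sgn (inner ℝ e x) * g x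
      + -sgn (inner ℝ e x) * g (refl e x)) := by
    filter_upwards [hlt, ae_comp_refl e hlt] with x h3 h4
    rw [inner_refl he, refl_refl] at h4
    simp only [Pi.zero_apply]
    rcases lt_trichotomy (inner ℝ e x) 0 with h5 | h5 | h5
    · rw [sgn_of_neg h5]; linarith [h4 (by linarith)]
    · simp [h5, sgn_zero]
    · rw [sgn_of_pos h5]; linarith [h3 h5]
  have hz : ∫ x, -(sgn (inner ℝ e x) * g x + -sgn (inner ℝ e x) * g (refl e x)) = 0 := by
    rw [integral_neg, integral_add hi hi2, h2, h]; simp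
  have hae := (integral_eq_zero_iff_of_nonneg_ae hs (hi.add hi2).neg).1 hz
  have hnull : ∀ᵐ x : E5, ¬ 0 < inner ℝ e x := by
    filter_upwards [hae, hlt] with x h3 h4 h5
    simp only [sgn_of_pos h5, Pi.zero_apply] at h3
    linarith [h4 h5]
  have hopen : IsOpen {x : E5 | 0 < inner ℝ e x} := isOpen_lt continuous_const (by fun_prop)
  have hpos := hopen.measure_pos volume ⟨e, by
    simp only [Set.mem_ofPred_eq, real_inner_self_eq_norm_sq, he]; norm_num⟩
  refine hpos.ne' ?_
  rw [ae_iff] at hnull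
  simpa only [not_not] using hnull

/-- An optimal triple is symmetric with respect to every hyperplane that bisects the mass of its first
component. -/
lemma IsOpt.comp_refl_ae_eq {κ : Fin 3 → ℝ} (hκ : ∀ j, 0 < κ j) {f : Fin 3 → E5 → ℝ}
    (hu : IsOpt κ (toC f)) (hm : ∀ j, Measurable (f j)) (h0 : ∀ j x, 0 ≤ f j x) {e : E5}
    (he : ‖e‖ = 1) (hb : Bisects e fun x => f 0 x ^ 2) (j : Fin 3) :
    ∀ᵐ x, f j (refl e x) = f j x := by
  have key : ∀ e : E5, ‖e‖ = 1 → Bisects e (fun x => f 0 x ^ 2) →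
      ∀ᵐ x, 0 < inner ℝ e x → f j (refl e x) ≤ f j x := by
    intro e he hb
    rcases hu.reflection_alternative hκ hm h0 he with h | h
    · exact h j
    · refine absurd ?_ (hb.not_lt he (memLp_of_toC hu.mem 0).integrable_sq)
      filter_upwards [h] with x hx hxe
      exact pow_lt_pow_left₀ (hx hxe) (h0 0 x) two_ne_zero
  -- Both sides of the hyperplane play the same role, as `-e` bisects as well.
  have k1 := key e he hb
  have k2 := key (-e) (by rwa [norm_neg]) hb.neg
  simp only [refl_neg he, inner_neg_left] at k2
  filter_upwards [k1, k2, ae_comp_refl e k1, ae_comp_refl e k2] with x h1 h2 h3 h4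
  rw [inner_refl he, refl_refl] at h3 h4
  rcases lt_trichotomy (inner ℝ e x) 0 with h5 | h5 | h5
  · exact le_antisymm (h2 (by linarith)) (h3 (by linarith))
  · rw [refl_apply he, h5]; simp
  · exact le_antisymm (h1 h5) (h4 (by linarith))

/-! ### Centering and radial symmetry -/

lemma volume_hyperplane (i : Fin 5) (t : ℝ) : volume {x : E5 | x i = t} = 0 := by
  have h := (EuclideanSpace.volume_preserving_symm_measurableEquiv_toLp (Fin 5)).measure_preimage_equiv
    {f : Fin 5 → ℝ | f i = t}
  have h2 : volume {f : Fin 5 → ℝ | f i = t} = 0 := by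
    rw [volume_pi]
    exact Measure.pi_hyperplane (fun _ : Fin 5 => (volume : Measure ℝ)) i t
  rw [h2] at h
  exact h

/-- Some hyperplane orthogonal to a coordinate direction bisects a given density. -/
lemma exists_bisecting {g : E5 → ℝ} (hg : Integrable g) (hpos : 0 < ∫ x, g x) (i : Fin 5) :
    ∃ t : ℝ, ∫ x : E5, sgn (x i - t) * g x = 0 := by
  set G : ℝ → ℝ := fun t => ∫ x : E5, sgn (x i - t) * g x with hG
  have hmeas : ∀ t, AEStronglyMeasurable (fun x : E5 => sgn (x i - t) * g x) := fun t =>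
    (measurable_sgn.comp (by fun_prop)).aestronglyMeasurable.mul hg.1
  have hbound : ∀ t, ∀ᵐ x : E5, ‖sgn (x i - t) * g x‖ ≤ ‖g x‖ := fun t =>
    ae_of_all _ fun x => by
      rw [norm_mul]
      exact mul_le_of_le_one_left (norm_nonneg _) (abs_sgn_le _)
  have hcont : Continuous G := by
    rw [continuous_iff_continuousAt]
    intro t
    refine continuousAt_of_dominated (Eventually.of_forall hmeas) (Eventually.of_forall hbound)
      hg.norm ?_
    have hne : ∀ᵐ x : E5, x i ≠ t := by
      rw [ae_iff]; simpa using volume_hyperplane i t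
    filter_upwards [hne] with x hx
    refine ContinuousAt.congr (f := fun _ => sgn (x i - t) * g x) continuousAt_const ?_
    rcases lt_or_gt_of_ne hx with h | h
    · filter_upwards [lt_mem_nhds h] with s hs
      rw [sgn_of_neg (by linarith), sgn_of_neg (by linarith)]
    · filter_upwards [gt_mem_nhds h] with s hs
      rw [sgn_of_pos (by linarith), sgn_of_pos (by linarith)]
  have htop : Tendsto G atTop (𝓝 (∫ x, -g x)) := by
    refine tendsto_integral_filter_of_dominated_convergence _ (Eventually.of_forall hmeas)
      (Eventually.of_forall hbound) hg.norm (ae_of_all _ fun x => ?_)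
    refine tendsto_const_nhds.congr' ?_
    filter_upwards [eventually_gt_atTop (x i)] with t ht
    rw [sgn_of_neg (by linarith)]; ring
  have hbot : Tendsto G atBot (𝓝 (∫ x, g x)) := by
    refine tendsto_integral_filter_of_dominated_convergence _ (Eventually.of_forall hmeas)
      (Eventually.of_forall hbound) hg.norm (ae_of_all _ fun x => ?_)
    refine tendsto_const_nhds.congr' ?_
    filter_upwards [eventually_lt_atBot (x i)] with t ht
    rw [sgn_of_pos (by linarith)]; ring
  rw [integral_neg] at htop
  obtain ⟨s, hs⟩ := (htop.eventually_lt_const (show -∫ x, g x < 0 by linarith)).exists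
  obtain ⟨s', hs'⟩ := (hbot.eventually_const_lt hpos).exists
  exact mem_range_of_exists_le_of_exists_ge hcont ⟨s, hs.le⟩ ⟨s', hs'.le⟩

lemma IsOpt.congr {κ : Fin 3 → ℝ} {u v : Fin 3 → E5 → ℂ} (hu : IsOpt κ u)
    (h : ∀ j, u j =ᵐ[volume] v j) : IsOpt κ v := by
  have hM : M v = M u := by simp only [M, normL2Sq_congr (h _)]
  have hK : K κ v = K κ u := by
    simp only [K]
    exact Finset.sum_congr rfl fun j _ => by rw [normH1DotSq_congr (hu.mem j) (h j)]
  have hV : V v = V u := (V_congr h).symm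
  refine ⟨fun j => (hu.mem j).congr (h j), hM ▸ hu.M_pos, hK ▸ hu.K_pos, hV ▸ hu.V_ne, ?_⟩
  rw [hM, hK, hV]
  exact hu.le

/-- Optimality is invariant under the symmetries of the problem. -/
lemma IsOpt.rescale {κ : Fin 3 → ℝ} {u : Fin 3 → E5 → ℂ} (hu : IsOpt κ u) {m l : ℝ} (hm : 0 < m)
    (hl : 0 < l) (b : E5) : IsOpt κ (rescale m l b u) := by
  have hM := M_rescale u m hl b
  have hK := K_rescale κ hu.mem m hl b
  have hV := V_rescale u m hl b
  have hM0 := hu.M_pos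
  have hK0 := hu.K_pos
  have hV0 := hu.V_ne
  refine ⟨memH1_rescale hu.mem m hl b, ?_, ?_, ?_, fun w hw => ?_⟩
  · rw [hM]; positivity
  · rw [hK]; positivity
  · rw [hV]; positivity
  · have h := hu.le w hw
    rw [hM, hK, hV]
    have hc : 0 < m ^ 12 * ((l ^ 5)⁻¹) ^ 4 := by positivity
    have e1 : V w ^ 4 * (m ^ 2 * (l ^ 5)⁻¹ * M u * (m ^ 2 * (l ^ 2 * (l ^ 5)⁻¹) * K κ u) ^ 5)
        = m ^ 12 * ((l ^ 5)⁻¹) ^ 4 * (V w ^ 4 * (M u * K κ u ^ 5)) := by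
      field_simp
    have e2 : (m ^ 3 * (l ^ 5)⁻¹ * V u) ^ 4 * (M w * K κ w ^ 5)
        = m ^ 12 * ((l ^ 5)⁻¹) ^ 4 * (V u ^ 4 * (M w * K κ w ^ 5)) := by ring
    rw [e1, e2]
    exact mul_le_mul_of_nonneg_left h hc.le

lemma rescale_toC (m l : ℝ) (b : E5) (f : Fin 3 → E5 → ℝ) :
    rescale m l b (toC f) = toC fun j x => m * f j (l • x + b) := by
  funext j x
  simp [NLSSystem.rescale, toC]

lemma norm_single_one (i : Fin 5) : ‖(EuclideanSpace.single i (1 : ℝ) : E5)‖ = 1 := by simp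

lemma inner_single_left' (i : Fin 5) (x : E5) :
    inner ℝ (EuclideanSpace.single i (1 : ℝ)) x = x i := by
  rw [real_inner_comm, inner_single_right]

/-- Reflecting in all coordinate hyperplanes is the reflection in the origin. -/
lemma refl_all (x : E5) :
    refl (EuclideanSpace.single 0 1) (refl (EuclideanSpace.single 1 1)
      (refl (EuclideanSpace.single 2 1) (refl (EuclideanSpace.single 3 1)
        (refl (EuclideanSpace.single 4 1) x)))) = -x := by
  ext k
  simp only [refl_apply (norm_single_one _), inner_single_left']
  fin_cases k <;> simp <;> ring

/-- A function symmetric with respect to all coordinate hyperplanes is even, and thus each hyperplane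
through the origin bisects it. -/
lemma bisects_of_symm {g : E5 → ℝ}
    (h : ∀ i : Fin 5, ∀ᵐ x, g (refl (EuclideanSpace.single i 1) x) = g x) (e : E5) :
    Bisects e g := by
  have heven : ∀ᵐ x, g (-x) = g x := by
    have h4 := h 4
    have h3 := ae_comp_refl (EuclideanSpace.single 4 1) (h 3)
    have h2 := ae_comp_refl (EuclideanSpace.single 4 1)
      (ae_comp_refl (EuclideanSpace.single 3 1) (h 2))
    have h1 := ae_comp_refl (EuclideanSpace.single 4 1)
      (ae_comp_refl (EuclideanSpace.single 3 1) (ae_comp_refl (EuclideanSpace.single 2 1) (h 1)))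
    have h0 := ae_comp_refl (EuclideanSpace.single 4 1)
      (ae_comp_refl (EuclideanSpace.single 3 1) (ae_comp_refl (EuclideanSpace.single 2 1)
        (ae_comp_refl (EuclideanSpace.single 1 1) (h 0))))
    filter_upwards [h0, h1, h2, h3, h4] with x e0 e1 e2 e3 e4
    rw [← refl_all x, e0, e1, e2, e3, e4]
  have h1 : ∫ x, sgn (inner ℝ e x) * g x = -∫ x, sgn (inner ℝ e x) * g x := by
    rw [← integral_neg]
    conv_lhs => rw [← integral_neg_eq_self]
    refine integral_congr_ae ?_
    filter_upwards [heven] with x hx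
    rw [hx, inner_neg_right, sgn_neg, neg_mul]
  rw [Bisects]; linarith

/-- A function invariant under all reflections is radial; its profile is obtained from ball averages
with centres on a ray. -/
lemma exists_radial_profile {f : E5 → ℝ} (hf : LocallyIntegrable f)
    (h : ∀ e : E5, ‖e‖ = 1 → ∀ᵐ x, f (refl e x) = f x) : ∃ g : ℝ → ℝ, ∀ᵐ x, f x = g ‖x‖ := by
  set A : ℕ → E5 → ℝ := fun n x => ⨍ y in Metric.closedBall x (1 / ((n : ℝ) + 1)), f y with hA
  have hinv : ∀ e : E5, ‖e‖ = 1 → ∀ n x, A n (refl e x) = A n x := by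
    intro e he n x
    simp only [hA]
    rw [setAverage_eq, setAverage_eq]
    have hpre : refl e ⁻¹' Metric.closedBall (refl e x) (1 / ((n : ℝ) + 1))
        = Metric.closedBall x (1 / ((n : ℝ) + 1)) := by
      rw [LinearIsometryEquiv.preimage_closedBall]
      congr 1
      exact (refl e).symm_apply_apply x
    have h1 := (measurePreserving_refl e).setIntegral_preimage_emb
      (refl e).toHomeomorph.measurableEmbedding f
      (Metric.closedBall (refl e x) (1 / ((n : ℝ) + 1)))
    have h2 := (measurePreserving_refl e).measureReal_preimage
      (s := Metric.closedBall (refl e x) (1 / ((n : ℝ) + 1)))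
      Metric.isClosed_closedBall.measurableSet.nullMeasurableSet
    rw [hpre] at h1 h2
    rw [← h1, h2]
    congr 1
    refine setIntegral_congr_ae Metric.isClosed_closedBall.measurableSet ?_
    filter_upwards [h e he] with y hy _ using hy
  set e0 : E5 := EuclideanSpace.single 0 1 with he0
  -- Any two points of equal norm are mirror images in some hyperplane.
  have hray : ∀ n x, A n (‖x‖ • e0) = A n x := by
    intro n x
    by_cases hx : x = ‖x‖ • e0
    · rw [← hx]
    · set w := x - ‖x‖ • e0 with hw
      have hw0 : ‖w‖ ≠ 0 := by rw [norm_ne_zero_iff, hw]; exact sub_ne_zero.2 hx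
      have hn : ‖x‖ = ‖‖x‖ • e0‖ := by rw [norm_smul, he0, norm_single_one]; simp
      have hspan : (ℝ ∙ ((‖w‖)⁻¹ • w)) = ℝ ∙ w :=
        Submodule.span_singleton_smul_eq (isUnit_iff_ne_zero.2 (inv_ne_zero hw0)) w
      have hr : refl ((‖w‖)⁻¹ • w) x = ‖x‖ • e0 := by
        have h1 := Submodule.reflection_sub (v := x) (w := ‖x‖ • e0) hn
        rw [refl]
        simp only [hspan]
        exact h1
      rw [← hr]
      exact hinv _ (by rw [norm_smul, norm_inv, norm_norm, inv_mul_cancel₀ hw0]) n x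
  -- The limit exists for the radii of almost all points, by Lebesgue's differentiation theorem.
  refine ⟨fun ρ => limUnder atTop fun n => A n (ρ • e0), ?_⟩
  have hleb := IsUnifLocDoublingMeasure.ae_tendsto_average (volume : Measure E5) hf 1
  have hδ : Tendsto (fun n : ℕ => 1 / ((n : ℝ) + 1)) atTop (𝓝[>] 0) := by
    refine tendsto_nhdsWithin_iff.2 ⟨tendsto_one_div_add_atTop_nhds_zero_nat, ?_⟩
    exact Eventually.of_forall fun n => Set.mem_Ioi.2 (by positivity)
  filter_upwards [hleb] with x hx
  have h1 := hx (fun _ : ℕ => x) (fun n => 1 / ((n : ℝ) + 1)) hδ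
    (Eventually.of_forall fun n => Metric.mem_closedBall_self (by positivity))
  have h2 : Tendsto (fun n => A n (‖x‖ • e0)) atTop (𝓝 (f x)) := by
    simp_rw [hray]; exact h1
  exact h2.limUnder_eq.symm

/-- After a translation, nonnegative optimal triples are radial. -/
lemma IsOpt.exists_radial {κ : Fin 3 → ℝ} (hκ : ∀ j, 0 < κ j) {f : Fin 3 → E5 → ℝ}
    (hu : IsOpt κ (toC f)) (hm : ∀ j, Measurable (f j)) (h0 : ∀ j x, 0 ≤ f j x) :
    ∃ b : E5, ∀ j, ∃ g : ℝ → ℝ, ∀ᵐ x, f j (x + b) = g ‖x‖ := by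
  have hf2 : ∀ j, Integrable fun x => f j x ^ 2 := fun j => (memLp_of_toC hu.mem j).integrable_sq
  have hpos : 0 < ∫ x, f 0 x ^ 2 := by
    refine lt_of_le_of_ne (integral_nonneg fun x => sq_nonneg _) fun h => ?_
    have h1 := (integral_eq_zero_iff_of_nonneg (fun x => sq_nonneg (f 0 x)) (hf2 0)).1 h.symm
    obtain ⟨x, hx1, hx2⟩ := (h1.and (hu.ae_pos hκ hm h0 0)).exists
    simp only [Pi.zero_apply] at hx1
    exact hx2.ne' (pow_eq_zero_iff two_ne_zero |>.1 hx1)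
  choose t ht using exists_bisecting (hf2 0) hpos
  set b : E5 := WithLp.toLp 2 t with hb
  set f' : Fin 3 → E5 → ℝ := fun j x => f j (x + b) with hf'
  have hu' : IsOpt κ (toC f') := by
    -- Moving `b` to the origin turns the bisecting hyperplanes into coordinate hyperplanes.
    have h := hu.rescale one_pos one_pos b
    rw [rescale_toC] at h
    simpa only [one_smul, one_mul] using h
  have hm' : ∀ j, Measurable (f' j) := fun j => (hm j).comp (measurable_add_const b)
  have h0' : ∀ j x, 0 ≤ f' j x := fun j x => h0 j _
  have hbis : ∀ i : Fin 5, Bisects (EuclideanSpace.single i 1) fun x => f' 0 x ^ 2 := by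
    intro i
    rw [Bisects, ← ht i, ← integral_add_right_eq_self (fun x : E5 => sgn (x i - t i) * f 0 x ^ 2) b]
    refine integral_congr_ae (ae_of_all _ fun x => ?_)
    simp only [inner_single_left', hf']
    congr 2
    simp [hb]
  have hsymm : ∀ e : E5, Bisects e fun x => f' 0 x ^ 2 := by
    refine bisects_of_symm fun i => ?_
    filter_upwards [hu'.comp_refl_ae_eq hκ hm' h0' (norm_single_one i) (hbis i) 0] with x hx
    rw [hx]
  exact ⟨b, fun j => exists_radial_profile (locInt (memLp_of_toC hu'.mem j)) fun e he =>
    hu'.comp_refl_ae_eq hκ hm' h0' he (hsymm e) j⟩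

/-! ### The scale of ground states -/

lemma gauss_neg (r : ℝ) (f : E5 → ℝ) (x : E5) : gauss r (fun x => -f x) x = -gauss r f x := by
  simp only [gauss, mul_neg, integral_neg]

lemma gauss_le_bound {f : E5 → ℝ} (hf : MemLp f 2) {r : ℝ} (hr : 0 < r) (x : E5) :
    gauss r f x ≤ r⁻¹ * (∫ z, gam z ^ 2) + r * ((r ^ 5)⁻¹ * ∫ y, f y ^ 2) := by
  have h1 := memLp_gam.integrable_sq.const_mul r⁻¹
  have h2 := (integrable_comp_affine hf.integrable_sq hr x).const_mul r
  have h3 := integral_comp_affine (fun x => f x ^ 2) hr x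
  rw [smul_eq_mul] at h3
  rw [← h3, ← integral_const_mul, ← integral_const_mul, ← integral_add h1 h2]
  refine integral_mono (integrable_gauss hf hr x) (h1.add h2) fun z => ?_
  simp only
  rw [add_comm x]
  have h4 : r⁻¹ * gam z ^ 2 + r * f (r • z + x) ^ 2 - gam z * f (r • z + x)
      = r⁻¹ * ((gam z - r * f (r • z + x) / 2) ^ 2 + 3 / 4 * (r * f (r • z + x)) ^ 2) := by
    field_simp; ring
  have h5 : 0 ≤ r⁻¹ * ((gam z - r * f (r • z + x) / 2) ^ 2 + 3 / 4 * (r * f (r • z + x)) ^ 2) := by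
    positivity
  linarith

lemma le_gauss {f : E5 → ℝ} (hf : MemLp f 2) (h0 : ∀ᵐ x, 0 ≤ f x) {r : ℝ} (hr : 1 ≤ r) (x : E5) :
    (r ^ 5)⁻¹ * gauss 1 f x ≤ gauss r f x := by
  have hr0 : 0 < r := by linarith
  rw [gauss_eq one_pos, gauss_eq hr0]
  refine mul_le_mul_of_nonneg_left ?_ (by positivity)
  simp only [one_pow, inv_one, one_mul, one_smul]
  have h1 := integrable_gauss' hf one_pos x
  simp only [inv_one, one_smul] at h1
  refine integral_mono_ae h1 (integrable_gauss' hf hr0 x) ?_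
  filter_upwards [h0] with w hw
  refine mul_le_mul_of_nonneg_right (gam_le_gam ?_) hw
  rw [norm_smul, Real.norm_of_nonneg (by positivity)]
  exact mul_le_of_le_one_left (norm_nonneg _) (inv_le_one_of_one_le₀ hr)

lemma SolvesReal.neg {a k : ℝ} {D F : E5 → ℝ} (h : SolvesReal a k D F) :
    SolvesReal a k (fun x => -D x) (fun x => -F x) := by
  intro ψ hψ
  simp only [mul_neg, integral_neg, h ψ hψ]

/-- The Laplacian has no nonnegative square-integrable eigenfunctions. -/
lemma SolvesReal.eq_zero_of_homogeneous {a k : ℝ} (hak : a ≠ 0 ∨ k ≠ 0) {D : E5 → ℝ}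
    (h : SolvesReal a k D fun _ => 0) (hDm : Measurable D) (hD : MemLp D 2) (hD0 : ∀ᵐ x, 0 ≤ D x) :
    ∀ᵐ x, D x = 0 := by
  have main : ∀ a k : ℝ, 0 < k → SolvesReal a k D (fun _ => 0) → ∀ᵐ x, D x = 0 := by
    intro a k hk h
    have hi : Integrable (fun _ : E5 => (0 : ℝ)) := integrable_zero _ _ _
    rcases le_or_gt 0 a with ha | ha
    -- Comparison applied to `-D`: then `D` is below its averages, which decay at large scales as `D` is
    -- square integrable.
    · have h1 : ∀ᵐ x, ∀ n : ℕ, D x ≤ gauss (n + 1) D x := by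
        rw [ae_all_iff]
        intro n
        have hn : (0 : ℝ) < n + 1 := by positivity
        have h2 := h.neg
        simp only [neg_zero] at h2
        have hg : ∀ᵐ x, 0 ≤ gauss (n + 1) D x := by
          refine ae_of_all _ fun x => ?_
          rw [gauss_eq hn]
          refine mul_nonneg (by positivity) (integral_nonneg_of_ae ?_)
          filter_upwards [hD0] with w hw using mul_nonneg (gam_pos _).le hw
        filter_upwards [h2.gauss_le_of_nonneg hk hDm.neg hD.neg hi (ae_of_all _ fun _ => le_rfl) hn,
          hg] with x hx hgx
        rw [gauss_neg] at hx
        have hexp : Real.exp (-(a * ((n : ℝ) + 1) ^ 2 / (2 * k))) ≤ 1 := by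
          rw [Real.exp_le_one_iff]
          have : 0 ≤ a * ((n : ℝ) + 1) ^ 2 / (2 * k) := by positivity
          linarith
        nlinarith [mul_le_mul_of_nonneg_right hexp hgx]
      filter_upwards [h1, hD0] with x hx hx0
      refine le_antisymm ?_ hx0
      have hlim : Tendsto (fun n : ℕ => (1 / ((n : ℝ) + 1)) * ((∫ z, gam z ^ 2) + ∫ y, D y ^ 2))
          atTop (𝓝 0) := by
        simpa using tendsto_one_div_add_atTop_nhds_zero_nat.mul_const
          ((∫ z, gam z ^ 2) + ∫ y, D y ^ 2)
      refine ge_of_tendsto' hlim fun n => ?_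
      have hn1 : (1 : ℝ) ≤ n + 1 := by linarith [n.cast_nonneg (α := ℝ)]
      have hn : (0 : ℝ) < n + 1 := by linarith
      refine ((hx n).trans (gauss_le_bound hD hn x)).trans ?_
      have hI : 0 ≤ ∫ y, D y ^ 2 := integral_nonneg fun y => sq_nonneg _
      have h3 : ((n : ℝ) + 1) * (((n : ℝ) + 1) ^ 5)⁻¹ ≤ ((n : ℝ) + 1)⁻¹ := by
        rw [← div_eq_mul_inv, div_le_iff₀ (by positivity), pow_succ, ← mul_assoc,
          mul_comm _ ((n : ℝ) + 1), ← mul_assoc, mul_inv_cancel₀ hn.ne', one_mul]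
        calc (n : ℝ) + 1 = ((n : ℝ) + 1) ^ 1 := (pow_one _).symm
          _ ≤ ((n : ℝ) + 1) ^ 4 := pow_le_pow_right₀ hn1 (by norm_num)
      have h4 := mul_le_mul_of_nonneg_right h3 hI
      rw [one_div, mul_add]
      linarith
    -- Now `D` is above averages whose weights grow like `exp (c r²)`, while the averages decay at most
    -- like `r⁻⁵`; thus `D` would be infinite.
    · by_contra hne
      have hpos : ∀ x, 0 < gauss 1 D x := fun x => by
        by_contra hle
        exact hne (ae_zero_of_gauss_eq_zero hD hD0 one_pos (not_lt.1 hle))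
      have h1 : ∀ᵐ x, ∀ n : ℕ, Real.exp (-(a * ((n : ℝ) + 1) ^ 2 / (2 * k))) * gauss (n + 1) D x
          ≤ D x := by
        rw [ae_all_iff]
        intro n
        exact h.gauss_le_of_nonneg hk hDm hD hi (ae_of_all _ fun _ => le_rfl) (by positivity)
      obtain ⟨x, hx⟩ := h1.exists
      set c := -a / (2 * k) with hc
      have hc0 : 0 < c := div_pos (by linarith) (by linarith)
      have hP := hpos x
      have hgrow : ∀ n : ℕ, c ^ 3 / 6 * gauss 1 D x * ((n : ℝ) + 1) ≤ D x := by
        intro n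
        have hn1 : (1 : ℝ) ≤ n + 1 := by linarith [n.cast_nonneg (α := ℝ)]
        have hn : (0 : ℝ) < n + 1 := by linarith
        refine le_trans ?_ (hx n)
        have e1 : -(a * ((n : ℝ) + 1) ^ 2 / (2 * k)) = c * ((n : ℝ) + 1) ^ 2 := by rw [hc]; ring
        have h2 := Real.pow_div_factorial_le_exp (c * ((n : ℝ) + 1) ^ 2) (by positivity) 3
        have h3 := le_gauss hD hD0 hn1 x
        rw [e1]
        refine le_trans (le_of_eq ?_) (mul_le_mul h2 h3 (by positivity) (Real.exp_pos _).le)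
        simp only [Nat.factorial]
        push_cast
        field_simp
      obtain ⟨n, hn⟩ := exists_nat_gt (D x / (c ^ 3 / 6 * gauss 1 D x))
      rw [div_lt_iff₀ (by positivity)] at hn
      have := hgrow n
      nlinarith [mul_pos (by positivity : 0 < c ^ 3 / 6) hP]
  rcases lt_trichotomy k 0 with hk | rfl | hk
  · refine main (-a) (-k) (by linarith) fun ψ hψ => ?_
    have h1 := h ψ hψ
    have e : ∀ x, (-a * ψ x - -k * Laplacian.laplacian ψ x) * D x
        = -((a * ψ x - k * Laplacian.laplacian ψ x) * D x) := fun x => by ring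
    simp_rw [e]
    rw [integral_neg, h1]
    simp
  · have ha : a ≠ 0 := by simpa using hak
    refine ae_eq_zero_of_integral_contDiff_smul_eq_zero (locInt hD) fun ψ h1 h2 => ?_
    have h3 := h ψ ⟨h1, h2⟩
    simp only [zero_mul, sub_zero, mul_zero, integral_zero, mul_assoc] at h3
    rw [integral_const_mul] at h3
    exact (mul_eq_zero.1 h3).resolve_left ha
  · exact main a k hk h

lemma SolvesReal.smul {a k : ℝ} {D F : E5 → ℝ} (h : SolvesReal a k D F) (c : ℝ) :
    SolvesReal (c * a) (c * k) D (fun x => c * F x) := by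
  intro ψ hψ
  have e1 : ∀ x, (c * a * ψ x - c * k * Laplacian.laplacian ψ x) * D x
      = c * ((a * ψ x - k * Laplacian.laplacian ψ x) * D x) := fun x => by ring
  simp_rw [e1, mul_left_comm _ c]
  rw [integral_const_mul, integral_const_mul, h ψ hψ]

lemma SolvesReal.sub_coeff {a k a' k' : ℝ} {D F F' : E5 → ℝ} (h : SolvesReal a k D F)
    (h' : SolvesReal a' k' D F') (hD : LocallyIntegrable D) (hF : LocallyIntegrable F)
    (hF' : LocallyIntegrable F') :
    SolvesReal (a - a') (k - k') D (fun x => F x - F' x) := by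
  intro ψ hψ
  have htest : ∀ a k : ℝ, IsTest (fun x => a * ψ x - k * Laplacian.laplacian ψ x) := fun a k =>
    ⟨(contDiff_const.mul hψ.1).sub (contDiff_const.mul hψ.laplacian.1),
      (hψ.2.mul_left).sub hψ.laplacian.2.mul_left⟩
  have h1 := integral_sub ((htest a k).integrable_smul hD) ((htest a' k').integrable_smul hD)
  have h2 := integral_sub (hψ.integrable_smul hF) (hψ.integrable_smul hF')
  simp only [smul_eq_mul] at h1 h2
  rw [h ψ hψ, h' ψ hψ, ← h2] at h1
  simp only [mul_sub]
  rw [← h1]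
  exact integral_congr_ae (ae_of_all _ fun x => by ring)

lemma SolvesWeakly.congr {a k : ℝ} {φ φ' F F' : E5 → ℂ} (h : SolvesWeakly a k φ F)
    (h1 : φ =ᵐ[volume] φ') (h2 : F =ᵐ[volume] F') : SolvesWeakly a k φ' F' := by
  intro ψ hψ
  have e1 : ∫ x, (a * ψ x - k * Laplacian.laplacian ψ x) • φ' x
      = ∫ x, (a * ψ x - k * Laplacian.laplacian ψ x) • φ x :=
    integral_congr_ae (by filter_upwards [h1] with x hx; rw [hx])
  have e2 : ∫ x, ψ x • F' x = ∫ x, ψ x • F x :=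
    integral_congr_ae (by filter_upwards [h2] with x hx; rw [hx])
  rw [e1, e2, h ψ hψ]

/-- Ground states satisfy the **Pohozaev identities** `K = 5 M` and `V = 4 M`: otherwise the difference
of the elliptic system and the Euler–Lagrange equations would make the first component an
eigenfunction of the Laplacian. -/
lemma IsGroundState.isOpt_and_energies {κ : Fin 3 → ℝ} (hκ : ∀ j, 0 < κ j) {Q : Fin 3 → E5 → ℂ}
    (hQ : IsGroundState κ Q) : IsOpt κ Q ∧ K κ Q = 5 * M Q ∧ V Q = 4 * M Q := by
  have hopt := isOpt_of_J_eq hκ hQ.mem hQ.minimal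
  have hmeas := fun j => (hopt.mem j).1.1.aemeasurable
  set f : Fin 3 → E5 → ℝ := fun j x => max 0 ((hmeas j).mk (Q j) x).re with hf
  have hfm : ∀ j, Measurable (f j) := fun j =>
    measurable_const.max (Complex.measurable_re.comp (hmeas j).measurable_mk)
  have hf0 : ∀ j x, 0 ≤ f j x := fun j x => le_max_left _ _
  have hQf : ∀ j, Q j =ᵐ[volume] toC f j := by
    intro j
    filter_upwards [(hmeas j).ae_eq_mk, hQ.nonneg j] with x hx hx0
    simp only [toC, hf]
    rw [← hx, max_eq_right hx0.1]
    exact Complex.ext (by simp) (by simp [hx0.2])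
  have hu : IsOpt κ (toC f) := hopt.congr hQf
  have hM : M (toC f) = M Q := by simp only [M, normL2Sq_congr (hQf _)]
  have hK : K κ (toC f) = K κ Q := by
    simp only [K]
    exact Finset.sum_congr rfl fun j _ => by rw [normH1DotSq_congr (hopt.mem j) (hQf j)]
  have hV : V (toC f) = V Q := (V_congr hQf).symm
  have hVpos := hu.V_pos_of_nonneg hf0
  have hMpos := hu.M_pos
  have hKpos := hu.K_pos
  have hloc := locInt (memLp_of_toC hu.mem 0)
  have hi := integrable_rnonlin hu.mem 0
  have hsys : SolvesReal 1 (κ 0) (f 0) (rnonlin f 0) := by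
    have h1 := hQ.solves.1.congr (hQf 0) (F' := nonlin (toC f) 0) (by
      filter_upwards [hQf 1, hQf 2] with x h1 h2
      rw [h1, h2, nonlin_toC]
      simp [rnonlin, toC])
    have h2 := h1.re_mul (locInt (hu.mem 0).1)
      (integrable_nonlin (fun j => (hu.mem j).1) 0).locallyIntegrable 1
    simp only [nonlin_toC, one_mul, Complex.ofReal_re] at h2
    exact h2
  -- Both equations for the first component have the same right-hand side, so their difference is
  -- homogeneous.
  have hdiff := (hu.solvesReal 0).sub_coeff (hsys.smul (2 / V (toC f))) hloc
    (hi.const_mul _).locallyIntegrable (hi.const_mul _).locallyIntegrable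
  simp only [sub_self] at hdiff
  have hcoef : massCoef 0 / (2 * M (toC f)) - 2 / V (toC f) * 1 = 0 ∧
      5 * κ 0 / (2 * K κ (toC f)) - 2 / V (toC f) * κ 0 = 0 := by
    by_contra hne
    rw [not_and_or] at hne
    have hz := hdiff.eq_zero_of_homogeneous hne (hfm 0) (memLp_of_toC hu.mem 0)
      (ae_of_all _ (hf0 0))
    obtain ⟨x, hx1, hx2⟩ := (hz.and (hu.ae_pos hκ hfm hf0 0)).exists
    exact hx2.ne' hx1
  have hκ0 := hκ 0
  obtain ⟨c1, c2⟩ := hcoef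
  have e0 : massCoef 0 = 1 := rfl
  rw [e0] at c1
  have hVM : V (toC f) = 4 * M (toC f) := by
    field_simp at c1; linarith
  have hKM : K κ (toC f) = 5 * M (toC f) := by
    have c3 : 5 * V (toC f) = 4 * K κ (toC f) := by
      field_simp at c2
      have := (mul_eq_zero.1 (c2.trans (mul_zero _))).resolve_left hκ0.ne'
      linarith
    linarith
  rw [hM, hK] at hKM
  rw [hM, hV] at hVM
  exact ⟨hopt, hKM, hVM⟩

lemma IsGroundState.M_eq {κ : Fin 3 → ℝ} (hκ : ∀ j, 0 < κ j) {Q Q' : Fin 3 → E5 → ℂ}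
    (hQ : IsGroundState κ Q) (hQ' : IsGroundState κ Q') : M Q = M Q' := by
  have key : ∀ {Q Q' : Fin 3 → E5 → ℂ}, IsGroundState κ Q → IsGroundState κ Q' → M Q ≤ M Q' := by
    intro Q Q' hQ hQ'
    obtain ⟨h1, hK, hV⟩ := hQ.isOpt_and_energies hκ
    obtain ⟨h1', hK', hV'⟩ := hQ'.isOpt_and_energies hκ
    have h := h1.le Q' h1'.mem
    rw [hK, hV, hK', hV'] at h
    have hp := h1.M_pos
    have hp' := h1'.M_pos
    have h2 : (256 * 3125 * M Q ^ 4 * M Q' ^ 4) * M Q ^ 2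
        ≤ (256 * 3125 * M Q ^ 4 * M Q' ^ 4) * M Q' ^ 2 := by linarith
    exact le_of_sq_le_sq (le_of_mul_le_mul_left h2 (by positivity)) hp'.le
  exact le_antisymm (key hQ hQ') (key hQ' hQ)

/-! ### Reduction of optimal triples to ground states -/

/-- The components of an optimal triple have constant phases. -/
lemma IsOpt.exists_phases {κ : Fin 3 → ℝ} (hκ : ∀ j, 0 < κ j) {u : Fin 3 → E5 → ℂ} (hu : IsOpt κ u)
    (hm : ∀ j, Measurable (u j)) (j : Fin 3) :
    ∃ θ : ℝ, ∀ᵐ x, u j x = Complex.exp (Complex.I * (θ : ℂ)) * (‖u j x‖ : ℂ) := by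
  obtain ⟨hn, hK, hV⟩ := hu.norm hκ
  have hM : M (toC fun j x => ‖u j x‖) = M u := by
    have h : ∀ j, normL2Sq (toC (fun j x => ‖u j x‖) j) = normL2Sq (u j) :=
      fun j => normL2Sq_norm (u j)
    simp only [M, h]
  have hs := hn.solvesReal j
  rw [hM, hK, hV] at hs
  refine exists_phase (hu.kappa_div_pos hκ j) (hu.solvesWeakly j) hs (hm j) (hu.mem j).1
    ((integrable_nonlin (fun j => (hu.mem j).1) j).const_mul _)
    ((integrable_rnonlin hn.mem j).const_mul _) (ae_of_all _ fun x => le_of_eq ?_)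
  have h1 : ‖nonlin u j x‖ = rnonlin (fun j x => ‖u j x‖) j x := by
    fin_cases j <;> simp [nonlin, rnonlin]
  rw [norm_mul, Complex.norm_real, h1, Real.norm_eq_abs, abs_div, abs_of_pos (two_pos (α := ℝ))]

lemma SolvesWeakly.smul {a k : ℝ} {φ F : E5 → ℂ} (h : SolvesWeakly a k φ F) (c : ℝ) :
    SolvesWeakly (c * a) (c * k) φ (fun x => (c : ℂ) * F x) := by
  intro ψ hψ
  have e1 : ∀ x, (c * a * ψ x - c * k * Laplacian.laplacian ψ x) • φ x
      = c • ((a * ψ x - k * Laplacian.laplacian ψ x) • φ x) := fun x => by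
    rw [smul_smul]; congr 1; ring
  have e2 : ∀ x, ψ x • ((c : ℂ) * F x) = c • (ψ x • F x) := fun x => by
    rw [← Complex.real_smul, smul_comm]
  simp_rw [e1, e2]
  rw [integral_smul, integral_smul, h ψ hψ]

/-- Optimal triples on the right scale solve the elliptic system. -/
lemma IsOpt.solvesEllipticSystem {κ : Fin 3 → ℝ} {f : Fin 3 → E5 → ℝ} (hu : IsOpt κ (toC f))
    (hK : K κ (toC f) = 5 * M (toC f)) (hV : V (toC f) = 4 * M (toC f)) :
    SolvesEllipticSystem κ (toC f) := by
  have hM := hu.M_pos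
  have key : ∀ j, SolvesWeakly (massCoef j) (κ j) (toC f j) (nonlin (toC f) j) := by
    intro j
    have h := (hu.solvesWeakly j).smul (2 * M (toC f))
    rw [hK, hV] at h
    have e1 : 2 * M (toC f) * (massCoef j / (2 * M (toC f))) = massCoef j := by field_simp
    have e2 : 2 * M (toC f) * (5 * κ j / (2 * (5 * M (toC f)))) = κ j := by field_simp
    have e3 : ∀ x, ((2 * M (toC f) : ℝ) : ℂ) * (((2 / (4 * M (toC f)) : ℝ) : ℂ)
        * nonlin (toC f) j x) = nonlin (toC f) j x := by
      intro x
      rw [← mul_assoc, ← Complex.ofReal_mul]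
      have : 2 * M (toC f) * (2 / (4 * M (toC f))) = 1 := by field_simp; norm_num
      rw [this, Complex.ofReal_one, one_mul]
    rw [e1, e2] at h
    simp_rw [e3] at h
    exact h
  refine ⟨(key 0).congr EventuallyEq.rfl (ae_of_all _ fun x => ?_),
    (key 1).congr EventuallyEq.rfl (ae_of_all _ fun x => ?_), key 2⟩ <;>
  simp [nonlin, toC]

/-- Every optimal triple is a ground state up to the symmetries of the problem. -/
lemma IsOpt.exists_groundState {κ : Fin 3 → ℝ} (hκ : ∀ j, 0 < κ j) {u : Fin 3 → E5 → ℂ}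
    (hu : IsOpt κ u) : ∃ Q : Fin 3 → E5 → ℂ, IsGroundState κ Q ∧
      ∃ (m n : ℝ) (θ : Fin 3 → ℝ) (x₀ : E5), 0 < m ∧ 0 < n ∧
        ∀ j, ∀ᵐ x, u j x =
          Complex.exp (Complex.I * (θ j : ℂ)) * (m : ℂ) * Q j (n • (x - x₀)) := by
  have hmeas := fun j => (hu.mem j).1.1.aemeasurable
  set v : Fin 3 → E5 → ℂ := fun j => (hmeas j).mk (u j) with hv
  have huv : ∀ j, u j =ᵐ[volume] v j := fun j => (hmeas j).ae_eq_mk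
  have hvm : ∀ j, Measurable (v j) := fun j => (hmeas j).measurable_mk
  have hvo : IsOpt κ v := hu.congr huv
  choose θ hθ using hvo.exists_phases hκ hvm
  set f : Fin 3 → E5 → ℝ := fun j x => ‖v j x‖ with hf
  have hfm : ∀ j, Measurable (f j) := fun j => (hvm j).norm
  have hf0 : ∀ j x, 0 ≤ f j x := fun j x => norm_nonneg _
  have hfo : IsOpt κ (toC f) := (hvo.norm hκ).1
  obtain ⟨b, hb⟩ := hfo.exists_radial hκ hfm hf0
  have hM := hfo.M_pos
  have hK := hfo.K_pos
  have hV := hfo.V_pos_of_nonneg hf0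
  -- The scale on which the Euler–Lagrange equations become the elliptic system.
  set l := Real.sqrt (5 * M (toC f) / K κ (toC f)) with hl
  have hl0 : 0 < l := Real.sqrt_pos.2 (by positivity)
  have hl2 : l ^ 2 * K κ (toC f) = 5 * M (toC f) := by
    rw [hl, Real.sq_sqrt (by positivity)]; field_simp
  set m := 4 * M (toC f) / V (toC f) with hmdef
  have hm0 : 0 < m := by positivity
  have hmV : m * V (toC f) = 4 * M (toC f) := by rw [hmdef]; field_simp
  set g : Fin 3 → E5 → ℝ := fun j x => m * f j (l • x + b) with hg
  have hgr : NLSSystem.rescale m l b (toC f) = toC g := rescale_toC m l b f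
  have hgo : IsOpt κ (toC g) := hgr ▸ hfo.rescale hm0 hl0 b
  have hgM : M (toC g) = m ^ 2 * (l ^ 5)⁻¹ * M (toC f) := by rw [← hgr, M_rescale _ _ hl0]
  have hgK : K κ (toC g) = 5 * M (toC g) := by
    rw [hgM, ← hgr, K_rescale κ hfo.mem m hl0 b]
    linear_combination m ^ 2 * (l ^ 5)⁻¹ * hl2
  have hgV : V (toC g) = 4 * M (toC g) := by
    rw [hgM, ← hgr, V_rescale _ m hl0 b]
    linear_combination m ^ 2 * (l ^ 5)⁻¹ * hmV
  refine ⟨toC g, ⟨hgo.mem_H1Nonzero, fun j => ae_of_all _ fun x => ?_, fun j => ?_,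
    hgo.solvesEllipticSystem hgK hgV, hgo.J_eq hκ⟩, m⁻¹, l⁻¹, θ, b, inv_pos.2 hm0, inv_pos.2 hl0,
    fun j => ?_⟩
  · exact ⟨by simpa [toC] using mul_nonneg hm0.le (hf0 j _), by simp [toC]⟩
  · obtain ⟨p, hp⟩ := hb j
    refine ⟨fun ρ => ((m * p (l * ρ) : ℝ) : ℂ), ?_⟩
    filter_upwards [ae_comp_affine hp hl0 0] with x hx
    simp only [add_zero, norm_smul, Real.norm_of_nonneg hl0.le] at hx
    simp only [toC, hg]
    rw [hx]
  · filter_upwards [huv j, hθ j] with x h1 h2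
    have h3 : l • l⁻¹ • (x - b) + b = x := by
      rw [smul_smul, mul_inv_cancel₀ hl0.ne', one_smul, sub_add_cancel]
    rw [h1, h2]
    simp only [toC, hg]
    rw [h3, Complex.ofReal_mul, ← mul_assoc, mul_assoc (Complex.exp _), ← Complex.ofReal_mul,
      inv_mul_cancel₀ hm0.ne', Complex.ofReal_one, mul_one]

end NLSSystem

end

theorem proposition3p1 (κ : Fin 3 → ℝ) (hκ : ∀ j, 0 < κ j) :
    -- the minimum of `J` over `H¹ ∖ {0}` is finite and attained
    (NLSSystem.Jmin κ < ⊤ ∧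
      ∃ u ∈ NLSSystem.H1Nonzero, NLSSystem.J κ u = NLSSystem.Jmin κ) ∧
    -- up to translation, scaling and phases every minimizer is a ground state
    (∀ u ∈ NLSSystem.H1Nonzero, NLSSystem.J κ u = NLSSystem.Jmin κ →
      ∃ Q : Fin 3 → NLSSystem.E5 → ℂ, NLSSystem.IsGroundState κ Q ∧
        ∃ (m n : ℝ) (θ : Fin 3 → ℝ) (x₀ : NLSSystem.E5), 0 < m ∧ 0 < n ∧
          ∀ j, ∀ᵐ x, u j x =
            Complex.exp (Complex.I * (θ j : ℂ)) * (m : ℂ) * Q j (n • (x - x₀))) ∧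
    -- all ground states have the same mass
    (∀ Q Q' : Fin 3 → NLSSystem.E5 → ℂ,
      NLSSystem.IsGroundState κ Q → NLSSystem.IsGroundState κ Q' →
        NLSSystem.M Q = NLSSystem.M Q') := by
  obtain ⟨u, hu, -⟩ := NLSSystem.exists_isOpt hκ
  exact ⟨⟨NLSSystem.Jmin_lt_top hκ, u, hu.mem_H1Nonzero, hu.J_eq hκ⟩,
    fun v hv h => (NLSSystem.isOpt_of_J_eq hκ hv h).exists_groundState hκ,
    fun Q Q' hQ hQ' => hQ.M_eq hκ hQ'⟩
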